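/- Let $S^3\subset\mathbb R^4=\mathbb H$ be the unit sphere with its round metric, let $W\subseteq S^3$ be a connected open set, and let $\mathcal F$ be a fibration of $W$ by great circles: $W$ is the disjoint union of the members of $\mathcal F$, each of which is a great circle, and they are the fibers of a locally trivial circle bundle over a surface. Identify the oriented great circles of $S^3$ (the oriented $2$-planes of $\mathbb R^4$) with the points of $S^2\times S^2$, where $S^2$ is the sphere of unit imaginary quaternions: the oriented plane with oriented orthonormal basis $(x,y)$ corresponds to $(u,v)=(yx^{-1},x^{-1}y)$, so that $(u,v)$ corresponds to the great circle $\{x\in S^3 : ux=xv\}$, and reversing the orientation replaces $(u,v)$ by $(-u,-v)$. Under this identification a fibration by great circles is the graph of a (distance-decreasing) map $f$ from an open subset of one factor $S^2$ to the other factor. Assume that this map is of class $C^2$; that is, around each of its members, $\mathcal F$ is given as the graph of a $C^2$ map from an open set of one factor $S^2$ to the other. Assume that $\mathcal F$ is locally fiberwise homogeneous: for any two fibers $C,C'\in\mathcal F$ there are open sets $U\supseteq C$ and $U'\supseteq C'$ of $S^3$ and an isometry $g\colon U\to U'$ (onto) that takes fibers to fibers and satisfies $g(C)=C'$. Then $\mathcal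 F$ is a portion of a Hopf fibration: there is a fibration $\mathcal H$ of $S^3$ with $\mathcal F\subseteq\mathcal H$, where $\mathcal H$ is the image, under an isometry of $S^3$ (an element of $O(4)$), of the standard Hopf fibration of $S^3\subset\mathbb C^2$, whose fibers are the intersections of $S^3$ with the complex lines through the origin. -/

import Mathlib

open scoped Quaternion Manifold ContDiff Topology

noncomputable section

namespace GreatCircle

/-- The round 3-sphere: the unit sphere of `ℝ⁴ = ℍ` (the norm of `ℍ` is the Euclidean norm). -/
abbrev S3 : Type := Metric.sphere (0 : ℍ[ℝ]) 1

/-- The round 2-sphere. -/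
abbrev S2 : Type := Metric.sphere (0 : EuclideanSpace ℝ (Fin 3)) 1

/-- A great circle: the intersection of the 3-sphere with a 2-plane through the origin. -/
def IsGreatCircle (C : Set S3) : Prop :=
  ∃ P : Submodule ℝ ℍ[ℝ], Module.finrank ℝ P = 2 ∧ C = {x : S3 | (x : ℍ[ℝ]) ∈ P}

/-- `F` is (the set of fibers of) a fibration of `W ⊆ S³` by great circles: the members of `F` are
pairwise disjoint great circles with union `W`, and they are the fibers of a locally trivial circle
bundle over a surface. -/
structure IsGreatCircleFibration (W : Set S3) (F : Set (Set S3)) : Prop where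
  isGreatCircle : ∀ C ∈ F, IsGreatCircle C
  pairwiseDisjoint : ∀ C ∈ F, ∀ D ∈ F, C ≠ D → Disjoint C D
  sUnion_eq : ⋃₀ F = W
  locallyTrivial : ∀ C ∈ F, ∃ h : EuclideanSpace ℝ (Fin 2) × Circle → S3,
    Topology.IsOpenEmbedding h ∧
    (∀ b, Set.range (fun t : Circle => h (b, t)) ∈ F) ∧
    (∃ b, Set.range (fun t : Circle => h (b, t)) = C)

/-- The isometric embedding of `S²` as the sphere of unit imaginary quaternions. -/
def imQuat (u : S2) : ℍ[ℝ] :=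
  ⟨0, (u : EuclideanSpace ℝ (Fin 3)) 0, (u : EuclideanSpace ℝ (Fin 3)) 1,
    (u : EuclideanSpace ℝ (Fin 3)) 2⟩

/-- The identification of `S² × S²` with the Grassmannian of oriented 2-planes of `ℝ⁴`, i.e. with
the set of oriented great circles. The oriented plane with oriented orthonormal basis `(x, y)` has
the coordinates `(u, v) = (y x⁻¹, x⁻¹ y)`, unit imaginary quaternions; conversely, the plane with
the coordinates `(u, v)` is `{x | u x = x v}`, oriented by the bases `(x, u x)`. The definition
gives the underlying unoriented circle, so `(u, v)` and `(-u, -v)` have the same value. -/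
def circleOf (u v : S2) : Set S3 :=
  {x : S3 | imQuat u * (x : ℍ[ℝ]) = (x : ℍ[ℝ]) * imQuat v}

/-- The map between the two factors of `S² × S²` whose graph is the fibration `F` is of class `C²`.
This is a local condition: around each of its members, `F` is the graph of a `C²` map from an open
set of one `S²` factor to the other factor. -/
def HasC2GraphMap (F : Set (Set S3)) : Prop :=
  ∀ C ∈ F, ∃ (V : Set S2) (f : S2 → S2), IsOpen V ∧ ContMDiffOn (𝓡 2) (𝓡 2) 2 f V ∧
    (((∀ u ∈ V, circleOf u (f u) ∈ F) ∧ ∃ u ∈ V, circleOf u (f u) = C) ∨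
     ((∀ v ∈ V, circleOf (f v) v ∈ F) ∧ ∃ v ∈ V, circleOf (f v) v = C))

/-- `g` restricts to a (Riemannian) isometry of the open set `U` of `S³` onto the open set `U'`:
a bijection that locally preserves distances. -/
def IsIsometryBetween (g : S3 → S3) (U U' : Set S3) : Prop :=
  Set.BijOn g U U' ∧
    ∀ x ∈ U, ∃ N ∈ 𝓝 x, ∀ y ∈ N ∩ U, ∀ z ∈ N ∩ U, dist (g y) (g z) = dist y z

/-- Any two fibers have open sets around them with an isometry taking one open set to the other,
taking fibers to fibers, and taking the first given fiber to the second. -/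
def LocallyFiberwiseHomogeneous (F : Set (Set S3)) : Prop :=
  ∀ C ∈ F, ∀ C' ∈ F, ∃ (U U' : Set S3) (g : S3 → S3),
    IsOpen U ∧ IsOpen U' ∧ C ⊆ U ∧ C' ⊆ U' ∧ IsIsometryBetween g U U' ∧
    (∀ D ∈ F, D ⊆ U → g '' D ∈ F) ∧ g '' C = C'

/-- The fibers of the standard Hopf fibration: the intersections of `S³` with the complex lines
`x ℂ` of `ℍ = ℂ²` (complex scalars act by multiplication on the right). -/
def standardHopf : Set (Set S3) :=
  {C | ∃ x : S3, C = {y : S3 | ∃ z : ℂ, (y : ℍ[ℝ]) = (x : ℍ[ℝ]) * (z : ℍ[ℝ])}}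

/-- A Hopf fibration: the image of the standard one under an isometry of `S³`, i.e. under an
orthogonal transformation of `ℝ⁴` of either determinant. -/
def IsHopfFibration (H : Set (Set S3)) : Prop :=
  ∃ A : ℍ[ℝ] ≃ₗᵢ[ℝ] ℍ[ℝ],
    H = {C | ∃ D ∈ standardHopf, C = {y : S3 | ∃ x ∈ D, (y : ℍ[ℝ]) = A (x : ℍ[ℝ])}}

end GreatCircle

end

/-! Two great circles with coordinates `(u, v)` and `(u', v')` meet as soon as `⟪u, u'⟫ = ⟪v, v'⟫`
(`circV_inter_nonempty`). Fibers are disjoint, so along the graph of a local map `f` between the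
factors the sign of `⟪u, u'⟫ - ⟪f u, f u'⟫` cannot change: `f` strictly decreases all distances or
strictly increases them, and in the second case its inverse decreases them
(`IsCircleRelation.lt_or_gt`, `IsRadialGerm.exists_inverse`). A local isometry of the 3-sphere is
linear near a point and acts on coordinates by isometries of the two factors, possibly exchanging
them (`exists_action`). An exchange would make a decreasing map increasing, so local fiberwise
homogeneity says that `f` looks the same at all nearby points, up to isometries of source and target
(`IsDecreasingGerm.isHomogeneousGerm`).

Such an `f` is constant (`IsHomogeneousGerm.eventually_eq`). By homogeneity the pullback of the
round metric has constant eigenvalues. If they differed, the eigenlines would give an orthonormal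
frame whose connection coefficients `p`, `q` are constant up to sign, hence constant, and the Gauss
curvature would be `-(p² + q²)` instead of `1` (`not_homogeneous_frame`). So the pullback is `c`
times the round metric with `c` constant. If `c ≠ 0`, invariance of curvature gives `c = 1`, so `f`
is a local isometry, contrary to strict decrease. Hence `c = 0`.

Thus near every fiber one of the two coordinates is constant, and the fibers are the circles `p C`
or `C p`, where `C` is the circle of unit quaternions commuting with a fixed imaginary one. Two
different families of this kind never agree on an open set, so connectedness of `W` leaves a single
family (`exists_forall_eq_parallel`), and each family lies in a Hopf fibration
(`exists_isHopfFibration_parallel`).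

The calculus is done in the ambient 3-space: `f` is replaced by its extension `x ↦ ‖x‖ • f (x /
‖x‖)`, homogeneous of degree one, and tangent fields by extensions of degree zero. As `f` is only
`C²`, the curvature arguments never assume the top derivative; a structure equation with constant
coefficients supplies it. -/

open scoped RealInnerProductSpace
open Filter
noncomputable section
namespace GreatCircle

/-! ### Calculus preliminaries: radial projection, orthonormal bases, local constancy of signs. -/

section Calculus
variable {E : Type*} [NormedAddCommGroup E] [InnerProductSpace ℝ E]

/-- The radial projection onto the unit sphere. -/
def radial (y : E) : E := ‖y‖⁻¹ • y

lemma radial_of_norm_one {y : E} (hy : ‖y‖ = 1) : radial y = y := by simp [radial, hy]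

lemma norm_radial {y : E} (hy : y ≠ 0) : ‖radial y‖ = 1 := by
  simp [radial, norm_smul, hy]

lemma norm_smul_radial {y : E} (hy : y ≠ 0) : ‖y‖ • radial y = y := by
  simp [radial, smul_smul, hy]

lemma radial_smul {t : ℝ} (ht : 0 < t) (y : E) : radial (t • y) = radial y := by
  rw [radial, radial, norm_smul, Real.norm_of_nonneg ht.le, smul_smul]
  congr 1
  field_simp

lemma hasFDerivAt_inv_norm {y : E} (hy : y ≠ 0) :
    HasFDerivAt (fun x : E => ‖x‖⁻¹) (-(‖y‖⁻¹ ^ 3) • innerSL ℝ y) y := by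
  have h0 : ‖y‖ ≠ 0 := norm_ne_zero_iff.2 hy
  have h1 : HasFDerivAt (fun x : E => Real.sqrt (‖x‖ ^ 2)) _ y :=
    (hasStrictFDerivAt_norm_sq y).hasFDerivAt.sqrt (by positivity)
  have h2 : HasFDerivAt (fun x : E => ‖x‖) _ y :=
    h1.congr_of_eventuallyEq (Eventually.of_forall fun x => by simp)
  have h3 := (hasDerivAt_inv h0).comp_hasFDerivAt y h2
  refine h3.congr_fderiv ?_
  ext v
  simp
  field_simp

lemma hasFDerivAt_radial {y : E} (hy : y ≠ 0) :
    HasFDerivAt (radial : E → E) (‖y‖⁻¹ • ContinuousLinearMap.id ℝ E +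
      (-(‖y‖⁻¹ ^ 3) • innerSL ℝ y).smulRight y) y := by
  exact (hasFDerivAt_inv_norm hy).smul (hasFDerivAt_id y)

lemma expand_of_orthonormal [FiniteDimensional ℝ E] (h3 : Module.finrank ℝ E = 3) {u a b : E}
    (hu : ‖u‖ = 1) (ha : ‖a‖ = 1) (hb : ‖b‖ = 1) (hua : ⟪u, a⟫ = 0) (hub : ⟪u, b⟫ = 0)
    (hab : ⟪a, b⟫ = 0) (X : E) : X = ⟪u, X⟫ • u + ⟪a, X⟫ • a + ⟪b, X⟫ • b := by
  have ho : Orthonormal ℝ ![u, a, b] := by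
    rw [orthonormal_iff_ite]
    intro i j
    fin_cases i <;> fin_cases j <;>
      simp [hu, ha, hb, hua, hub, hab, real_inner_comm]
  have hc : Fintype.card (Fin 3) = Module.finrank ℝ E := by simp [h3]
  let B := (basisOfOrthonormalOfCardEqFinrank ho hc).toOrthonormalBasis (by simpa using ho)
  have := B.sum_repr' X
  simpa [Fin.sum_univ_three, B] using this.symm

lemma ext_inner_of_orthonormal [FiniteDimensional ℝ E] (h3 : Module.finrank ℝ E = 3) {u a b : E}
    (hu : ‖u‖ = 1) (ha : ‖a‖ = 1) (hb : ‖b‖ = 1) (hua : ⟪u, a⟫ = 0) (hub : ⟪u, b⟫ = 0)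
    (hab : ⟪a, b⟫ = 0) {X Y : E} (h1 : ⟪u, X⟫ = ⟪u, Y⟫) (h2 : ⟪a, X⟫ = ⟪a, Y⟫)
    (h4 : ⟪b, X⟫ = ⟪b, Y⟫) : X = Y := by
  rw [expand_of_orthonormal h3 hu ha hb hua hub hab X,
    expand_of_orthonormal h3 hu ha hb hua hub hab Y, h1, h2, h4]

/-- Symmetry of the second derivative in the form used for integrability conditions: only the
derivatives of `f'` evaluated at two fixed vectors have to be computed. -/
lemma second_derivative_symm_apply {G : Type*} [NormedAddCommGroup G] [NormedSpace ℝ G]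
    {f : E → G} {f' : E → E →L[ℝ] G} {x : E} (hf : ∀ᶠ y in 𝓝 x, HasFDerivAt f (f' y) y)
    (hd : DifferentiableAt ℝ f' x) {v w : E} {A B : E →L[ℝ] G}
    (hA : HasFDerivAt (fun y => f' y w) A x) (hB : HasFDerivAt (fun y => f' y v) B x) :
    A v = B w := by
  have h := second_derivative_symmetric_of_eventually hf hd.hasFDerivAt v w
  have h1 := hA.unique (hd.hasFDerivAt.clm_apply (hasFDerivAt_const w x))
  have h2 := hB.unique (hd.hasFDerivAt.clm_apply (hasFDerivAt_const v x))
  rw [h1, h2]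
  simpa using h

/-- By continuity the sign cannot jump, because `G x` and `-G x` are different. -/
lemma eventually_eq_or_eq_neg {X : Type*} [TopologicalSpace X] {F G : X → E} {x : X}
    (hF : ContinuousAt F x)
    (hG : ContinuousAt G x) (h1 : G x ≠ 0) (h : ∀ᶠ y in 𝓝 x, F y = G y ∨ F y = -G y) :
    (∀ᶠ y in 𝓝 x, F y = G y) ∨ (∀ᶠ y in 𝓝 x, F y = -G y) := by
  have h2 : G x + G x ≠ 0 := by
    rw [← two_smul ℝ]; exact smul_ne_zero two_ne_zero h1
  rcases h.self_of_nhds with h0 | h0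
  · left
    have : ∀ᶠ y in 𝓝 x, F y + G y ≠ 0 := (hF.add hG).eventually_ne (by simpa [h0] using h2)
    filter_upwards [this, h] with y hy hy'
    rcases hy' with hy' | hy'
    · exact hy'
    · exact absurd (by rw [hy']; simp) hy
  · right
    have : ∀ᶠ y in 𝓝 x, F y - G y ≠ 0 := (hF.sub hG).eventually_ne (by
      rw [Pi.sub_apply, h0]; intro h; apply h2; rw [← neg_eq_zero, neg_add', h])
    filter_upwards [this, h] with y hy hy'
    rcases hy' with hy' | hy'
    · exact absurd (by rw [hy']; simp) hy
    · exact hy'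

lemma eventually_eq_of_sq_eq {X : Type*} [TopologicalSpace X] {p : X → ℝ} {x : X}
    (hp : ContinuousAt p x) (h : ∀ᶠ y in 𝓝 x, p y ^ 2 = p x ^ 2) : ∀ᶠ y in 𝓝 x, p y = p x := by
  by_cases h0 : p x = 0
  · filter_upwards [h] with y hy
    rw [h0] at hy ⊢; simpa using hy
  · have : ∀ᶠ y in 𝓝 x, p y + p x ≠ 0 :=
      (hp.add continuousAt_const).eventually_ne (by simpa [← two_mul] using h0)
    filter_upwards [this, h] with y hy hy'
    rcases sq_eq_sq_iff_eq_or_eq_neg.1 hy' with h | h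
    · exact h
    · exact absurd (by rw [h]; simp) hy

end Calculus

/-! ### Orthonormal frames on the round sphere and their connection form. -/

section Frame
variable {E : Type*} [NormedAddCommGroup E] [InnerProductSpace ℝ E]

/-- `(e₁, e₂)` is an orthonormal frame of the sphere through `y`. -/
structure IsTangentFrame (e₁ e₂ : E → E) (y : E) : Prop where
  norm_left : ‖e₁ y‖ = 1
  norm_right : ‖e₂ y‖ = 1
  inner_eq : ⟪e₁ y, e₂ y⟫ = 0
  left_radial : ⟪e₁ y, y⟫ = 0
  right_radial : ⟪e₂ y, y⟫ = 0

/-- The connection form of the frame `(e₁, e₂)` at `y`, evaluated at `‖y‖ • X`. -/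
def connectionForm (e₁ e₂ : E → E) (X y : E) : ℝ := ‖y‖ * ⟪fderiv ℝ e₁ y X, e₂ y⟫

variable {e₁ e₂ : E → E} {u₀ : E}

/-- Each identity is the derivative of one of the constant inner products in `IsTangentFrame`. -/
lemma fderiv_frame (hon : ∀ᶠ y in 𝓝 u₀, IsTangentFrame e₁ e₂ y)
    (h1 : DifferentiableAt ℝ e₁ u₀) (h2 : DifferentiableAt ℝ e₂ u₀) (X : E) :
    ⟪e₁ u₀, fderiv ℝ e₁ u₀ X⟫ = 0 ∧ ⟪e₂ u₀, fderiv ℝ e₂ u₀ X⟫ = 0 ∧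
    ⟪e₁ u₀, fderiv ℝ e₂ u₀ X⟫ = - ⟪e₂ u₀, fderiv ℝ e₁ u₀ X⟫ ∧
    ⟪u₀, fderiv ℝ e₁ u₀ X⟫ = - ⟪e₁ u₀, X⟫ ∧ ⟪u₀, fderiv ℝ e₂ u₀ X⟫ = - ⟪e₂ u₀, X⟫ := by
  have key : ∀ (F G : E → E) (c : ℝ), DifferentiableAt ℝ F u₀ → DifferentiableAt ℝ G u₀ →
      (∀ᶠ y in 𝓝 u₀, ⟪F y, G y⟫ = c) →
      ⟪F u₀, fderiv ℝ G u₀ X⟫ + ⟪fderiv ℝ F u₀ X, G u₀⟫ = 0 := by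
    intro F G c hF hG h
    rw [← fderiv_inner_apply ℝ hF hG X]
    have : (fun y => ⟪F y, G y⟫) =ᶠ[𝓝 u₀] fun _ => c := h
    rw [this.fderiv_eq]
    simp
  have k1 := key e₁ e₁ 1 h1 h1 (hon.mono fun y hy => by
    rw [real_inner_self_eq_norm_sq, hy.norm_left]; norm_num)
  have k2 := key e₂ e₂ 1 h2 h2 (hon.mono fun y hy => by
    rw [real_inner_self_eq_norm_sq, hy.norm_right]; norm_num)
  have k3 := key e₁ e₂ 0 h1 h2 (hon.mono fun y hy => hy.inner_eq)
  have k4 := key e₁ id 0 h1 differentiableAt_id (hon.mono fun y hy => hy.left_radial)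
  have k5 := key e₂ id 0 h2 differentiableAt_id (hon.mono fun y hy => hy.right_radial)
  simp only [fderiv_id, ContinuousLinearMap.id_apply, id] at k4 k5
  simp only [real_inner_comm] at k1 k2 k3 k4 k5 ⊢
  refine ⟨?_, ?_, ?_, ?_, ?_⟩ <;> linarith

/-- The structure equation of the frame: the `e₂` component of the derivative of `e₁` is the
connection form, and the radial component is the second fundamental form of the sphere. The
hypothesis `hdeg`, infinitesimal homogeneity of degree zero, removes the radial direction of `X`. -/
lemma fderiv_frame_left [FiniteDimensional ℝ E] (h3 : Module.finrank ℝ E = 3)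
    (h0 : u₀ ≠ 0)
    (hon : ∀ᶠ y in 𝓝 u₀, IsTangentFrame e₁ e₂ y)
    (h1 : DifferentiableAt ℝ e₁ u₀) (h2 : DifferentiableAt ℝ e₂ u₀)
    (hdeg : fderiv ℝ e₁ u₀ u₀ = 0) (X : E) :
    fderiv ℝ e₁ u₀ X = ‖u₀‖⁻¹ • ((⟪e₁ u₀, X⟫ * connectionForm e₁ e₂ (e₁ u₀) u₀ +
      ⟪e₂ u₀, X⟫ * connectionForm e₁ e₂ (e₂ u₀) u₀) • e₂ u₀ - ⟪e₁ u₀, X⟫ • radial u₀) := by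
  have hn : ‖u₀‖ ≠ 0 := norm_ne_zero_iff.2 h0
  have H := hon.self_of_nhds
  have hr : ‖radial u₀‖ = 1 := norm_radial h0
  have hr1 : ⟪radial u₀, e₁ u₀⟫ = 0 := by
    rw [radial, real_inner_smul_left, real_inner_comm, H.left_radial, mul_zero]
  have hr2 : ⟪radial u₀, e₂ u₀⟫ = 0 := by
    rw [radial, real_inner_smul_left, real_inner_comm, H.right_radial, mul_zero]
  have hX := expand_of_orthonormal h3 hr H.norm_left H.norm_right hr1 hr2 H.inner_eq X
  obtain ⟨d1, -, -, d4, -⟩ := fderiv_frame hon h1 h2 X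
  have hw : ⟪e₂ u₀, fderiv ℝ e₁ u₀ X⟫ = ‖u₀‖⁻¹ * (⟪e₁ u₀, X⟫ * connectionForm e₁ e₂ (e₁ u₀) u₀ +
      ⟪e₂ u₀, X⟫ * connectionForm e₁ e₂ (e₂ u₀) u₀) := by
    have : fderiv ℝ e₁ u₀ (radial u₀) = 0 := by rw [radial, map_smul, hdeg, smul_zero]
    conv_lhs => rw [hX]
    simp only [map_add, map_smul, this, inner_add_right, inner_smul_right, connectionForm,
      real_inner_comm (e₂ u₀), inner_zero_right]
    field_simp
    ring
  refine ext_inner_of_orthonormal h3 hr H.norm_left H.norm_right hr1 hr2 H.inner_eq ?_ ?_ ?_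
  · simp only [inner_smul_right, inner_sub_right, hr2, real_inner_self_eq_norm_sq, hr]
    rw [radial, real_inner_smul_left, d4]; ring
  · simp only [inner_smul_right, inner_sub_right, H.inner_eq, real_inner_comm (radial u₀), hr1, d1]
    ring
  · simp only [inner_smul_right, inner_sub_right, real_inner_self_eq_norm_sq, H.norm_right,
      real_inner_comm (radial u₀), hr2, hw]
    ring

/-- The connection form is natural under isometries, and its factor `‖y‖` makes it invariant under
scaling. The symmetry preserves the frame vectors only up to sign, so only the squares are
invariant. -/
lemma sq_connectionForm_eq (t : ℝ) (L : E ≃ₗᵢ[ℝ] E) (ht : 0 < t) (hu : ‖u₀‖ = 1)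
    (h1 : ContinuousAt e₁ u₀) (h2 : ContinuousAt e₂ u₀)
    (h1' : ContinuousAt e₂ (t • L u₀)) (h2' : DifferentiableAt ℝ e₁ (t • L u₀))
    (hon : IsTangentFrame e₁ e₂ u₀)
    (hL : ∀ᶠ x in 𝓝 u₀, (e₁ (t • L x) = L (e₁ x) ∨ e₁ (t • L x) = - L (e₁ x)) ∧
      (e₂ (t • L x) = L (e₂ x) ∨ e₂ (t • L x) = - L (e₂ x))) :
    connectionForm e₁ e₂ (e₁ (t • L u₀)) (t • L u₀) ^ 2 = connectionForm e₁ e₂ (e₁ u₀) u₀ ^ 2 ∧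
    connectionForm e₁ e₂ (e₂ (t • L u₀)) (t • L u₀) ^ 2 = connectionForm e₁ e₂ (e₂ u₀) u₀ ^ 2 := by
  have hcT : ContinuousAt (fun x : E => t • L x) u₀ := by fun_prop
  have sgn : ∀ e : E → E, ContinuousAt e u₀ → ContinuousAt e (t • L u₀) → ‖e u₀‖ = 1 →
      (∀ᶠ x in 𝓝 u₀, e (t • L x) = L (e x) ∨ e (t • L x) = - L (e x)) →
      ∃ s : ℝ, s ^ 2 = 1 ∧ ∀ᶠ x in 𝓝 u₀, e (t • L x) = s • L (e x) := by
    intro e he he' hn h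
    have c1 : ContinuousAt (fun x => e (t • L x)) u₀ :=
      ContinuousAt.comp (f := fun x : E => t • L x) he' hcT
    have c2 : ContinuousAt (fun x => L (e x)) u₀ := L.continuous.continuousAt.comp he
    rcases eventually_eq_or_eq_neg c1 c2 (by
      rw [← norm_ne_zero_iff, L.norm_map, hn]; norm_num) h with h | h
    · exact ⟨1, by norm_num, h.mono fun x hx => by rw [hx, one_smul]⟩
    · exact ⟨-1, by norm_num, h.mono fun x hx => by rw [hx, neg_one_smul]⟩
  obtain ⟨s, hs, hs'⟩ := sgn e₁ h1 h2'.continuousAt hon.norm_left (hL.mono fun _ h => h.1)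
  obtain ⟨r, hr, hr'⟩ := sgn e₂ h2 h1' hon.norm_right (hL.mono fun _ h => h.2)
  have hs0 : s ≠ 0 := by rintro rfl; norm_num at hs
  have hcomp : HasFDerivAt (fun x => e₁ (t • L x))
      ((fderiv ℝ e₁ (t • L u₀)).comp (t • (L : E →L[ℝ] E))) u₀ := by
    apply HasFDerivAt.comp u₀ (f := fun x : E => t • L x) h2'.hasFDerivAt
    exact (L : E →L[ℝ] E).hasFDerivAt.const_smul t
  have hder : ∀ X, fderiv ℝ e₁ u₀ X = s • t • L.symm (fderiv ℝ e₁ (t • L u₀) (L X)) := by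
    intro X
    have h5 : HasFDerivAt e₁ (s • (L.symm : E →L[ℝ] E).comp
        ((fderiv ℝ e₁ (t • L u₀)).comp (t • (L : E →L[ℝ] E)))) u₀ := by
      have := (((L.symm : E →L[ℝ] E).hasFDerivAt.comp u₀ hcomp).const_smul s)
      refine this.congr_of_eventuallyEq (hs'.mono fun x hx => ?_)
      simp [hx, smul_smul, ← pow_two, hs]
    rw [h5.fderiv]
    simp
  have hder' : ∀ X, L (fderiv ℝ e₁ u₀ X) = s • t • (fderiv ℝ e₁ (t • L u₀) (L X)) := by
    intro X; rw [hder X]; simp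
  have hnorm : ‖t • L u₀‖ = t := by
    rw [norm_smul, L.norm_map, hu, mul_one, Real.norm_of_nonneg ht.le]
  have key : ∀ X, t * ⟪fderiv ℝ e₁ (t • L u₀) (L X), L (e₂ u₀)⟫ =
      s * ⟪fderiv ℝ e₁ u₀ X, e₂ u₀⟫ := by
    intro X
    rw [← L.inner_map_map (fderiv ℝ e₁ u₀ X), hder' X]
    simp only [real_inner_smul_left]
    linear_combination (-t * ⟪fderiv ℝ e₁ (t • L u₀) (L X), L (e₂ u₀)⟫) * hs
  have hs1 := hs'.self_of_nhds
  have hr1 := hr'.self_of_nhds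
  simp only [connectionForm, hnorm, hu, one_mul]
  rw [hs1, hr1]
  simp only [map_smul, real_inner_smul_left, real_inner_smul_right]
  constructor
  · rw [show ∀ z : ℝ, t * (r * (s * z)) = r * s * (t * z) by intro z; ring, key]
    linear_combination (r ^ 2 * s ^ 2 * ⟪fderiv ℝ e₁ u₀ (e₁ u₀), e₂ u₀⟫ ^ 2 + r ^ 2 *
      ⟪fderiv ℝ e₁ u₀ (e₁ u₀), e₂ u₀⟫ ^ 2) * hs + ⟪fderiv ℝ e₁ u₀ (e₁ u₀), e₂ u₀⟫ ^ 2 * hr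
  · rw [show ∀ z : ℝ, t * (r * (r * z)) = r * r * (t * z) by intro z; ring, key]
    linear_combination (r ^ 4 * ⟪fderiv ℝ e₁ u₀ (e₂ u₀), e₂ u₀⟫ ^ 2) * hs +
      (r ^ 2 + 1) * ⟪fderiv ℝ e₁ u₀ (e₂ u₀), e₂ u₀⟫ ^ 2 * hr

/-- No orthonormal frame on an open subset of the round sphere has constant connection
coefficients. -/
theorem not_homogeneous_frame [FiniteDimensional ℝ E] (h3 : Module.finrank ℝ E = 3)
    (hu : ‖u₀‖ = 1) (h1 : ContDiffAt ℝ 1 e₁ u₀) (h2 : ContDiffAt ℝ 1 e₂ u₀)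
    (hon : ∀ᶠ y in 𝓝 u₀, IsTangentFrame e₁ e₂ y)
    (hdeg : ∀ᶠ y in 𝓝 u₀, fderiv ℝ e₁ y y = 0)
    (hhom : ∀ᶠ y in 𝓝 u₀, ∃ (L : E ≃ₗᵢ[ℝ] E) (t : ℝ), 0 < t ∧ t • L u₀ = y ∧
      ∀ᶠ x in 𝓝 u₀, (e₁ (t • L x) = L (e₁ x) ∨ e₁ (t • L x) = - L (e₁ x)) ∧
        (e₂ (t • L x) = L (e₂ x) ∨ e₂ (t • L x) = - L (e₂ x))) : False := by
  have h0 : u₀ ≠ 0 := by rintro rfl; simp at hu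
  have d1 : ∀ᶠ y in 𝓝 u₀, DifferentiableAt ℝ e₁ y :=
    (h1.eventually (by simp)).mono fun y hy => hy.differentiableAt (by simp)
  have d2 : ∀ᶠ y in 𝓝 u₀, DifferentiableAt ℝ e₂ y :=
    (h2.eventually (by simp)).mono fun y hy => hy.differentiableAt (by simp)
  have hne : ∀ᶠ y in 𝓝 u₀, y ≠ 0 := eventually_ne_nhds h0
  have c1 : ContinuousAt (fderiv ℝ e₁) u₀ :=
    (h1.fderiv_right (m := 0) (by simp)).continuousAt
  have hconst : ∀ᶠ y in 𝓝 u₀,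
      connectionForm e₁ e₂ (e₁ y) y ^ 2 = connectionForm e₁ e₂ (e₁ u₀) u₀ ^ 2 ∧
      connectionForm e₁ e₂ (e₂ y) y ^ 2 = connectionForm e₁ e₂ (e₂ u₀) u₀ ^ 2 := by
    filter_upwards [hhom, d1, d2] with y hy hd1 hd2
    obtain ⟨L, t, ht, rfl, hL⟩ := hy
    exact sq_connectionForm_eq t L ht hu h1.continuousAt h2.continuousAt hd2.continuousAt hd1
      hon.self_of_nhds hL
  have cont : ∀ e : E → E, ContinuousAt e u₀ →
      ContinuousAt (fun y => connectionForm e₁ e₂ (e y) y) u₀ := fun e he =>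
    (continuous_norm.continuousAt).mul ((c1.clm_apply he).inner h2.continuousAt)
  have hp := eventually_eq_of_sq_eq (cont e₁ h1.continuousAt) (hconst.mono fun _ h => h.1)
  have hq := eventually_eq_of_sq_eq (cont e₂ h2.continuousAt) (hconst.mono fun _ h => h.2)
  set p := connectionForm e₁ e₂ (e₁ u₀) u₀ with hpdef
  set q := connectionForm e₁ e₂ (e₂ u₀) u₀ with hqdef
  -- With `k` frozen, `g y` is the derivative of `⟪e₁ ·, k⟫` at `y`, written with the constants `p`,
  -- `q`. The frame is only `C¹`, but this expression is again differentiable, so the second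
  -- derivative exists and is symmetric.
  set k := e₂ u₀ with hk
  let g : E → E →L[ℝ] ℝ := fun y => ‖y‖⁻¹ • ((⟪e₂ y, k⟫ * p) • innerSL ℝ (e₁ y) +
    (⟪e₂ y, k⟫ * q) • innerSL ℝ (e₂ y) - ⟪radial y, k⟫ • innerSL ℝ (e₁ y))
  have hg : ∀ᶠ y in 𝓝 u₀, HasFDerivAt (fun y => ⟪e₁ y, k⟫) (g y) y := by
    filter_upwards [hne, d1, d2, hdeg, hp, hq, eventually_eventually_nhds.2 hon] with
      y hy0 hd1 hd2 hdegy hpy hqy hony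
    refine (hd1.hasFDerivAt.inner ℝ (hasFDerivAt_const k y)).congr_fderiv ?_
    ext X
    have := fderiv_frame_left h3 hy0 hony hd1 hd2 hdegy X
    rw [hpy, hqy] at this
    simp [fderivInnerCLM_apply, this, g, inner_smul_left, inner_sub_left]
    refine Or.inl ?_
    ring
  have D1 := d1.self_of_nhds
  have D2 := d2.self_of_nhds
  have i1 : DifferentiableAt ℝ (fun y => innerSL ℝ (e₁ y)) u₀ :=
    (innerSL ℝ : E →L[ℝ] E →L[ℝ] ℝ).differentiableAt.comp u₀ D1
  have i2 : DifferentiableAt ℝ (fun y => innerSL ℝ (e₂ y)) u₀ :=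
    (innerSL ℝ : E →L[ℝ] E →L[ℝ] ℝ).differentiableAt.comp u₀ D2
  have hnn : DifferentiableAt ℝ (fun y : E => ‖y‖⁻¹) u₀ := (hasFDerivAt_inv_norm h0).differentiableAt
  have hrd : DifferentiableAt ℝ (radial : E → E) u₀ := (hasFDerivAt_radial h0).differentiableAt
  have hgd : DifferentiableAt ℝ g u₀ := by
    have a1 : DifferentiableAt ℝ (fun y => ⟪e₂ y, k⟫) u₀ := D2.inner ℝ (differentiableAt_const k)
    have a2 : DifferentiableAt ℝ (fun y => ⟪radial y, k⟫) u₀ := hrd.inner ℝ (differentiableAt_const k)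
    exact hnn.smul ((((a1.mul_const p).smul i1).add ((a1.mul_const q).smul i2)).sub (a2.smul i1))
  have hD : ∀ X, HasFDerivAt (fun y => g y X) _ u₀ := fun X => by
    have a1 := D2.hasFDerivAt.inner ℝ (hasFDerivAt_const k u₀)
    have a2 := (hasFDerivAt_radial h0).inner ℝ (hasFDerivAt_const k u₀)
    have b1 := D1.hasFDerivAt.inner ℝ (hasFDerivAt_const X u₀)
    have b2 := D2.hasFDerivAt.inner ℝ (hasFDerivAt_const X u₀)
    exact (hasFDerivAt_inv_norm h0).mul
      ((((a1.mul_const p).mul b1).add ((a1.mul_const q).mul b2)).sub (a2.mul b1))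
  have hsym := second_derivative_symm_apply hg hgd (hD (e₁ u₀)) (hD k) (v := k) (w := e₁ u₀)
  have H := hon.self_of_nhds
  obtain ⟨-, x2, -, -, -⟩ := fderiv_frame hon D1 D2 (e₁ u₀)
  obtain ⟨y1, y2, y3, -, -⟩ := fderiv_frame hon D1 D2 k
  have hp' : ⟪k, fderiv ℝ e₁ u₀ (e₁ u₀)⟫ = p := by
    rw [hpdef, connectionForm, hu, one_mul, real_inner_comm]
  have hq' : ⟪k, fderiv ℝ e₁ u₀ k⟫ = q := by
    rw [hqdef, connectionForm, hu, one_mul, real_inner_comm]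
  have z1 : ⟪u₀, e₁ u₀⟫ = 0 := by rw [real_inner_comm]; exact H.left_radial
  have z2 : ⟪u₀, k⟫ = 0 := by rw [real_inner_comm]; exact H.right_radial
  have z3 : ⟪e₁ u₀, k⟫ = 0 := H.inner_eq
  have z4 : ⟪k, e₁ u₀⟫ = 0 := by rw [real_inner_comm]; exact z3
  have n1 := H.norm_left
  have n2 : ‖k‖ = 1 := H.norm_right
  simp [fderivInnerCLM_apply, hu, radial_of_norm_one hu, z1, z2, z3, z4, n1, n2, y1, y3,
    real_inner_comm, hp', hq', ← hk] at hsym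
  rw [← hk] at x2 y2
  rw [x2, y2] at hsym
  -- The symmetry now reads `-q² - 1 = p²`: the Gauss equation with curvature `1`.
  nlinarith [sq_nonneg p, sq_nonneg q]

end Frame

/-! ### Radial germs and diagonalization of the pulled back metric. -/

section Adapted
variable {E : Type*} [NormedAddCommGroup E] [InnerProductSpace ℝ E]

/-- A `C²` germ at `u` of a norm preserving map, positively homogeneous of degree one. -/
structure IsRadialGerm (M : E → E) (u : E) : Prop where
  contDiffAt : ContDiffAt ℝ 2 M u
  map_smul : ∀ t : ℝ, 0 < t → ∀ x, M (t • x) = t • M x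
  norm_map : ∀ᶠ x in 𝓝 u, ‖M x‖ = ‖x‖

variable {M : E → E} {u : E}

lemma IsRadialGerm.eventually (h : IsRadialGerm M u) : ∀ᶠ y in 𝓝 u, IsRadialGerm M y := by
  filter_upwards [h.contDiffAt.eventually (by simp), eventually_eventually_nhds.2 h.norm_map]
    with y h1 h2 using ⟨h1, h.map_smul, h2⟩

lemma IsRadialGerm.differentiableAt (h : IsRadialGerm M u) : DifferentiableAt ℝ M u :=
  h.contDiffAt.differentiableAt (by simp)

lemma IsRadialGerm.contDiffAt_fderiv (h : IsRadialGerm M u) : ContDiffAt ℝ 1 (fderiv ℝ M) u :=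
  h.contDiffAt.fderiv_right (by norm_num)

lemma hasDerivAt_along_ray {G : Type*} [NormedAddCommGroup G] [NormedSpace ℝ G] {F : E → G} {y : E}
    (h : DifferentiableAt ℝ F y) :
    HasDerivAt (fun t : ℝ => F (t • y)) (fderiv ℝ F y y) 1 := by
  have h1 : HasDerivAt (fun t : ℝ => t • y) y 1 := by
    simpa using (hasDerivAt_id (1 : ℝ)).smul_const y
  have h2 : HasFDerivAt F (fderiv ℝ F y) ((1 : ℝ) • y) := by
    rw [one_smul]; exact h.hasFDerivAt
  exact h2.comp_hasDerivAt (1 : ℝ) h1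

lemma fderiv_self_eq_zero {G : Type*} [NormedAddCommGroup G] [NormedSpace ℝ G] {F : E → G} {y : E}
    (h : DifferentiableAt ℝ F y) (h' : ∀ t : ℝ, 0 < t → F (t • y) = F y) : fderiv ℝ F y y = 0 := by
  refine (hasDerivAt_along_ray h).unique ((hasDerivAt_const (1 : ℝ) (F y)).congr_of_eventuallyEq ?_)
  filter_upwards [eventually_gt_nhds (zero_lt_one' ℝ)] with t ht using h' t ht

/-- Euler's identity for degree one. -/
lemma IsRadialGerm.fderiv_self (h : IsRadialGerm M u) : fderiv ℝ M u u = M u := by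
  refine (hasDerivAt_along_ray h.differentiableAt).unique ?_
  have h1 : HasDerivAt (fun t : ℝ => t • M u) (M u) 1 := by
    simpa using (hasDerivAt_id (1 : ℝ)).smul_const (M u)
  refine h1.congr_of_eventuallyEq ?_
  filter_upwards [eventually_gt_nhds (zero_lt_one' ℝ)] with t ht using h.map_smul t ht u

/-- Differentiate `‖M x‖² = ‖x‖²`. This plays the role of the Gauss lemma: it determines the
component of the derivative of `M` along `M u`. -/
lemma IsRadialGerm.inner_fderiv (h : IsRadialGerm M u) (X : E) :
    ⟪M u, fderiv ℝ M u X⟫ = ⟪u, X⟫ := by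
  have h1 : HasFDerivAt (fun x => ‖M x‖ ^ 2) _ u := h.differentiableAt.hasFDerivAt.norm_sq
  have h2 : HasFDerivAt (fun x : E => ‖x‖ ^ 2) _ u := (hasFDerivAt_id u).norm_sq
  have h3 := h1.unique (h2.congr_of_eventuallyEq (h.norm_map.mono fun x hx => by simp [hx]))
  have := DFunLike.congr_fun h3 X
  simpa using this

lemma IsRadialGerm.hasFDerivAt_smul (h : IsRadialGerm M u) {D : E →L[ℝ] E} {y : E}
    (hD : HasFDerivAt M D y) {t : ℝ} (ht : 0 < t) : HasFDerivAt M D (t • y) := by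
  have h1 : HasFDerivAt (fun x : E => t⁻¹ • x) (t⁻¹ • ContinuousLinearMap.id ℝ E) (t • y) :=
    (hasFDerivAt_id _).const_smul _
  have h2 : HasFDerivAt M D (t⁻¹ • t • y) := by
    rwa [smul_smul, inv_mul_cancel₀ ht.ne', one_smul]
  have h3 := (h2.comp (t • y) h1).const_smul t
  refine (h3.congr_of_eventuallyEq (Eventually.of_forall fun x => ?_)).congr_fderiv ?_
  · simp [h.map_smul t⁻¹ (inv_pos.2 ht), smul_smul, ht.ne']
  · ext v; simp [smul_smul, ht.ne']

/-- `(a, b)` is an orthonormal basis of the tangent plane of the sphere at `radial y` which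
diagonalizes the pullback under `M` of the Euclidean metric, with eigenvalues `l` and `m`. -/
structure IsAdapted (M : E → E) (l m : ℝ) (a b y : E) : Prop where
  ne_zero : y ≠ 0
  norm_left : ‖a‖ = 1
  norm_right : ‖b‖ = 1
  inner_eq : ⟪a, b⟫ = 0
  left_radial : ⟪radial y, a⟫ = 0
  right_radial : ⟪radial y, b⟫ = 0
  metric : ∀ X Y, ⟪fderiv ℝ M y X, fderiv ℝ M y Y⟫ =
    ⟪radial y, X⟫ * ⟪radial y, Y⟫ + l * (⟪a, X⟫ * ⟪a, Y⟫) + m * (⟪b, X⟫ * ⟪b, Y⟫)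

variable {l m : ℝ} {a b y : E}

lemma IsAdapted.swap (h : IsAdapted M l m a b y) : IsAdapted M m l b a y where
  ne_zero := h.ne_zero
  norm_left := h.norm_right
  norm_right := h.norm_left
  inner_eq := by rw [real_inner_comm]; exact h.inner_eq
  left_radial := h.right_radial
  right_radial := h.left_radial
  metric X Y := by rw [h.metric]; ring

lemma IsAdapted.neg_left (h : IsAdapted M l m a b y) : IsAdapted M l m (-a) b y where
  ne_zero := h.ne_zero
  norm_left := by rw [norm_neg]; exact h.norm_left
  norm_right := h.norm_right
  inner_eq := by rw [inner_neg_left, h.inner_eq, neg_zero]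
  left_radial := by rw [inner_neg_right, h.left_radial, neg_zero]
  right_radial := h.right_radial
  metric X Y := by rw [h.metric]; simp

lemma IsAdapted.expand [FiniteDimensional ℝ E] (h3 : Module.finrank ℝ E = 3)
    (h : IsAdapted M l m a b y) (X : E) :
    X = ⟪radial y, X⟫ • radial y + ⟪a, X⟫ • a + ⟪b, X⟫ • b :=
  expand_of_orthonormal h3 (norm_radial h.ne_zero) h.norm_left h.norm_right h.left_radial
    h.right_radial h.inner_eq X

lemma IsAdapted.inner_expand [FiniteDimensional ℝ E] (h3 : Module.finrank ℝ E = 3)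
    (h : IsAdapted M l m a b y) (X Y : E) :
    ⟪X, Y⟫ = ⟪radial y, X⟫ * ⟪radial y, Y⟫ + ⟪a, X⟫ * ⟪a, Y⟫ + ⟪b, X⟫ * ⟪b, Y⟫ := by
  conv_lhs => rw [h.expand h3 X]
  simp only [inner_add_left, real_inner_smul_left]

lemma IsAdapted.metric_left (h : IsAdapted M l m a b y) (X : E) :
    ⟪fderiv ℝ M y a, fderiv ℝ M y X⟫ = l * ⟪a, X⟫ := by
  rw [h.metric, h.left_radial, real_inner_self_eq_norm_sq, h.norm_left, real_inner_comm a b,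
    h.inner_eq]
  ring

lemma IsAdapted.inner_eq_zero {a' b' : E} (h : IsAdapted M l m a b y)
    (h' : IsAdapted M m l a' b' y) (hlm : l ≠ m) : ⟪a, a'⟫ = 0 := by
  have h1 := h.metric_left a'
  have h2 := h'.metric_left a
  rw [real_inner_comm, h1, real_inner_comm a a', ← sub_eq_zero, ← sub_mul] at h2
  exact (mul_eq_zero.1 h2).resolve_left (sub_ne_zero.2 hlm)

/-- Eigenvectors for different eigenvalues are orthogonal, so in the tangent plane a unit
eigenvector is determined up to sign. -/
lemma IsAdapted.left_unique [FiniteDimensional ℝ E] (h3 : Module.finrank ℝ E = 3) {a' b' : E}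
    (h : IsAdapted M l m a b y) (h' : IsAdapted M l m a' b' y) (hlm : l ≠ m) :
    a' = a ∨ a' = -a := by
  have h1 : ⟪b, a'⟫ = 0 := by
    rw [real_inner_comm]; exact h'.inner_eq_zero h.swap hlm
  have h2 := h.expand h3 a'
  rw [h'.left_radial, h1, zero_smul, zero_smul, zero_add, add_zero] at h2
  have h4 : ⟪a, a'⟫ ^ 2 = 1 := by
    have := congrArg (fun v => ‖v‖ ^ 2) h2
    simp only [norm_smul, h.norm_left, h'.norm_left, mul_one, Real.norm_eq_abs, sq_abs] at this
    linarith
  rcases mul_self_eq_one_iff.1 ((sq _).symm.trans h4) with h5 | h5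
  · left; rw [h2, h5, one_smul]
  · right; rw [h2, h5, neg_one_smul]

/-- Since `M = B ∘ M ∘ L⁻¹` near `L y` and `B` preserves inner products, `L` carries the pulled back
metric at `y` to that at `L y`. The factor `t` is harmless because the derivative of `M` is
homogeneous of degree zero. -/
lemma IsAdapted.map (hM : IsRadialGerm M u) (h : IsAdapted M l m a b y)
    (hd : DifferentiableAt ℝ M y) (L B : E ≃ₗᵢ[ℝ] E) {t : ℝ} (ht : 0 < t)
    (hL : ∀ᶠ x in 𝓝 y, M (L x) = B (M x)) : IsAdapted M l m (L a) (L b) (t • L y) := by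
  have hr : radial (t • L y) = L (radial y) := by
    rw [radial_smul ht, radial, radial, L.norm_map, map_smul]
  have h1 : HasFDerivAt M ((B : E →L[ℝ] E).comp ((fderiv ℝ M y).comp (L.symm : E →L[ℝ] E)))
      (L y) := by
    have h2 : HasFDerivAt M (fderiv ℝ M y) (L.symm (L y)) := by
      rw [L.symm_apply_apply]; exact hd.hasFDerivAt
    have h3 := (B : E →L[ℝ] E).hasFDerivAt.comp (L y)
      (h2.comp (L y) (L.symm : E →L[ℝ] E).hasFDerivAt)
    refine h3.congr_of_eventuallyEq ?_
    have hc : Tendsto L.symm (𝓝 (L y)) (𝓝 y) := by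
      have := L.symm.continuous.tendsto (L y)
      rwa [L.symm_apply_apply] at this
    filter_upwards [hc.eventually hL] with x hx
    simpa using hx
  have h2 := (hM.hasFDerivAt_smul h1 ht).fderiv
  refine ⟨smul_ne_zero ht.ne' (by simpa using h.ne_zero), by simpa using h.norm_left,
    by simpa using h.norm_right, by simpa using h.inner_eq, ?_, ?_, ?_⟩
  · rw [hr, L.inner_map_map]; exact h.left_radial
  · rw [hr, L.inner_map_map]; exact h.right_radial
  · intro X Y
    obtain ⟨X, rfl⟩ := L.surjective X
    obtain ⟨Y, rfl⟩ := L.surjective Y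
    rw [h2, hr]
    simpa using h.metric X Y

lemma exists_orthonormal_triple [FiniteDimensional ℝ E] (h3 : Module.finrank ℝ E = 3)
    (hu : ‖u‖ = 1) : ∃ a b : E, ‖a‖ = 1 ∧ ‖b‖ = 1 ∧ ⟪a, b⟫ = 0 ∧ ⟪u, a⟫ = 0 ∧ ⟪u, b⟫ = 0 := by
  have hv : Orthonormal ℝ (({0} : Set (Fin 3)).domRestrict fun _ => u) := by
    refine ⟨fun _ => hu, fun i j hij => absurd (Subsingleton.elim i j) hij⟩
  obtain ⟨B, hB⟩ := hv.exists_orthonormalBasis_extension_of_card_eq (by simp [h3])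
  have h0 : B 0 = u := hB 0 rfl
  refine ⟨B 1, B 2, B.norm_eq_one 1, B.norm_eq_one 2, B.orthonormal.2 (by decide), ?_, ?_⟩
  · rw [← h0]; exact B.orthonormal.2 (by decide)
  · rw [← h0]; exact B.orthonormal.2 (by decide)

/-- Rotating the orthonormal pair by a quarter turn changes the sign of the inner product of the
images, so it vanishes for an intermediate angle. -/
lemma exists_orthogonal_images {D : E →L[ℝ] E} {a b : E} (ha : ‖a‖ = 1) (hb : ‖b‖ = 1)
    (hab : ⟪a, b⟫ = 0) (hua : ⟪u, a⟫ = 0) (hub : ⟪u, b⟫ = 0) :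
    ∃ a' b' : E, ‖a'‖ = 1 ∧ ‖b'‖ = 1 ∧ ⟪a', b'⟫ = 0 ∧ ⟪u, a'⟫ = 0 ∧ ⟪u, b'⟫ = 0 ∧
      ⟪D a', D b'⟫ = 0 := by
  let φ : ℝ → ℝ := fun θ =>
    ⟪D (Real.cos θ • a + Real.sin θ • b), D (-Real.sin θ • a + Real.cos θ • b)⟫
  have hφ : Continuous φ := by fun_prop
  have h0 : φ 0 = ⟪D a, D b⟫ := by simp [φ]
  have h1 : φ (Real.pi / 2) = -⟪D a, D b⟫ := by simp [φ, real_inner_comm]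
  have hz : (0 : ℝ) ∈ Set.uIcc (φ 0) (φ (Real.pi / 2)) := by
    rw [h0, h1, Set.mem_uIcc]
    rcases le_total 0 ⟪D a, D b⟫ with h | h
    · right; constructor <;> linarith
    · left; constructor <;> linarith
  obtain ⟨θ, -, hθ⟩ := intermediate_value_uIcc hφ.continuousOn hz
  have hba : ⟪b, a⟫ = 0 := by rw [real_inner_comm]; exact hab
  have hn : ∀ c s : ℝ, c ^ 2 + s ^ 2 = 1 → ‖c • a + s • b‖ = 1 := by
    intro c s hcs
    rw [← sq_eq_sq₀ (norm_nonneg _) zero_le_one, ← real_inner_self_eq_norm_sq]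
    rw [real_inner_self_eq_norm_sq, norm_add_sq_real]
    simp only [norm_smul, real_inner_smul_left, real_inner_smul_right, hab, ha, hb,
      Real.norm_eq_abs, mul_one, sq_abs]
    linarith
  refine ⟨_, _, hn _ _ (Real.cos_sq_add_sin_sq θ), hn _ _ (by rw [neg_sq, Real.sin_sq_add_cos_sq]),
    ?_, ?_, ?_, hθ⟩
  · simp [inner_add_left, inner_add_right, real_inner_smul_left, real_inner_smul_right, hab, hba,
      ha, hb]
    ring
  · simp [inner_add_right, real_inner_smul_right, hua, hub]
  · simp [inner_add_right, real_inner_smul_right, hua, hub]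

/-- The radial direction splits off by `IsRadialGerm.inner_fderiv`; in the tangent plane an
orthonormal pair with orthogonal images diagonalizes the metric. -/
lemma IsRadialGerm.exists_isAdapted [FiniteDimensional ℝ E] (h3 : Module.finrank ℝ E = 3)
    (hu : ‖u‖ = 1) (h : IsRadialGerm M u) : ∃ l m a b, IsAdapted M l m a b u := by
  obtain ⟨a₀, b₀, h1, h2, h4, h5, h6⟩ := exists_orthonormal_triple h3 hu
  obtain ⟨a, b, ha, hb, hab, hua, hub, hD⟩ :=
    exists_orthogonal_images (D := fderiv ℝ M u) h1 h2 h4 h5 h6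
  refine ⟨⟪fderiv ℝ M u a, fderiv ℝ M u a⟫, ⟪fderiv ℝ M u b, fderiv ℝ M u b⟫, a, b, ?_, ha, hb, hab,
    ?_, ?_, ?_⟩
  · rintro rfl; simp at hu
  · rwa [radial_of_norm_one hu]
  · rwa [radial_of_norm_one hu]
  · intro X Y
    rw [radial_of_norm_one hu]
    have hX := expand_of_orthonormal h3 hu ha hb hua hub hab X
    have hY := expand_of_orthonormal h3 hu ha hb hua hub hab Y
    have huu : ⟪M u, M u⟫ = 1 := by
      rw [real_inner_self_eq_norm_sq, h.norm_map.self_of_nhds, hu]; norm_num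
    have hua' : ⟪M u, fderiv ℝ M u a⟫ = 0 := by rw [h.inner_fderiv, hua]
    have hub' : ⟪M u, fderiv ℝ M u b⟫ = 0 := by rw [h.inner_fderiv, hub]
    have hau' : ⟪fderiv ℝ M u a, M u⟫ = 0 := by rw [real_inner_comm, hua']
    have hbu' : ⟪fderiv ℝ M u b, M u⟫ = 0 := by rw [real_inner_comm, hub']
    have hD' : ⟪fderiv ℝ M u b, fderiv ℝ M u a⟫ = 0 := by rw [real_inner_comm, hD]
    conv_lhs => rw [hX, hY]
    simp only [map_add, _root_.map_smul, h.fderiv_self, inner_add_left, inner_add_right,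
      real_inner_smul_left, real_inner_smul_right, huu, hua', hub', hau', hbu', hD, hD']
    ring

end Adapted

/-! ### Rigidity: a homogeneous strictly decreasing germ is constant on the sphere. -/

section Rigidity
variable {E : Type*} [NormedAddCommGroup E] [InnerProductSpace ℝ E] {M : E → E} {u : E}

/-- The vector `(DMᵀ DM - n - (1 - n) ŷ ŷᵀ) w`, where `DM` is the derivative of `M` at `y` and
`ŷ = radial y`. -/
def eigenVec [FiniteDimensional ℝ E] (M : E → E) (n : ℝ) (w y : E) : E :=
  ∑ i, (⟪fderiv ℝ M y w, fderiv ℝ M y (stdOrthonormalBasis ℝ E i)⟫ -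
    n * ⟪w, stdOrthonormalBasis ℝ E i⟫ -
    (1 - n) * (⟪radial y, w⟫ * ⟪radial y, stdOrthonormalBasis ℝ E i⟫)) • stdOrthonormalBasis ℝ E i

/-- After subtracting `m` times the identity and the remaining radial part, the operator has rank
one with image the `l`-eigenline. A fixed `w` therefore yields an eigenvector depending on `y` as
regularly as the derivative of `M`. -/
lemma IsAdapted.eigenVec_eq [FiniteDimensional ℝ E] (h3 : Module.finrank ℝ E = 3) {l m : ℝ}
    {a b y : E} (h : IsAdapted M l m a b y) (w : E) :
    eigenVec M m w y = ((l - m) * ⟪a, w⟫) • a := by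
  have : ∀ X, ⟪fderiv ℝ M y w, fderiv ℝ M y X⟫ - m * ⟪w, X⟫ -
      (1 - m) * (⟪radial y, w⟫ * ⟪radial y, X⟫) = (l - m) * ⟪a, w⟫ * ⟪a, X⟫ := by
    intro X
    rw [h.metric, h.inner_expand h3 w X]
    ring
  simp only [eigenVec, this]
  generalize (l - m) * ⟪a, w⟫ = c
  conv_rhs => rw [← (stdOrthonormalBasis ℝ E).sum_repr' a]
  rw [Finset.smul_sum]
  refine Finset.sum_congr rfl fun i _ => ?_
  rw [smul_smul, real_inner_comm a]

lemma IsAdapted.inner_left {l m : ℝ} {a b y : E} (h : IsAdapted M l m a b y) : ⟪a, y⟫ = 0 := by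
  have := h.left_radial
  rw [radial, real_inner_smul_left, real_inner_comm] at this
  exact (mul_eq_zero.1 this).resolve_left (inv_ne_zero (norm_ne_zero_iff.2 h.ne_zero))

lemma contDiffAt_radial {n : WithTop ℕ∞} (hu : u ≠ 0) : ContDiffAt ℝ n (radial : E → E) u :=
  ((contDiffAt_norm ℝ hu).inv (norm_ne_zero_iff.2 hu)).smul contDiffAt_id

lemma IsRadialGerm.contDiffAt_eigenVec [FiniteDimensional ℝ E] (hu : u ≠ 0)
    (h : IsRadialGerm M u) (n : ℝ) (w : E) : ContDiffAt ℝ 1 (eigenVec M n w) u := by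
  have hr := contDiffAt_radial (n := 1) hu
  have hD := h.contDiffAt_fderiv
  unfold eigenVec
  refine ContDiffAt.sum fun i _ => ?_
  exact ((((hD.clm_apply contDiffAt_const).inner ℝ (hD.clm_apply contDiffAt_const)).sub
    contDiffAt_const).sub (contDiffAt_const.mul ((hr.inner ℝ contDiffAt_const).mul
      (hr.inner ℝ contDiffAt_const)))).smul contDiffAt_const

lemma IsRadialGerm.eigenVec_smul [FiniteDimensional ℝ E] (h : IsRadialGerm M u) (n : ℝ) (w : E)
    {t : ℝ} (ht : 0 < t) : eigenVec M n w (t • u) = eigenVec M n w u := by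
  have h1 := (h.hasFDerivAt_smul h.differentiableAt.hasFDerivAt ht).fderiv
  simp only [eigenVec, h1, radial_smul ht]

/-- A `C¹` field of eigenvectors. -/
lemma IsRadialGerm.exists_eigenField [FiniteDimensional ℝ E] (h3 : Module.finrank ℝ E = 3)
    (hu : u ≠ 0) (h : IsRadialGerm M u) {l m : ℝ} (hlm : l ≠ m)
    (had : ∀ᶠ y in 𝓝 u, ∃ a b, IsAdapted M l m a b y) :
    ∃ e : E → E, ContDiffAt ℝ 1 e u ∧ (∀ᶠ y in 𝓝 u, fderiv ℝ e y y = 0) ∧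
      ∀ᶠ y in 𝓝 u, ∃ b, IsAdapted M l m (e y) b y := by
  obtain ⟨w, b₀, h0⟩ := had.self_of_nhds
  let v := eigenVec M m w
  have hv : ContDiffAt ℝ 1 v u := h.contDiffAt_eigenVec hu m w
  have hvu : v u ≠ 0 := by
    simp only [v]
    rw [h0.eigenVec_eq h3, real_inner_self_eq_norm_sq, h0.norm_left, ← norm_ne_zero_iff,
      norm_smul, h0.norm_left]
    simpa [sub_eq_zero] using hlm
  let e : E → E := fun y => ‖v y‖⁻¹ • v y
  have he : ContDiffAt ℝ 1 e u := ((hv.norm ℝ hvu).inv (norm_ne_zero_iff.2 hvu)).smul hv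
  refine ⟨e, he, ?_, ?_⟩
  · filter_upwards [he.eventually (by simp), h.eventually] with y hy hMy
    refine fderiv_self_eq_zero (hy.differentiableAt (by simp)) fun t ht => ?_
    simp only [e, v, hMy.eigenVec_smul m w ht]
  · filter_upwards [had, hv.continuousAt.eventually_ne hvu] with y ⟨a, b, hab⟩ hvy
    refine ⟨b, ?_⟩
    have h1 : v y = ((l - m) * ⟪a, w⟫) • a := hab.eigenVec_eq h3 w
    have hc : (l - m) * ⟪a, w⟫ ≠ 0 := by
      intro hc; rw [h1, hc, zero_smul] at hvy; exact hvy rfl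
    have h2 : e y = (|(l - m) * ⟪a, w⟫|⁻¹ * ((l - m) * ⟪a, w⟫)) • a := by
      simp only [e, h1, norm_smul, hab.norm_left, mul_one, Real.norm_eq_abs, smul_smul]
    rcases lt_or_gt_of_ne hc with h4 | h4
    · rw [h2, abs_of_neg h4, show (-((l - m) * ⟪a, w⟫))⁻¹ * ((l - m) * ⟪a, w⟫) = -1 by
        rw [inv_neg, neg_mul, inv_mul_cancel₀ hc], neg_one_smul]
      exact hab.neg_left
    · rw [h2, abs_of_pos h4, inv_mul_cancel₀ hc, one_smul]
      exact hab

/-- The germ `M` looks the same, up to isometries, at all points near `u`. -/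
def IsHomogeneousGerm (M : E → E) (u : E) : Prop :=
  ∀ᶠ y in 𝓝 u, ∃ (L B : E ≃ₗᵢ[ℝ] E) (t : ℝ), 0 < t ∧ t • L u = y ∧
    ∀ᶠ x in 𝓝 u, M (L x) = B (M x)

/-- Homogeneity transports the eigenvalues to all nearby points. If they differed, the unit
eigenfields would be a `C¹` frame preserved up to sign by the symmetries, which
`not_homogeneous_frame` forbids. -/
lemma IsHomogeneousGerm.eigenvalues_eq [FiniteDimensional ℝ E] (h3 : Module.finrank ℝ E = 3)
    (hu : ‖u‖ = 1) (h : IsRadialGerm M u) (hh : IsHomogeneousGerm M u) {l m : ℝ}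
    (had : ∃ a b, IsAdapted M l m a b u) : l = m := by
  by_contra hlm
  have hu0 : u ≠ 0 := by rintro rfl; simp at hu
  have hA : ∀ᶠ y in 𝓝 u, ∃ a b, IsAdapted M l m a b y := by
    obtain ⟨a, b, hab⟩ := had
    filter_upwards [hh] with y ⟨L, B, t, ht, hy, hL⟩
    exact hy ▸ ⟨_, _, hab.map h h.differentiableAt L B ht hL⟩
  have hA' : ∀ᶠ y in 𝓝 u, ∃ a b, IsAdapted M m l a b y :=
    hA.mono fun y ⟨a, b, hab⟩ => ⟨b, a, hab.swap⟩
  obtain ⟨e₁, c1, d1, f1⟩ := h.exists_eigenField h3 hu0 hlm hA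
  obtain ⟨e₂, c2, -, f2⟩ := h.exists_eigenField h3 hu0 (Ne.symm hlm) hA'
  refine not_homogeneous_frame h3 hu c1 c2 ?_ d1 ?_
  · filter_upwards [f1, f2] with y ⟨b, hb⟩ ⟨a, ha⟩
    refine ⟨hb.norm_left, ha.norm_left, hb.inner_eq_zero ha hlm, ?_, ?_⟩
    · exact hb.inner_left
    · exact ha.inner_left
  · filter_upwards [hh, eventually_eventually_nhds.2 f1, eventually_eventually_nhds.2 f2] with y
      ⟨L, B, t, ht, hy, hL⟩ g1 g2
    refine ⟨L, t, ht, hy, ?_⟩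
    have hc : Tendsto (fun x : E => t • L x) (𝓝 u) (𝓝 y) := by
      rw [← hy]; exact (L.continuous.const_smul t).tendsto u
    filter_upwards [hc.eventually g1, hc.eventually g2, f1, f2, eventually_eventually_nhds.2 hL,
      h.eventually] with x ⟨b, hb⟩ ⟨a, ha⟩ ⟨b', hb'⟩ ⟨a', ha'⟩ hLx hMx
    exact ⟨(hb'.map h hMx.differentiableAt L B ht hLx).left_unique h3 hb hlm,
      (ha'.map h hMx.differentiableAt L B ht hLx).left_unique h3 ha (Ne.symm hlm)⟩

/-- The pullback under `M` of the Euclidean metric is that of a cone over a homothety. -/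
def IsConformalAt (M : E → E) (c : ℝ) (y : E) : Prop :=
  ∀ X Y, ⟪fderiv ℝ M y X, fderiv ℝ M y Y⟫ =
    c * ⟪X, Y⟫ + (1 - c) * (⟪radial y, X⟫ * ⟪radial y, Y⟫)

lemma IsHomogeneousGerm.exists_conformal [FiniteDimensional ℝ E] (h3 : Module.finrank ℝ E = 3)
    (hu : ‖u‖ = 1) (h : IsRadialGerm M u) (hh : IsHomogeneousGerm M u) :
    ∃ c, ∀ᶠ y in 𝓝 u, IsConformalAt M c y := by
  obtain ⟨l, m, a, b, hab⟩ := h.exists_isAdapted h3 hu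
  obtain rfl := hh.eigenvalues_eq h3 hu h ⟨a, b, hab⟩
  refine ⟨l, ?_⟩
  filter_upwards [hh] with y ⟨L, B, t, ht, hy, hL⟩ X Y
  have h1 := hab.map h h.differentiableAt L B ht hL
  rw [hy] at h1
  rw [h1.metric, h1.inner_expand h3 X Y]
  ring

lemma eventually_const_of_hasFDerivAt_zero {G : Type*} [NormedAddCommGroup G] [NormedSpace ℝ G]
    {F : E → G} (h : ∀ᶠ y in 𝓝 u, HasFDerivAt F (0 : E →L[ℝ] G) y) : ∀ᶠ y in 𝓝 u, F y = F u := by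
  obtain ⟨r, hr, hb⟩ := Metric.eventually_nhds_iff_ball.1 h
  filter_upwards [Metric.ball_mem_nhds u hr] with y hy
  exact Metric.isOpen_ball.is_const_of_fderiv_eq_zero (convex_ball u r).isPreconnected
    (fun x hx => (hb x hx).differentiableAt.differentiableWithinAt)
    (fun x hx => (hb x hx).fderiv) hy (Metric.mem_ball_self hr)

/-- For `c = 0` the vector `fderiv ℝ M y X` has norm `|⟪radial y, X⟫|`, which is already the size of
its component along `M y`. So it is a multiple of `M y`, and `‖y‖⁻¹ • M y` has zero derivative. -/
lemma IsRadialGerm.eq_of_conformal_zero (hu : ‖u‖ = 1) (h : IsRadialGerm M u)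
    (hc : ∀ᶠ y in 𝓝 u, IsConformalAt M 0 y) : ∀ᶠ y in 𝓝 u, M y = ‖y‖ • M u := by
  have hu0 : u ≠ 0 := by rintro rfl; simp at hu
  have hd : ∀ᶠ y in 𝓝 u, HasFDerivAt (fun y => ‖y‖⁻¹ • M y) (0 : E →L[ℝ] E) y := by
    filter_upwards [hc, h.eventually, eventually_ne_nhds hu0] with y hy hM hy0
    have hn : ‖y‖ ≠ 0 := norm_ne_zero_iff.2 hy0
    refine ((hasFDerivAt_inv_norm hy0).smul hM.differentiableAt.hasFDerivAt).congr_fderiv ?_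
    ext X
    have hX : fderiv ℝ M y X = (‖y‖⁻¹ ^ 2 * ⟪y, X⟫) • M y := by
      rw [← sub_eq_zero, ← norm_eq_zero, ← sq_eq_zero_iff, norm_sub_sq_real,
        ← real_inner_self_eq_norm_sq, hy X X, real_inner_smul_right, real_inner_comm (M y),
        hM.inner_fderiv, norm_smul, hM.norm_map.self_of_nhds, radial, real_inner_smul_left]
      simp only [Real.norm_eq_abs, mul_pow, sq_abs]
      field_simp
      ring
    simp only [hX, add_apply, smul_apply,
      ContinuousLinearMap.smulRight_apply, innerSL_apply_apply, zero_apply,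
      smul_smul, ← add_smul, smul_eq_mul]
    rw [show ‖y‖⁻¹ * (‖y‖⁻¹ ^ 2 * ⟪y, X⟫) + -(‖y‖⁻¹ ^ 3) * ⟪y, X⟫ = 0 by ring, zero_smul]
  filter_upwards [eventually_const_of_hasFDerivAt_zero hd, eventually_ne_nhds hu0] with y hy hy0
  rw [hu, inv_one, one_smul] at hy
  rw [← hy, smul_smul, mul_inv_cancel₀ (norm_ne_zero_iff.2 hy0), one_smul]

/-- The second fundamental form of a map which is conformal near `u`. -/
lemma IsRadialGerm.second_fderiv [FiniteDimensional ℝ E] (hu : u ≠ 0) (h : IsRadialGerm M u)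
    {c : ℝ} (hc0 : c ≠ 0) (hc : ∀ᶠ y in 𝓝 u, IsConformalAt M c y) (Z X : E) :
    fderiv ℝ (fderiv ℝ M) u Z X =
      ((1 - c) * ‖u‖⁻¹ ^ 2 * (⟪Z, X⟫ - ⟪radial u, Z⟫ * ⟪radial u, X⟫)) • M u := by
  have hn : ‖u‖ ≠ 0 := norm_ne_zero_iff.2 hu
  have hD : DifferentiableAt ℝ (fderiv ℝ M) u := h.contDiffAt_fderiv.differentiableAt (by simp)
  have hsym : ∀ v w, fderiv ℝ (fderiv ℝ M) u v w = fderiv ℝ (fderiv ℝ M) u w v := fun v w =>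
    second_derivative_symmetric_of_eventually
      (h.eventually.mono fun y hy => hy.differentiableAt.hasFDerivAt) hD.hasFDerivAt v w
  have hder : ∀ X Y Z : E, ⟪fderiv ℝ (fderiv ℝ M) u Z X, fderiv ℝ M u Y⟫ +
      ⟪fderiv ℝ (fderiv ℝ M) u Z Y, fderiv ℝ M u X⟫ = (1 - c) * ‖u‖⁻¹ *
        ((⟪Z, X⟫ - ⟪radial u, Z⟫ * ⟪radial u, X⟫) * ⟪radial u, Y⟫ +
          ⟪radial u, X⟫ * (⟪Z, Y⟫ - ⟪radial u, Z⟫ * ⟪radial u, Y⟫)) := by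
    intro X Y Z
    have h1 := (hD.hasFDerivAt.clm_apply (hasFDerivAt_const X u)).inner ℝ
      (hD.hasFDerivAt.clm_apply (hasFDerivAt_const Y u))
    have h2 := ((((hasFDerivAt_radial hu).inner ℝ (hasFDerivAt_const X u)).mul
      ((hasFDerivAt_radial hu).inner ℝ (hasFDerivAt_const Y u))).const_mul (1 - c)).const_add
        (c * ⟪X, Y⟫)
    have h3 := h1.unique (h2.congr_of_eventuallyEq (hc.mono fun y hy => hy X Y))
    have h4 := DFunLike.congr_fun h3 Z
    have e : ∀ V, ⟪radial u, V⟫ = ‖u‖⁻¹ * ⟪u, V⟫ := fun V => by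
      rw [radial, real_inner_smul_left]
    simp only [fderivInnerCLM_apply, ContinuousLinearMap.comp_apply, ContinuousLinearMap.prod_apply,
      add_apply, smul_apply, ContinuousLinearMap.flip_apply, zero_apply, map_zero, zero_add,
      inner_zero_right, smul_eq_mul, ContinuousLinearMap.smulRight_apply, innerSL_apply_apply,
      ContinuousLinearMap.id_apply, inner_add_left, real_inner_smul_left, e] at h4 ⊢
    rw [add_comm, real_inner_comm, h4]
    ring
  have hinj : Function.Injective (fderiv ℝ M u) := by
    rw [injective_iff_map_eq_zero]
    intro X hX
    have h1 := h.inner_fderiv X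
    rw [hX, inner_zero_right] at h1
    have h2 := hc.self_of_nhds X X
    rw [hX, inner_zero_left, radial, real_inner_smul_left, ← h1] at h2
    simp only [mul_zero, add_zero] at h2
    exact inner_self_eq_zero.1 ((mul_eq_zero.1 h2.symm).resolve_left hc0)
  have hsurj : Function.Surjective (fderiv ℝ M u) :=
    (LinearMap.injective_iff_surjective (f := (fderiv ℝ M u : E →ₗ[ℝ] E))).1 hinj
  refine ext_inner_right ℝ fun W => ?_
  obtain ⟨Y, rfl⟩ := hsurj W
  rw [real_inner_smul_left, h.inner_fderiv]
  -- The Koszul trick: by symmetry of the second derivative, `a1 + a2 - a3` isolates twice one term.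
  have a1 := hder X Y Z
  have a2 := hder Z Y X
  have a3 := hder X Z Y
  rw [hsym X Z] at a2
  rw [hsym Y X, hsym Y Z] at a3
  have e : ⟪u, Y⟫ = ‖u‖ * ⟪radial u, Y⟫ := by
    rw [radial, real_inner_smul_left]; field_simp
  rw [real_inner_comm Z X, real_inner_comm] at a2
  rw [e]
  have e2 : (1 - c) * ‖u‖⁻¹ ^ 2 * (⟪Z, X⟫ - ⟪radial u, Z⟫ * ⟪radial u, X⟫) *
      (‖u‖ * ⟪radial u, Y⟫) = (1 - c) * ‖u‖⁻¹ * (⟪Z, X⟫ - ⟪radial u, Z⟫ * ⟪radial u, X⟫) *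
      ⟪radial u, Y⟫ := by
    field_simp
  rw [e2]
  simp only [real_inner_comm] at a1 a2 a3 ⊢
  linarith

/-- The Theorema Egregium in integrability form: differentiating the formula of
`IsRadialGerm.second_fderiv` once more, symmetry in two tangent directions `a`, `b` leaves `(1 - c)
• fderiv ℝ M u b = 0`, and the derivative of `M` does not kill `b` because `c ≠ 0`. -/
lemma IsRadialGerm.conformal_factor [FiniteDimensional ℝ E] (h3 : Module.finrank ℝ E = 3)
    (hu : ‖u‖ = 1) (h : IsRadialGerm M u)
    {c : ℝ} (hc0 : c ≠ 0) (hc : ∀ᶠ y in 𝓝 u, IsConformalAt M c y) : c = 1 := by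
  have hu0 : u ≠ 0 := by rintro rfl; simp at hu
  obtain ⟨a, b, ha, hb, hab, hua, hub⟩ := exists_orthonormal_triple h3 hu
  -- The second derivative of `M` evaluated at `a`. Its explicit form involves only `M` and
  -- `radial`, so it is differentiable although `M` is merely `C²`.
  let g : E → E →L[ℝ] E := fun y => ((1 - c) * ‖y‖⁻¹ ^ 2) •
    ((innerSL ℝ a) - ⟪radial y, a⟫ • innerSL ℝ (radial y)).smulRight (M y)
  have hg : ∀ᶠ y in 𝓝 u, HasFDerivAt (fun y => fderiv ℝ M y a) (g y) y := by
    filter_upwards [eventually_eventually_nhds.2 hc, h.eventually, eventually_ne_nhds hu0] with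
      y hy hM hy0
    have hD : DifferentiableAt ℝ (fderiv ℝ M) y := hM.contDiffAt_fderiv.differentiableAt (by simp)
    refine (hD.hasFDerivAt.clm_apply (hasFDerivAt_const a y)).congr_fderiv ?_
    ext Z
    have := hM.second_fderiv hy0 hc0 hy Z a
    simp [g, this, smul_smul, real_inner_comm, mul_comm]
  have hr := (hasFDerivAt_radial hu0)
  have hM := h.differentiableAt.hasFDerivAt
  have hgd : DifferentiableAt ℝ g u := by
    have i1 : DifferentiableAt ℝ (fun y => innerSL ℝ (radial y)) u :=
      (innerSL ℝ : E →L[ℝ] E →L[ℝ] ℝ).differentiableAt.comp u hr.differentiableAt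
    have i2 : DifferentiableAt ℝ (fun y => ⟪radial y, a⟫) u :=
      hr.differentiableAt.inner ℝ (differentiableAt_const a)
    have i3 : DifferentiableAt ℝ (fun y => (innerSL ℝ a) - ⟪radial y, a⟫ • innerSL ℝ (radial y)) u :=
      (differentiableAt_const _).sub (i2.smul i1)
    have i4 : DifferentiableAt ℝ (fun y : E => (1 - c) * ‖y‖⁻¹ ^ 2) u :=
      ((hasFDerivAt_inv_norm hu0).differentiableAt.pow 2).const_mul _
    have i5 : DifferentiableAt ℝ (fun y => ((innerSL ℝ a) -
        ⟪radial y, a⟫ • innerSL ℝ (radial y)).smulRight (M y)) u := by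
      exact ((ContinuousLinearMap.smulRightL ℝ E E).hasFDerivAt_of_bilinear
        i3.hasFDerivAt hM).differentiableAt
    exact i4.smul i5
  have hA : ∀ X, HasFDerivAt (fun y => g y X) _ u := fun X =>
    (((hasFDerivAt_inv_norm hu0).pow 2).const_mul (1 - c)).smul
      (((hr.inner ℝ (hasFDerivAt_const a u)).mul (hr.inner ℝ (hasFDerivAt_const X u))).const_sub
        ⟪a, X⟫ |>.smul hM)
  have hsym := second_derivative_symm_apply hg hgd (hA a) (hA b) (v := b) (w := a)
  simp [hu, radial_of_norm_one hu, ha, hab, hua, hub] at hsym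
  rcases hsym with h1 | h1
  · linarith
  · exfalso
    have h2 := hc.self_of_nhds b b
    rw [h1, radial_of_norm_one hu, hub, real_inner_self_eq_norm_sq b, hb] at h2
    simp at h2
    exact hc0 h2.symm

/-- A homogeneous germ of a strictly distance decreasing map is constant. -/
theorem IsHomogeneousGerm.eventually_eq [FiniteDimensional ℝ E] (h3 : Module.finrank ℝ E = 3)
    (hu : ‖u‖ = 1) (h : IsRadialGerm M u) (hh : IsHomogeneousGerm M u)
    (hne : ∀ᶠ y in 𝓝 u, (∀ r : ℝ, y ≠ r • u) → ⟪M y, M u⟫ ≠ ⟪y, u⟫) :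
    ∀ᶠ y in 𝓝 u, M y = ‖y‖ • M u := by
  have hu0 : u ≠ 0 := by rintro rfl; simp at hu
  obtain ⟨c, hc⟩ := hh.exists_conformal h3 hu h
  by_cases hc0 : c = 0
  · subst hc0; exact h.eq_of_conformal_zero hu hc
  exfalso
  obtain rfl := h.conformal_factor h3 hu hc0 hc
  have h1 : ∀ᶠ y in 𝓝 u, HasFDerivAt (fderiv ℝ M) (0 : E →L[ℝ] E →L[ℝ] E) y := by
    filter_upwards [eventually_eventually_nhds.2 hc, h.eventually, eventually_ne_nhds hu0] with
      y hy hM hy0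
    refine (hM.contDiffAt_fderiv.differentiableAt (by simp)).hasFDerivAt.congr_fderiv ?_
    ext Z X
    rw [hM.second_fderiv hy0 hc0 hy]
    simp
  -- For `c = 1` the second derivative vanishes, so near `u` the germ is the linear map `fderiv ℝ M
  -- u`, which preserves inner products; a point off the line of `u` then contradicts `hne`.
  have h2 : ∀ᶠ y in 𝓝 u, HasFDerivAt (fun y => M y - fderiv ℝ M u y) (0 : E →L[ℝ] E) y := by
    filter_upwards [eventually_const_of_hasFDerivAt_zero h1, h.eventually] with y hy hM
    refine (hM.differentiableAt.hasFDerivAt.sub (fderiv ℝ M u).hasFDerivAt).congr_fderiv ?_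
    rw [hy, sub_self]
  have h4 := eventually_const_of_hasFDerivAt_zero h2
  obtain ⟨a, b, ha, hb, hab, hua, hub⟩ := exists_orthonormal_triple h3 hu
  have hcurve : Tendsto (fun s : ℝ => u + s • a) (𝓝[≠] 0) (𝓝 u) := by
    have : ContinuousAt (fun s : ℝ => u + s • a) 0 := by fun_prop
    have h := this.tendsto
    simp only [zero_smul, add_zero] at h
    exact h.mono_left nhdsWithin_le_nhds
  obtain ⟨s, ⟨hs1, hs2⟩, hs0⟩ :=
    ((hcurve.eventually (h4.and hne)).and self_mem_nhdsWithin).exists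
  refine hs2 ?_ ?_
  · intro r hr
    have := congrArg (fun v => ⟪v, a⟫) hr
    simp only [inner_add_left, real_inner_smul_left, hua, real_inner_self_eq_norm_sq, ha] at this
    apply hs0
    simpa using this
  · have hM : M (u + s • a) = fderiv ℝ M u (u + s • a) := by
      rw [h.fderiv_self, sub_self, sub_eq_zero] at hs1
      exact hs1
    have := hc.self_of_nhds (u + s • a) u
    rw [h.fderiv_self] at this
    rw [hM, this]
    ring

end Rigidity

/-! ### From the relation of disjoint circles to homogeneous germs. -/

section Relation
variable {E : Type*} [NormedAddCommGroup E] [InnerProductSpace ℝ E]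

/-- The abstract properties of the cone over the set of pairs `(u, v)` for which `circleOf u v` is
a fiber of a locally fiberwise homogeneous fibration. -/
structure IsCircleRelation (R : E → E → Prop) : Prop where
  norm_eq : ∀ {x y}, R x y → ‖x‖ = ‖y‖
  smul : ∀ {x y} {t : ℝ}, R x y → t ≠ 0 → R (t • x) (t • y)
  sep : ∀ {x y x' y'}, R x y → R x' y' → ⟪x, x'⟫ = ⟪y, y'⟫ → ∃ t : ℝ, x' = t • x ∧ y' = t • y
  hom : ∀ {x y x' y'}, R x y → R x' y' → ‖x‖ = ‖x'‖ → ∃ α β : E ≃ₗᵢ[ℝ] E,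
    (α x = x' ∧ β y = y' ∧ ∀ᶠ p in 𝓝 (x, y), R p.1 p.2 → R (α p.1) (β p.2)) ∨
    (α x = y' ∧ β y = x' ∧ ∀ᶠ p in 𝓝 (x, y), R p.1 p.2 → R (β p.2) (α p.1))

lemma IsCircleRelation.op {R : E → E → Prop} (h : IsCircleRelation R) :
    IsCircleRelation (fun x y => R y x) where
  norm_eq hr := (h.norm_eq hr).symm
  smul hr ht := h.smul hr ht
  sep hr hr' hi := by
    obtain ⟨t, h1, h2⟩ := h.sep hr hr' hi.symm
    exact ⟨t, h2, h1⟩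
  hom {x y x' y'} hr hr' hn := by
    have hs : Tendsto Prod.swap (𝓝 (x, y)) (𝓝 (y, x)) := continuous_swap.tendsto (x, y)
    obtain ⟨α, β, ⟨h1, h2, h3⟩ | ⟨h1, h2, h3⟩⟩ := h.hom hr hr'
      (by rw [h.norm_eq hr, h.norm_eq hr', hn])
    · exact ⟨β, α, Or.inl ⟨h2, h1, hs.eventually h3⟩⟩
    · exact ⟨β, α, Or.inr ⟨h2, h1, hs.eventually h3⟩⟩

/-- A `C²` germ whose graph lies in `R` and which is strictly distance decreasing on the sphere. -/
structure IsDecreasingGerm (R : E → E → Prop) (M : E → E) (u : E) : Prop where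
  radialGerm : IsRadialGerm M u
  rel : ∀ᶠ x in 𝓝 u, R x (M x)
  lt : ∀ᶠ p in 𝓝 (u, u), (∀ r : ℝ, p.1 ≠ r • p.2) → ⟪p.1, p.2⟫ < ⟪M p.1, M p.2⟫

variable {R : E → E → Prop} {M : E → E} {u : E}

lemma frequently_ne_smul [FiniteDimensional ℝ E] (h3 : Module.finrank ℝ E = 3) (hu : ‖u‖ = 1) :
    ∃ᶠ y in 𝓝 u, ∀ r : ℝ, y ≠ r • u := by
  obtain ⟨a, b, ha, hb, hab, hua, hub⟩ := exists_orthonormal_triple h3 hu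
  have hcurve : Tendsto (fun s : ℝ => u + s • a) (𝓝[≠] 0) (𝓝 u) := by
    have : ContinuousAt (fun s : ℝ => u + s • a) 0 := by fun_prop
    have h := this.tendsto
    simp only [zero_smul, add_zero] at h
    exact h.mono_left nhdsWithin_le_nhds
  refine hcurve.frequently (Eventually.frequently ?_)
  filter_upwards [self_mem_nhdsWithin] with s hs r hr
  have := congrArg (fun v => ⟪v, a⟫) hr
  simp only [inner_add_left, real_inner_smul_left, hua, real_inner_self_eq_norm_sq, ha] at this
  apply hs
  simpa using this

lemma eventually_inner_pos (hu : ‖u‖ = 1) : ∀ᶠ y in 𝓝 u, 0 < ⟪y, u⟫ := by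
  have : ContinuousAt (fun y => ⟪y, u⟫) u := by fun_prop
  exact this.tendsto.eventually_const_lt (by rw [real_inner_self_eq_norm_sq, hu]; norm_num)

lemma IsRadialGerm.eventually_continuousAt (h : IsRadialGerm M u) :
    ∀ᶠ y in 𝓝 u, ContinuousAt M y :=
  h.eventually.mono fun _ hy => hy.contDiffAt.continuousAt

/-- For a related pair `(x, y)` near `(u, M u)`, the function `z ↦ ⟪x, z⟫ - ⟪y, M z⟫` is negative at
a fixed `x₁` off the line of `u`, because `M` decreases distances, and nonnegative at `z = x` by
Cauchy–Schwarz. At a zero in between, `sep` makes `(z, M z)` proportional to `(x, y)`, with positive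
factor, whence `y = M x`. -/
lemma IsDecreasingGerm.unique [FiniteDimensional ℝ E] (h3 : Module.finrank ℝ E = 3)
    (hR : IsCircleRelation R) (hu : ‖u‖ = 1) (h : IsDecreasingGerm R M u) :
    ∀ᶠ p in 𝓝 (u, M u), R p.1 p.2 → p.2 = M p.1 := by
  have hlt : ∀ᶠ x in 𝓝 u, (∀ r : ℝ, x ≠ r • u) → ⟪x, u⟫ < ⟪M x, M u⟫ :=
    (Continuous.prodMk_left u).continuousAt.eventually h.lt
  obtain ⟨r, hr, hb⟩ := Metric.eventually_nhds_iff_ball.1 (h.rel.and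
    (h.radialGerm.norm_map.and ((eventually_inner_pos hu).and h.radialGerm.eventually_continuousAt)))
  obtain ⟨x₁, hx₁, hx₁', hxb⟩ := ((frequently_ne_smul h3 hu).and_eventually
    (hlt.and (Metric.ball_mem_nhds u hr))).exists
  have hcF : ContinuousAt (fun p : E × E => ⟪p.1, x₁⟫ - ⟪p.2, M x₁⟫) (u, M u) := by fun_prop
  have hF : ∀ᶠ p : E × E in 𝓝 (u, M u), ⟪p.1, x₁⟫ - ⟪p.2, M x₁⟫ < 0 := by
    refine hcF.tendsto.eventually_lt_const ?_
    have := hx₁' hx₁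
    rw [real_inner_comm, real_inner_comm (M u)] at this
    exact sub_neg.2 this
  have hball : ∀ᶠ p : E × E in 𝓝 (u, M u), p.1 ∈ Metric.ball u r :=
    continuous_fst.continuousAt.eventually (Metric.ball_mem_nhds u hr)
  filter_upwards [hF, hball] with ⟨x, y⟩ hxy hx hRxy
  simp only at hxy hx hRxy ⊢
  obtain ⟨hrx, hnx, hpx, -⟩ := hb x hx
  have hge : 0 ≤ ⟪x, x⟫ - ⟪y, M x⟫ := by
    have := real_inner_le_norm y (M x)
    rw [hnx, ← hR.norm_eq hRxy, ← real_inner_self_eq_norm_mul_norm] at this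
    linarith
  have hcont : ContinuousOn (fun z => ⟪x, z⟫ - ⟪y, M z⟫) (Metric.ball u r) := fun z hz =>
    ((continuousAt_const.inner continuousAt_id).sub
      (continuousAt_const.inner (hb z hz).2.2.2)).continuousWithinAt
  obtain ⟨z, hz, hz0⟩ := (convex_ball u r).isPreconnected.intermediate_value hxb hx hcont
    ⟨hxy.le, hge⟩
  obtain ⟨hrz, -, hpz, -⟩ := hb z hz
  obtain ⟨t, ht1, ht2⟩ := hR.sep hRxy hrz (by simp only at hz0; linarith)
  have ht : 0 < t := by
    rw [ht1, real_inner_smul_left] at hpz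
    exact (pos_iff_pos_of_mul_pos hpz).2 hpx
  rw [ht1, h.radialGerm.map_smul t ht] at ht2
  exact (smul_right_injective E ht.ne' ht2).symm

/-- A symmetry of the relation carries the graph of `M` near `u` into the relation near `(z, M z)`,
where by uniqueness it is again the graph of `M`. -/
lemma IsDecreasingGerm.isHomogeneousGerm [FiniteDimensional ℝ E] (h3 : Module.finrank ℝ E = 3)
    (hR : IsCircleRelation R) (hu : ‖u‖ = 1) (h : IsDecreasingGerm R M u) :
    IsHomogeneousGerm M u := by
  have hu0 : u ≠ 0 := by rintro rfl; simp at hu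
  have hMc : ContinuousAt M u := h.radialGerm.contDiffAt.continuousAt
  have hrc : Tendsto (radial : E → E) (𝓝 u) (𝓝 u) := by
    have := (contDiffAt_radial (n := 0) hu0).continuousAt.tendsto
    rwa [radial_of_norm_one hu] at this
  have hgr : Tendsto (fun x => (x, M x)) (𝓝 u) (𝓝 (u, M u)) :=
    (continuousAt_id.prodMk hMc).tendsto
  have hdg : Tendsto (fun x => (x, x)) (𝓝 u) (𝓝 (u, u)) :=
    (continuousAt_id.prodMk continuousAt_id).tendsto
  have huniq := eventually_eventually_nhds.2 (h.unique h3 hR hu)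
  filter_upwards [eventually_ne_nhds hu0, hrc.eventually h.rel, hrc.eventually (hgr.eventually huniq),
    hrc.eventually (hdg.eventually (eventually_eventually_nhds.2 h.lt))] with y hy0 hry hy hylt
  set z := GreatCircle.radial y with hz
  have hz1 : ‖z‖ = 1 := norm_radial hy0
  obtain ⟨α, β, ⟨h1, h2, h4⟩ | ⟨h1, h2, h4⟩⟩ := hR.hom h.rel.self_of_nhds hry (by rw [hu, hz1])
  · refine ⟨α, β, ‖y‖, norm_pos_iff.2 hy0, by rw [h1, norm_smul_radial hy0], ?_⟩
    have hc : Tendsto (fun x => (α x, β (M x))) (𝓝 u) (𝓝 (z, M z)) := by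
      have : ContinuousAt (fun x => (α x, β (M x))) u :=
        α.continuous.continuousAt.prodMk (β.continuous.continuousAt.comp hMc)
      rw [← h2, ← h1]
      exact this.tendsto
    filter_upwards [h.rel, hgr.eventually h4, hc.eventually hy] with x hx1 hx2 hx3
    exact (hx3 (hx2 hx1)).symm
  -- If the factors were exchanged, then `α x = M (β (M x))`: applying `M` twice, up to isometries,
  -- would return the original inner products, although each application strictly increases them.
  · exfalso
    have hc : Tendsto (fun x => (β (M x), α x)) (𝓝 u) (𝓝 (z, M z)) := by
      have : ContinuousAt (fun x => (β (M x), α x)) u :=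
        (β.continuous.continuousAt.comp hMc).prodMk α.continuous.continuousAt
      rw [← h1, ← h2]
      exact this.tendsto
    have hc' : Tendsto (fun x => (β (M x), z)) (𝓝 u) (𝓝 (z, z)) := by
      have : ContinuousAt (fun x => (β (M x), z)) u :=
        (β.continuous.continuousAt.comp hMc).prodMk continuousAt_const
      have := this.tendsto
      rwa [h2] at this
    have hlt : ∀ᶠ x in 𝓝 u, (∀ r : ℝ, x ≠ r • u) → ⟪x, u⟫ < ⟪M x, M u⟫ :=
      (Continuous.prodMk_left u).continuousAt.eventually h.lt
    obtain ⟨x, hx, ⟨hx1, hx2, hx3, hx4, hx5, hx6⟩⟩ := ((frequently_ne_smul h3 hu).and_eventually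
      (h.rel.and ((hgr.eventually h4).and ((hc.eventually hy).and ((hc'.eventually hylt).and
        (hlt.and (eventually_inner_pos hu))))))).exists
    have e1 : α x = M (β (M x)) := hx3 (hx2 hx1)
    have e2 := hx5 hx
    by_cases hpr : ∀ r : ℝ, β (M x) ≠ r • z
    · have e3 := hx4 hpr
      simp only at e3
      rw [← e1, ← h1, α.inner_map_map, ← h2, β.inner_map_map] at e3
      linarith
    · push Not at hpr
      obtain ⟨r, hr⟩ := hpr
      have e3 : M x = r • M u := by
        rw [← h2, ← map_smul] at hr
        exact β.injective hr
      have hM1 : ‖M u‖ = 1 := by rw [h.radialGerm.norm_map.self_of_nhds, hu]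
      have hr0 : 0 < r := by
        rw [e3, real_inner_smul_left, real_inner_self_eq_norm_sq, hM1] at e2
        linarith
      rw [hr, h.radialGerm.map_smul r hr0, ← h1, ← map_smul] at e1
      exact hx r (α.injective e1)

lemma IsDecreasingGerm.eventually_rel [FiniteDimensional ℝ E] (h3 : Module.finrank ℝ E = 3)
    (hR : IsCircleRelation R) (hu : ‖u‖ = 1) (h : IsDecreasingGerm R M u) :
    ∀ᶠ x in 𝓝 u, R x (‖x‖ • M u) := by
  have hlt : ∀ᶠ x in 𝓝 u, (∀ r : ℝ, x ≠ r • u) → ⟪x, u⟫ < ⟪M x, M u⟫ :=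
    (Continuous.prodMk_left u).continuousAt.eventually h.lt
  filter_upwards [h.rel, (h.isHomogeneousGerm h3 hR hu).eventually_eq h3 hu h.radialGerm
    (hlt.mono fun y hy hr => (hy hr).ne')] with x h1 h2
  rwa [← h2]

lemma finrank_orthogonal_singleton [FiniteDimensional ℝ E] (h3 : Module.finrank ℝ E = 3)
    (hu : u ≠ 0) : 1 < Module.rank ℝ (ℝ ∙ u)ᗮ := by
  have : Fact (Module.finrank ℝ E = 2 + 1) := ⟨h3⟩
  rw [← Module.finrank_eq_rank, Submodule.finrank_orthogonal_span_singleton (n := 2) hu]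
  norm_num

/-- A graph contained in `R` is either strictly distance decreasing or strictly distance
increasing. -/
lemma IsCircleRelation.lt_or_gt [FiniteDimensional ℝ E] (h3 : Module.finrank ℝ E = 3)
    (hR : IsCircleRelation R) (hu : ‖u‖ = 1) (h : IsRadialGerm M u) (hrel : ∀ᶠ x in 𝓝 u, R x (M x)) :
    (∀ᶠ p in 𝓝 (u, u), (∀ r : ℝ, p.1 ≠ r • p.2) → ⟪p.1, p.2⟫ < ⟪M p.1, M p.2⟫) ∨
    (∀ᶠ p in 𝓝 (u, u), (∀ r : ℝ, p.1 ≠ r • p.2) → ⟪M p.1, M p.2⟫ < ⟪p.1, p.2⟫) := by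
  have hu0 : u ≠ 0 := by rintro rfl; simp at hu
  obtain ⟨r, hr, hb⟩ := Metric.eventually_nhds_iff_ball.1 (hrel.and
    ((eventually_inner_pos hu).and h.eventually_continuousAt))
  let K := (ℝ ∙ u)ᗮ
  have hK : ∀ w : K, ⟪(w : E), u⟫ = 0 := fun w => by
    rw [real_inner_comm]; exact Submodule.mem_orthogonal_singleton_iff_inner_right.1 w.2
  -- Triples `(x, s, w)` encode the pairs `(x, x + s • w)` with `s > 0` and `w` a unit vector
  -- orthogonal to `u`. The circle of such `w` is connected, hence so is the parameter space, and
  -- `sep` keeps `F` from vanishing on it.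
  let S : Set (E × ℝ × K) :=
    Metric.ball u (r / 2) ×ˢ (Set.Ioo 0 (r / 2) ×ˢ Metric.sphere (0 : K) 1)
  have hS : IsPreconnected S := (convex_ball u _).isPreconnected.prod
    (isPreconnected_Ioo.prod (isPreconnected_sphere (finrank_orthogonal_singleton h3 hu0) 0 1))
  let q : E × ℝ × K → E := fun p => p.1 + p.2.1 • (p.2.2 : E)
  have hq : Continuous q := by fun_prop
  let F : E × ℝ × K → ℝ := fun p => ⟪p.1, q p⟫ - ⟪M p.1, M (q p)⟫
  have hS1 : ∀ p ∈ S, p.1 ∈ Metric.ball u r := fun p hp =>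
    Metric.ball_subset_ball (by linarith) hp.1
  have hS2 : ∀ p ∈ S, q p ∈ Metric.ball u r := by
    rintro ⟨x, s, w⟩ ⟨hx, hs, hw⟩
    simp only [Metric.mem_ball, mem_sphere_zero_iff_norm, Set.mem_Ioo, q, dist_eq_norm] at *
    calc ‖x + s • (w : E) - u‖ = ‖(x - u) + s • (w : E)‖ := by congr 1; abel
      _ ≤ ‖x - u‖ + ‖s • (w : E)‖ := norm_add_le _ _
      _ = ‖x - u‖ + s := by
        have hw' : ‖(w : E)‖ = 1 := hw
        rw [norm_smul, hw', mul_one, Real.norm_of_nonneg hs.1.le]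
      _ < r := by linarith [hs.2]
  have hF : ContinuousOn F S := by
    intro p hp
    have c1 : ContinuousAt (fun p : E × ℝ × K => M p.1) p :=
      ContinuousAt.comp (f := fun p : E × ℝ × K => p.1) (hb _ (hS1 p hp)).2.2
        continuous_fst.continuousAt
    have c2 : ContinuousAt (fun p : E × ℝ × K => M (q p)) p :=
      ContinuousAt.comp (f := q) (hb _ (hS2 p hp)).2.2 hq.continuousAt
    exact ((continuous_fst.continuousAt.inner hq.continuousAt).sub
      (c1.inner c2)).continuousWithinAt
  have hF0 : ∀ p ∈ S, F p ≠ 0 := by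
    intro p hp h0
    obtain ⟨t, ht, -⟩ := hR.sep (hb _ (hS1 p hp)).1 (hb _ (hS2 p hp)).1 (sub_eq_zero.1 h0)
    have hpos := (hb _ (hS1 p hp)).2.1
    have h1 := congrArg (fun v => ⟪v, u⟫) ht
    simp only [q, inner_add_left, real_inner_smul_left, hK, mul_zero, add_zero] at h1
    have h2 : t = 1 := by
      have : (1 - t) * ⟪p.1, u⟫ = 0 := by linarith
      rcases mul_eq_zero.1 this with h | h
      · linarith
      · exact absurd h hpos.ne'
    rw [h2, one_smul] at ht
    have h4 : p.2.1 • (p.2.2 : E) = 0 := by simpa [q] using ht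
    have h5 := congrArg norm h4
    have h6 : ‖(p.2.2 : E)‖ = 1 := by simpa using hp.2.2
    rw [norm_smul, h6, mul_one, norm_zero, norm_eq_zero] at h5
    exact hp.2.1.1.ne' h5
  have hsign : (∀ p ∈ S, F p < 0) ∨ (∀ p ∈ S, 0 < F p) := by
    by_contra hcon
    push Not at hcon
    obtain ⟨⟨p, hp, hp'⟩, p', hp1, hp1'⟩ := hcon
    obtain ⟨z, hz, hz0⟩ := hS.intermediate_value hp1 hp hF ⟨hp1', hp'⟩
    exact hF0 z hz hz0
  have hred : ∀ᶠ p in 𝓝 (u, u), (∀ r : ℝ, p.1 ≠ r • p.2) →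
      ∃ t : ℝ, 0 < t ∧ ∃ z ∈ S, F z = t * (⟪p.1, p.2⟫ - ⟪M p.1, M p.2⟫) := by
    -- The factor for which `ρ p • p.2` and `p.1` have the same component along `u`. Homogeneity of
    -- `M` makes this rescaling harmless for the sign.
    let ρ : E × E → ℝ := fun p => ⟪p.1, u⟫ / ⟪p.2, u⟫
    have huu : ⟪u, u⟫ = 1 := by rw [real_inner_self_eq_norm_sq, hu]; norm_num
    have hρ : ContinuousAt ρ (u, u) := by
      refine ContinuousAt.div ?_ ?_ ?_
      · fun_prop
      · fun_prop
      · simp [hu0]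
    have hz : ContinuousAt (fun p : E × E => ρ p • p.2 - p.1) (u, u) :=
      (hρ.smul continuous_snd.continuousAt).sub continuous_fst.continuousAt
    have hz' : ∀ᶠ p in 𝓝 (u, u), ‖ρ p • p.2 - p.1‖ < r / 2 := by
      refine hz.norm.tendsto.eventually_lt_const ?_
      simp only [ρ, huu]
      simpa using hr
    have hp1 : ∀ᶠ p : E × E in 𝓝 (u, u), p.1 ∈ Metric.ball u (r / 2) :=
      continuous_fst.continuousAt.eventually (Metric.ball_mem_nhds u (by linarith))
    have hp1' : ∀ᶠ p : E × E in 𝓝 (u, u), 0 < ⟪p.1, u⟫ :=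
      continuous_fst.continuousAt.eventually (eventually_inner_pos hu)
    have hp2' : ∀ᶠ p : E × E in 𝓝 (u, u), 0 < ⟪p.2, u⟫ :=
      continuous_snd.continuousAt.eventually (eventually_inner_pos hu)
    filter_upwards [hz', hp1, hp1', hp2'] with p a1 a2 a3 a4 hpr
    have hρ0 : 0 < ρ p := div_pos a3 a4
    refine ⟨ρ p, hρ0, ?_⟩
    set v := ρ p • p.2 - p.1 with hv
    have hv0 : v ≠ 0 := fun h0 => hpr (ρ p) (sub_eq_zero.1 h0).symm
    have hvK : v ∈ K := by
      rw [Submodule.mem_orthogonal_singleton_iff_inner_left, hv, inner_sub_left,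
        real_inner_smul_left]
      simp only [ρ]
      field_simp
      ring
    refine ⟨(p.1, ‖v‖, ⟨‖v‖⁻¹ • v, K.smul_mem _ hvK⟩), ⟨a2, ⟨norm_pos_iff.2 hv0, a1⟩, ?_⟩, ?_⟩
    · simp [norm_smul, hv0]
    · have hqv : q (p.1, ‖v‖, ⟨‖v‖⁻¹ • v, K.smul_mem _ hvK⟩) = ρ p • p.2 := by
        change p.1 + ‖v‖ • (‖v‖⁻¹ • v) = ρ p • p.2
        rw [smul_smul, mul_inv_cancel₀ (norm_ne_zero_iff.2 hv0), one_smul, hv, add_sub_cancel]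
      simp only [F, hqv, h.map_smul _ hρ0, real_inner_smul_right]
      ring
  rcases hsign with hs | hs
  · left
    filter_upwards [hred] with p hp hpr
    obtain ⟨t, ht, z, hz, hzt⟩ := hp hpr
    have := hs z hz
    rw [hzt] at this
    linarith [(pos_iff_neg_of_mul_neg this).1 ht]
  · right
    filter_upwards [hred] with p hp hpr
    obtain ⟨t, ht, z, hz, hzt⟩ := hp hpr
    have := hs z hz
    rw [hzt] at this
    linarith [(pos_iff_pos_of_mul_pos this).1 ht]

/-- Norms are preserved and inner products decrease, so `M` does not shorten chords from `u`. A
kernel vector `X` is orthogonal to `u`, and difference quotients along it have norm at least `‖X‖`,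
yet they tend to zero. -/
lemma IsRadialGerm.fderiv_injective_of_gt (h : IsRadialGerm M u)
    (hgt : ∀ᶠ p in 𝓝 (u, u), (∀ r : ℝ, p.1 ≠ r • p.2) → ⟪M p.1, M p.2⟫ < ⟪p.1, p.2⟫) :
    Function.Injective (fderiv ℝ M u) := by
  rw [injective_iff_map_eq_zero]
  intro X hX
  by_contra hX0
  have huX : ⟪u, X⟫ = 0 := by rw [← h.inner_fderiv, hX, inner_zero_right]
  have hcurve : HasDerivAt (fun s : ℝ => u + s • X) X 0 := by
    simpa using ((hasDerivAt_id (0 : ℝ)).smul_const X).const_add u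
  have hu' : u + (0 : ℝ) • X = u := by simp
  have hder : HasDerivAt (fun s : ℝ => M (u + s • X)) 0 0 := by
    rw [← hX]
    refine HasFDerivAt.comp_hasDerivAt (0 : ℝ) ?_ hcurve
    rw [hu']; exact h.differentiableAt.hasFDerivAt
  have hten : Tendsto (fun s : ℝ => u + s • X) (𝓝[≠] 0) (𝓝 u) := by
    have := hcurve.continuousAt.tendsto
    rw [hu'] at this
    exact this.mono_left nhdsWithin_le_nhds
  have hgt' : ∀ᶠ x in 𝓝 u, (∀ r : ℝ, x ≠ r • u) → ⟪M x, M u⟫ < ⟪x, u⟫ :=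
    (Continuous.prodMk_left u).continuousAt.eventually hgt
  have hle : ‖X‖ ≤ ‖(0 : E)‖ := by
    refine ge_of_tendsto (hasDerivAt_iff_tendsto_slope.1 hder).norm ?_
    filter_upwards [hten.eventually hgt', hten.eventually h.norm_map, self_mem_nhdsWithin] with
      s h1 h2 hs
    have hne : ∀ r : ℝ, u + s • X ≠ r • u := by
      intro r hr
      have := congrArg (fun v => ⟪v, X⟫) hr
      simp only [inner_add_left, real_inner_smul_left, huX, mul_zero, zero_add] at this
      rcases mul_eq_zero.1 this with h | h
      · exact hs h
      · exact hX0 (inner_self_eq_zero.1 h)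
    have h4 := h1 hne
    have h5 : ‖s • X‖ ≤ ‖M (u + s • X) - M u‖ := by
      rw [← sq_le_sq₀ (norm_nonneg _) (norm_nonneg _), norm_sub_sq_real, h2,
        h.norm_map.self_of_nhds]
      have e1 : ‖s • X‖ ^ 2 = ‖(u + s • X) - u‖ ^ 2 := by rw [add_sub_cancel_left]
      rw [e1, norm_sub_sq_real]
      linarith
    rw [slope_def_module, norm_smul, hu', sub_zero, norm_inv]
    rw [norm_smul] at h5
    have hs' : 0 < ‖s‖ := norm_pos_iff.2 hs
    rw [← div_eq_inv_mul, le_div_iff₀ hs']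
    linarith
  rw [norm_zero] at hle
  exact hX0 (norm_le_zero_iff.1 hle)

/-- A strictly distance increasing germ has a strictly distance decreasing inverse. -/
lemma IsRadialGerm.exists_inverse [FiniteDimensional ℝ E] (h : IsRadialGerm M u)
    (hu : ‖u‖ = 1) (hrel : ∀ᶠ x in 𝓝 u, R x (M x))
    (hgt : ∀ᶠ p in 𝓝 (u, u), (∀ r : ℝ, p.1 ≠ r • p.2) → ⟪M p.1, M p.2⟫ < ⟪p.1, p.2⟫) :
    ∃ N : E → E, N (M u) = u ∧ IsDecreasingGerm (fun x y => R y x) N (M u) := by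
  have hinj := h.fderiv_injective_of_gt hgt
  let e : E ≃L[ℝ] E :=
    (LinearEquiv.ofInjectiveEndo (fderiv ℝ M u : E →ₗ[ℝ] E) hinj).toContinuousLinearEquiv
  have he : (e : E →L[ℝ] E) = fderiv ℝ M u := by ext x; rfl
  have hd : HasFDerivAt M (e : E →L[ℝ] E) u := by rw [he]; exact h.differentiableAt.hasFDerivAt
  have hst : HasStrictFDerivAt M (e : E →L[ℝ] E) u := h.contDiffAt.hasStrictFDerivAt' hd (by simp)
  let g := h.contDiffAt.localInverse hd (by simp)
  have hg : ContDiffAt ℝ 2 g (M u) := h.contDiffAt.to_localInverse hd (by simp)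
  have hgu : g (M u) = u := hst.localInverse_apply_image
  have hMg : ∀ᶠ y in 𝓝 (M u), M (g y) = y := hst.eventually_right_inverse
  have hv : ‖M u‖ = 1 := by rw [h.norm_map.self_of_nhds, hu]
  have hv0 : M u ≠ 0 := by intro h0; simp [h0] at hv
  have hrad : Tendsto (GreatCircle.radial : E → E) (𝓝 (M u)) (𝓝 (M u)) := by
    have := (contDiffAt_radial (n := 0) hv0).continuousAt.tendsto
    rwa [radial_of_norm_one hv] at this
  have hgt' : Tendsto g (𝓝 (M u)) (𝓝 u) := by
    have := hg.continuousAt.tendsto; rwa [hgu] at this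
  -- The local inverse is homogeneous only near `M u`; its radial extension is homogeneous
  -- everywhere.
  let N : E → E := fun y => ‖y‖ • g (GreatCircle.radial y)
  have hNu : N (M u) = u := by simp [N, hv, radial_of_norm_one hv, hgu]
  have hN2 : ContDiffAt ℝ 2 N (M u) := by
    refine (contDiffAt_norm ℝ hv0).smul (ContDiffAt.comp (M u) ?_ (contDiffAt_radial hv0))
    rwa [radial_of_norm_one hv]
  have hNt : Tendsto N (𝓝 (M u)) (𝓝 u) := by
    have := hN2.continuousAt.tendsto; rwa [hNu] at this
  have hMN : ∀ᶠ y in 𝓝 (M u), M (N y) = y := by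
    filter_upwards [hrad.eventually hMg, eventually_ne_nhds hv0] with y hy hy0
    simp only [N]
    rw [h.map_smul _ (norm_pos_iff.2 hy0), hy, norm_smul_radial hy0]
  refine ⟨N, hNu, ⟨hN2, ?_, ?_⟩, ?_, ?_⟩
  · intro t ht x
    simp only [N, radial_smul ht, norm_smul, Real.norm_of_nonneg ht.le, smul_smul]
  · filter_upwards [hMN, hNt.eventually h.norm_map] with y h1 h2
    rw [← h2, h1]
  · filter_upwards [hMN, hNt.eventually hrel] with y h1 h2
    rwa [h1] at h2
  · have hNN : Tendsto (fun p : E × E => (N p.1, N p.2)) (𝓝 (M u, M u)) (𝓝 (u, u)) := by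
      rw [nhds_prod_eq, nhds_prod_eq]
      exact hNt.prodMap hNt
    have f1 : Tendsto (Prod.fst : E × E → E) (𝓝 (M u, M u)) (𝓝 (M u)) :=
      continuous_fst.tendsto _
    have f2 : Tendsto (Prod.snd : E × E → E) (𝓝 (M u, M u)) (𝓝 (M u)) :=
      continuous_snd.tendsto _
    filter_upwards [hNN.eventually hgt, f1.eventually hMN, f2.eventually hMN,
      (hNt.comp f1).eventually (eventually_inner_pos hu),
      (hNt.comp f2).eventually (eventually_inner_pos hu)] with p h1 h2 h4 h5 h6 hpr
    simp only [h2, h4, Function.comp_apply] at h1 h5 h6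
    refine h1 fun r hr => ?_
    have hr0 : 0 < r := by
      rw [hr, real_inner_smul_left] at h5
      exact (pos_iff_pos_of_mul_pos h5).2 h6
    apply hpr r
    rw [← h2, ← h4, hr, h.map_smul r hr0, h4]

theorem IsCircleRelation.eventually_rel [FiniteDimensional ℝ E] (h3 : Module.finrank ℝ E = 3)
    (hR : IsCircleRelation R) (hu : ‖u‖ = 1) (h : IsRadialGerm M u)
    (hrel : ∀ᶠ x in 𝓝 u, R x (M x)) :
    (∀ᶠ x in 𝓝 u, R x (‖x‖ • M u)) ∨ (∀ᶠ y in 𝓝 (M u), R (‖y‖ • u) y) := by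
  rcases hR.lt_or_gt h3 hu h hrel with h1 | h1
  · exact Or.inl (IsDecreasingGerm.eventually_rel h3 hR hu ⟨h, hrel, h1⟩)
  · obtain ⟨N, hN, hN'⟩ := h.exists_inverse hu hrel h1
    have := hN'.eventually_rel h3 hR.op (by rw [h.norm_map.self_of_nhds, hu])
    rw [hN] at this
    exact Or.inr this

end Relation

/-! ### Great circles in quaternionic coordinates. -/

section Circles

/-- Euclidean 3-space, the space of imaginary quaternions. -/
abbrev E3 : Type := EuclideanSpace ℝ (Fin 3)

/-- The embedding of Euclidean 3-space as the space of imaginary quaternions. -/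
def imL : E3 →ₗᵢ[ℝ] ℍ[ℝ] where
  toFun x := ⟨0, x 0, x 1, x 2⟩
  map_add' x y := QuaternionAlgebra.ext (by change (0 : ℝ) = 0 + 0; simp) rfl rfl rfl
  map_smul' c x := QuaternionAlgebra.ext (by change (0 : ℝ) = c * 0; simp) rfl rfl rfl
  norm_map' x := by
    rw [← sq_eq_sq₀ (norm_nonneg _) (norm_nonneg _), sq, ← Quaternion.normSq_eq_norm_mul_self,
      EuclideanSpace.norm_sq_eq, Fin.sum_univ_three, Quaternion.normSq_def']
    change (0 : ℝ) ^ 2 + x 0 ^ 2 + x 1 ^ 2 + x 2 ^ 2 = _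
    simp

@[simp] lemma imL_re (x : E3) : (imL x).re = 0 := rfl
@[simp] lemma imL_imI (x : E3) : (imL x).imI = x 0 := rfl
@[simp] lemma imL_imJ (x : E3) : (imL x).imJ = x 1 := rfl
@[simp] lemma imL_imK (x : E3) : (imL x).imK = x 2 := rfl

/-- The imaginary part of a quaternion. -/
def imPart (q : ℍ[ℝ]) : E3 := !₂[q.imI, q.imJ, q.imK]

lemma imL_imPart {q : ℍ[ℝ]} (hq : q.re = 0) : imL (imPart q) = q := by
  ext <;> simp [imPart, hq]

lemma imL_injective : Function.Injective imL := imL.injective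

lemma inner_E3 (x y : E3) : ⟪x, y⟫ = x 0 * y 0 + x 1 * y 1 + x 2 * y 2 := by
  rw [PiLp.inner_apply, Fin.sum_univ_three]
  simp [mul_comm]

lemma star_imL (x : E3) : star (imL x) = -imL x := by
  ext <;> simp

lemma imL_mul_add (x y : E3) : imL x * imL y + imL y * imL x = ((-2 * ⟪x, y⟫ : ℝ) : ℍ[ℝ]) := by
  rw [inner_E3]
  ext <;> simp <;> ring

lemma imL_mul_self (x : E3) : imL x * imL x = ((-‖x‖ ^ 2 : ℝ) : ℍ[ℝ]) := by
  rw [← real_inner_self_eq_norm_sq, inner_E3]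
  ext <;> simp <;> ring

lemma eq_smul_of_commute {x : E3} (hx : x ≠ 0) {q : ℍ[ℝ]} (h : imL x * q = q * imL x) :
    ∃ a : ℝ, imPart q = a • x := by
  have hn : ⟪x, x⟫ ≠ 0 := inner_self_ne_zero.2 hx
  have h1 := congrArg (fun q : ℍ[ℝ] => q.imI) h
  have h2 := congrArg (fun q : ℍ[ℝ] => q.imJ) h
  have h3 := congrArg (fun q : ℍ[ℝ] => q.imK) h
  simp at h1 h2 h3
  refine ⟨⟪x, imPart q⟫ / ⟪x, x⟫, ?_⟩
  rw [div_eq_inv_mul, mul_smul, eq_inv_smul_iff₀ hn]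
  rw [inner_E3, inner_E3]
  ext i
  fin_cases i
  · simp [imPart]; linear_combination (x 2 / 2) * h2 - (x 1 / 2) * h3
  · simp [imPart]; linear_combination (x 0 / 2) * h3 - (x 2 / 2) * h1
  · simp [imPart]; linear_combination (x 1 / 2) * h1 - (x 0 / 2) * h2

/-- The great circle with (not necessarily normalized) coordinates `x` and `y`. -/
def circV (x y : E3) : Set S3 := {q : S3 | imL x * (q : ℍ[ℝ]) = (q : ℍ[ℝ]) * imL y}

lemma circleOf_eq (u v : S2) : circleOf u v = circV u v := rfl

lemma mem_circV {x y : E3} {q : S3} :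
    q ∈ circV x y ↔ imL x * (q : ℍ[ℝ]) = (q : ℍ[ℝ]) * imL y := Iff.rfl

lemma norm_S3 (q : S3) : ‖(q : ℍ[ℝ])‖ = 1 := by simp

lemma mul_star_of_norm_one {q : ℍ[ℝ]} (hq : ‖q‖ = 1) : q * star q = 1 := by
  rw [Quaternion.self_mul_star, Quaternion.normSq_eq_norm_mul_self, hq]; simp

lemma star_mul_of_norm_one {q : ℍ[ℝ]} (hq : ‖q‖ = 1) : star q * q = 1 := by
  rw [Quaternion.star_mul_self, Quaternion.normSq_eq_norm_mul_self, hq]; simp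

lemma circV_smul {x y : E3} {t : ℝ} (ht : t ≠ 0) : circV (t • x) (t • y) = circV x y := by
  ext q
  rw [mem_circV, mem_circV, map_smul, map_smul, smul_mul_assoc, mul_smul_comm]
  exact (smul_right_injective _ ht).eq_iff

lemma radial_mem_circV {x y : E3} {w : ℍ[ℝ]} (hw : w ≠ 0) (h : imL x * w = w * imL y) :
    (⟨radial w, by simpa using norm_radial hw⟩ : S3) ∈ circV x y := by
  rw [mem_circV]
  simp only [radial, mul_smul_comm, smul_mul_assoc, h]

/-- As `x` and `y` have the same scalar square, `x w + w y` intertwines them for every `w`. If it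
always vanished, `w = 1` would give `y = -x`, and then `x` would commute with `i` and `j`, forcing
`x = 0`. -/
lemma exists_ne_zero_intertwine {x y : E3} (hx : x ≠ 0) (hxy : ‖x‖ = ‖y‖) :
    ∃ w : ℍ[ℝ], w ≠ 0 ∧ imL x * w = w * imL y := by
  have key : ∀ w : ℍ[ℝ], imL x * (imL x * w + w * imL y) = (imL x * w + w * imL y) * imL y := by
    intro w
    rw [mul_add, add_mul, ← mul_assoc, mul_assoc w, imL_mul_self, imL_mul_self, hxy,
      Quaternion.coe_mul_eq_smul, Quaternion.mul_coe_eq_smul, mul_assoc, add_comm]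
  by_contra! hcon
  have h0 : ∀ w : ℍ[ℝ], imL x * w + w * imL y = 0 := by
    intro w
    by_contra hw
    exact hcon _ hw (key w)
  have h1 := h0 1
  rw [mul_one, one_mul] at h1
  have hy : imL y = -imL x := by rw [eq_neg_iff_add_eq_zero, add_comm]; exact h1
  have hi := h0 (imL (EuclideanSpace.single 0 1))
  have hj := h0 (imL (EuclideanSpace.single 1 1))
  rw [hy] at hi hj
  have e1 := congrArg (fun q : ℍ[ℝ] => q.imJ) hi
  have e2 := congrArg (fun q : ℍ[ℝ] => q.imK) hi
  have e3 := congrArg (fun q : ℍ[ℝ] => q.imK) hj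
  simp at e1 e2 e3
  apply hx
  ext i
  fin_cases i <;> simp <;> linarith

lemma circV_nonempty {x y : E3} (hx : x ≠ 0) (hxy : ‖x‖ = ‖y‖) : (circV x y).Nonempty := by
  obtain ⟨w, hw, h⟩ := exists_ne_zero_intertwine hx hxy
  exact ⟨_, radial_mem_circV hw h⟩

lemma exists_conj_imL (x : E3) (q : ℍ[ℝ]) :
    ∃ y : E3, imL y = q * imL x * star q := by
  refine ⟨imPart (q * imL x * star q), imL_imPart ?_⟩
  have h : star (q * imL x * star q) = -(q * imL x * star q) := by
    rw [star_mul, star_mul, star_star, star_imL, neg_mul, mul_neg, mul_assoc]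
  have h2 := congrArg (fun q : ℍ[ℝ] => q.re) h
  simp only [Quaternion.re_star, Quaternion.re_neg] at h2
  linarith

lemma norm_eq_of_intertwine {x y : E3} {q : ℍ[ℝ]} (hq : q ≠ 0) (h : imL x * q = q * imL y) :
    ‖x‖ = ‖y‖ := by
  have := congrArg norm h
  rw [norm_mul, norm_mul, imL.norm_map, imL.norm_map, mul_comm] at this
  exact mul_left_cancel₀ (norm_ne_zero_iff.2 hq) this

/-- A quaternion commuting with `x` and intertwining `a` and `b`. -/
lemma exists_commute_intertwine {x a b : E3} (hx : x ≠ 0) (hab : ‖a‖ = ‖b‖) (hi : ⟪x, a⟫ = ⟪x, b⟫) :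
    ∃ z : ℍ[ℝ], z ≠ 0 ∧ imL x * z = z * imL x ∧ imL a * z = z * imL b := by
  have hn : ⟪x, x⟫ ≠ 0 := inner_self_ne_zero.2 hx
  set c : ℝ := ⟪x, a⟫ / ⟪x, x⟫ with hc
  set s : E3 := a - c • x with hs
  set r : E3 := b - c • x with hr
  have hxs : ⟪x, s⟫ = 0 := by
    rw [hs, inner_sub_right, real_inner_smul_right, hc]; field_simp; ring
  have hxr : ⟪x, r⟫ = 0 := by
    rw [hr, inner_sub_right, real_inner_smul_right, hc, ← hi]; field_simp; ring
  have hnorm : ‖s‖ ^ 2 = ‖r‖ ^ 2 := by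
    rw [hs, hr, norm_sub_sq_real, norm_sub_sq_real, hab, real_inner_smul_right,
      real_inner_smul_right, real_inner_comm, hi, real_inner_comm]
  have ha : imL a = c • imL x + imL s := by rw [hs, map_sub, map_smul]; abel
  have hb : imL b = c • imL x + imL r := by rw [hr, map_sub, map_smul]; abel
  have hcomm : ∀ t : E3, ⟪x, t⟫ = 0 → imL x * imL t = -(imL t * imL x) := by
    intro t ht
    have := imL_mul_add x t
    rw [ht, mul_zero, Quaternion.coe_zero] at this
    exact eq_neg_of_add_eq_zero_left this
  have hxs' := hcomm s hxs
  have hxr' := hcomm r hxr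
  have suff : ∀ z : ℍ[ℝ], imL x * z = z * imL x → imL s * z = z * imL r →
      imL a * z = z * imL b := by
    intro z h1 h2
    rw [ha, hb, add_mul, mul_add, smul_mul_assoc, mul_smul_comm, h1, h2]
  have hss := imL_mul_self s
  have hrr := imL_mul_self r
  by_cases hs0 : s = 0
  · have hr0 : r = 0 := by
      rw [hs0] at hnorm
      simpa using hnorm.symm
    exact ⟨1, one_ne_zero, by simp, suff 1 (by simp) (by simp [hs0, hr0])⟩
  by_cases hz : ((‖s‖ ^ 2 : ℝ) : ℍ[ℝ]) - imL s * imL r = 0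
  -- The components of `a` and `b` orthogonal to `x` are opposite: the rotation about `x` is a
  -- half-turn, given by `x` itself.
  · have h1 : imL s = -imL r := by
      have h2 := congrArg (fun q => imL s * q) hz
      simp only [mul_sub, mul_zero, ← mul_assoc, hss, Quaternion.mul_coe_eq_smul,
        Quaternion.coe_mul_eq_smul, neg_smul, sub_neg_eq_add] at h2
      rw [← smul_add] at h2
      rw [eq_neg_iff_add_eq_zero]
      exact (smul_eq_zero.1 h2).resolve_left (by simpa using hs0)
    refine ⟨imL x, fun h => hx (imL_injective (h.trans (map_zero imL).symm)), rfl, suff _ rfl ?_⟩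
    rw [hxr', h1, neg_mul]
  -- Here `z = ‖s‖² - s r` represents, up to scale, the rotation about `x` taking `r` to `s`.
  · refine ⟨_, hz, ?_, suff _ ?_ ?_⟩
    · rw [mul_sub, sub_mul, Quaternion.mul_coe_eq_smul, Quaternion.coe_mul_eq_smul, ← mul_assoc,
        hxs', neg_mul, mul_assoc, hxr', mul_neg, neg_neg, mul_assoc]
    · rw [mul_sub, sub_mul, Quaternion.mul_coe_eq_smul, Quaternion.coe_mul_eq_smul, ← mul_assoc,
        hxs', neg_mul, mul_assoc, hxr', mul_neg, neg_neg, mul_assoc]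
    · rw [mul_sub, sub_mul, Quaternion.mul_coe_eq_smul, Quaternion.coe_mul_eq_smul, ← mul_assoc,
        hss, mul_assoc, hrr, Quaternion.mul_coe_eq_smul, Quaternion.coe_mul_eq_smul, hnorm,
        neg_smul, neg_smul]
      abel

/-- Two great circles intersect as soon as their two pairs of coordinates form the same angles. -/
lemma circV_inter_nonempty {x y x' y' : E3} (hx : x ≠ 0) (hxy : ‖x‖ = ‖y‖) (hxy' : ‖x'‖ = ‖y'‖)
    (hi : ⟪x, x'⟫ = ⟪y, y'⟫) : (circV x y ∩ circV x' y').Nonempty := by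
  obtain ⟨q, hq⟩ := circV_nonempty hx hxy
  rw [mem_circV] at hq
  have h1 := norm_S3 q
  have hq0 : (q : ℍ[ℝ]) ≠ 0 := by intro h; rw [h, norm_zero] at h1; norm_num at h1
  -- Conjugation by a point `q` of the first circle turns `y` into `x` and `y'` into `b`. What
  -- remains is a rotation about `x` relating `x'` and `b`.
  obtain ⟨b, hb⟩ := exists_conj_imL y' _
  have hbq : imL b * (q : ℍ[ℝ]) = q * imL y' := by
    rw [hb, mul_assoc, star_mul_of_norm_one h1, mul_one]
  have hxb : ⟪x, b⟫ = ⟪y, y'⟫ := by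
    have e1 := imL_mul_add x b
    have e2 := imL_mul_add y y'
    have e3 : (imL x * imL b + imL b * imL x) * (q : ℍ[ℝ]) =
        q * (imL y * imL y' + imL y' * imL y) := by
      rw [add_mul, mul_assoc, mul_assoc, hq, hbq, ← mul_assoc, ← mul_assoc, hq, hbq, mul_add,
        mul_assoc, mul_assoc]
    rw [e1, e2, Quaternion.coe_mul_eq_smul, Quaternion.mul_coe_eq_smul] at e3
    have := smul_left_injective ℝ hq0 e3
    linarith
  obtain ⟨z, hz0, hz1, hz2⟩ := exists_commute_intertwine hx
    (hxy'.trans (norm_eq_of_intertwine hq0 hbq).symm) (hi.trans hxb.symm)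
  have hw : z * (q : ℍ[ℝ]) ≠ 0 := mul_ne_zero hz0 hq0
  refine ⟨_, radial_mem_circV hw ?_, radial_mem_circV hw ?_⟩
  · rw [← mul_assoc, hz1, mul_assoc, hq, mul_assoc]
  · rw [← mul_assoc, hz2, mul_assoc, hbq, mul_assoc]

lemma commute_of_mem_circV {x y : E3} {p q : S3} (hp : p ∈ circV x y) (hq : q ∈ circV x y) :
    imL x * ((q : ℍ[ℝ]) * star (p : ℍ[ℝ])) = ((q : ℍ[ℝ]) * star (p : ℍ[ℝ])) * imL x := by
  have h1 : imL y * star (p : ℍ[ℝ]) = star (p : ℍ[ℝ]) * imL x := by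
    have := congrArg star (mem_circV.1 hp)
    rw [star_mul, star_mul, star_imL, star_imL, mul_neg, neg_mul] at this
    exact (neg_injective this).symm
  rw [← mul_assoc, mem_circV.1 hq, mul_assoc, h1, mul_assoc]

lemma im_mul_star_ne_zero {p q : S3} (h1 : (q : ℍ[ℝ]) ≠ p) (h2 : (q : ℍ[ℝ]) ≠ -p) :
    imPart ((q : ℍ[ℝ]) * star (p : ℍ[ℝ])) ≠ 0 := by
  intro h
  set m := (q : ℍ[ℝ]) * star (p : ℍ[ℝ]) with hm
  have hr : m = (m.re : ℍ[ℝ]) := by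
    have e1 := congrArg (fun v : E3 => v 0) h
    have e2 := congrArg (fun v : E3 => v 1) h
    have e3 := congrArg (fun v : E3 => v 2) h
    simp [imPart] at e1 e2 e3
    ext <;> simp [e1, e2, e3]
  have hq : (q : ℍ[ℝ]) = m.re • (p : ℍ[ℝ]) := by
    rw [← Quaternion.coe_mul_eq_smul, ← hr, hm, mul_assoc, star_mul_of_norm_one (norm_S3 p), mul_one]
  have hn := congrArg norm hq
  rw [norm_smul, norm_S3, norm_S3, mul_one, Real.norm_eq_abs] at hn
  rcases (abs_eq zero_le_one).1 hn.symm with h3 | h3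
  · rw [h3, one_smul] at hq; exact h1 hq
  · rw [h3, neg_one_smul] at hq; exact h2 hq

/-- A great circle is determined by two of its points that are not antipodal. -/
lemma eq_smul_of_two_points {x y x' y' : E3} (hx : x ≠ 0) (hx' : x' ≠ 0) {p q : S3}
    (hp : p ∈ circV x y) (hq : q ∈ circV x y) (hp' : p ∈ circV x' y') (hq' : q ∈ circV x' y')
    (h1 : (q : ℍ[ℝ]) ≠ p) (h2 : (q : ℍ[ℝ]) ≠ -p) : ∃ t : ℝ, t ≠ 0 ∧ x' = t • x ∧ y' = t • y := by
  -- The quaternion `q p⁻¹` commutes with both `x` and `x'`, and its imaginary part is nonzero, so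
  -- both are multiples of it.
  obtain ⟨a, ha⟩ := eq_smul_of_commute hx (commute_of_mem_circV hp hq)
  obtain ⟨b, hb⟩ := eq_smul_of_commute hx' (commute_of_mem_circV hp' hq')
  have him := im_mul_star_ne_zero h1 h2
  have ha0 : a ≠ 0 := by rintro rfl; rw [zero_smul] at ha; exact him ha
  have hb0 : b ≠ 0 := by rintro rfl; rw [zero_smul] at hb; exact him hb
  have hxx : x' = (b⁻¹ * a) • x := by
    rw [mul_smul, ← ha, hb, smul_smul, inv_mul_cancel₀ hb0, one_smul]
  refine ⟨b⁻¹ * a, mul_ne_zero (inv_ne_zero hb0) ha0, hxx, ?_⟩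
  apply imL_injective
  have hpn := star_mul_of_norm_one (norm_S3 p)
  have e1 : ∀ x y, p ∈ circV x y → imL y = star (p : ℍ[ℝ]) * imL x * p := by
    intro x y h
    rw [mul_assoc, mem_circV.1 h, ← mul_assoc, hpn, one_mul]
  rw [map_smul, e1 _ _ hp', e1 _ _ hp, hxx, map_smul, mul_smul_comm, smul_mul_assoc]

/-- Rotation along a great circle. -/
lemma exists_second_point {x y : E3} (hx : x ≠ 0) {p : S3} (hp : p ∈ circV x y) {O : Set S3}
    (hO : IsOpen O) (hpO : p ∈ O) :
    ∃ q ∈ circV x y ∩ O, (q : ℍ[ℝ]) ≠ p ∧ (q : ℍ[ℝ]) ≠ -p := by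
  let w : ℝ → ℍ[ℝ] := fun t => (1 + t • imL x) * p
  have hwc : Continuous w := by fun_prop
  have hw0 : w 0 = p := by simp [w]
  have hp0 : (p : ℍ[ℝ]) ≠ 0 := by
    intro h; have := norm_S3 p; rw [h, norm_zero] at this; norm_num at this
  obtain ⟨O', hO', rfl⟩ := isOpen_induced_iff.1 hO
  have hr : ContinuousAt (fun t => radial (w t)) 0 := by
    have h1 : ContinuousAt (radial : ℍ[ℝ] → ℍ[ℝ]) (w 0) := by
      rw [hw0]; exact (contDiffAt_radial (n := 0) hp0).continuousAt
    exact ContinuousAt.comp (f := w) h1 hwc.continuousAt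
  have hr0 : radial (w 0) = p := by rw [hw0, radial_of_norm_one (norm_S3 p)]
  have h1 : ∀ᶠ t in 𝓝[≠] (0 : ℝ), radial (w t) ∈ O' :=
    (hr.eventually (hO'.mem_nhds (by simp only [hr0]; exact hpO))).filter_mono nhdsWithin_le_nhds
  obtain ⟨t, ht, ht0⟩ := (h1.and self_mem_nhdsWithin).exists
  have hre : ∀ c : ℝ, 1 + t • imL x ≠ (c : ℍ[ℝ]) := by
    intro c hc
    apply hx
    have e1 := congrArg (fun q : ℍ[ℝ] => q.imI) hc
    have e2 := congrArg (fun q : ℍ[ℝ] => q.imJ) hc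
    have e3 := congrArg (fun q : ℍ[ℝ] => q.imK) hc
    have ht0' : t ≠ 0 := ht0
    simp [ht0'] at e1 e2 e3
    ext i; fin_cases i <;> simp [e1, e2, e3]
  have hne : ∀ c : ℝ, w t ≠ c • (p : ℍ[ℝ]) := by
    intro c hc
    rw [← Quaternion.coe_mul_eq_smul] at hc
    exact hre c (mul_right_cancel₀ hp0 hc)
  have hwt : w t ≠ 0 := by simpa using hne 0
  have hsc : ∀ c : ℝ, radial (w t) ≠ c • (p : ℍ[ℝ]) := by
    intro c hc
    apply hne (‖w t‖ * c)
    rw [mul_smul, ← hc, norm_smul_radial hwt]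
  refine ⟨⟨radial (w t), by simpa using norm_radial hwt⟩, ⟨radial_mem_circV hwt ?_, ht⟩, ?_, ?_⟩
  · simp only [w]
    rw [mul_assoc, ← mem_circV.1 hp, ← mul_assoc, ← mul_assoc]
    congr 1
    simp [mul_add, add_mul]
  · simpa using hsc 1
  · simpa using hsc (-1)

/-- The tube lemma: the 3-sphere is compact, so the coordinates of circles leaving `U` form a closed
set. -/
lemma eventually_circV_subset {x y : E3} {U : Set S3} (hU : IsOpen U) (h : circV x y ⊆ U) :
    ∀ᶠ p in 𝓝 (x, y), circV p.1 p.2 ⊆ U := by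
  let Z : Set ((E3 × E3) × S3) :=
    {z | imL z.1.1 * (z.2 : ℍ[ℝ]) = (z.2 : ℍ[ℝ]) * imL z.1.2} ∩ {z | z.2 ∉ U}
  have hZ : IsClosed Z := by
    refine IsClosed.inter (isClosed_eq ?_ ?_) (hU.isClosed_compl.preimage continuous_snd)
    · have := imL.continuous; fun_prop
    · have := imL.continuous; fun_prop
  have hcl : IsClosed (Prod.fst '' Z) := isClosedMap_fst_of_compactSpace Z hZ
  have hmem : (Prod.fst '' Z)ᶜ ∈ 𝓝 (x, y) := by
    refine hcl.isOpen_compl.mem_nhds ?_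
    rintro ⟨⟨p, q⟩, ⟨hz1, hz2⟩, hp⟩
    simp only at hp
    subst hp
    exact hz2 (h hz1)
  filter_upwards [hmem] with p hp q hq
  by_contra hqU
  exact hp ⟨(p, q), ⟨hq, hqU⟩, rfl⟩

/-- The vector `‖x‖² q - x q y` lies in the plane of the circle with coordinates `(x, y)` and
depends continuously on them; at the initial coordinates it is a positive multiple of `q`. -/
lemma eventually_circV_inter_nonempty {x y : E3} (hx : x ≠ 0) (hxy : ‖x‖ = ‖y‖) {q : S3}
    (hq : q ∈ circV x y)
    {O : Set S3} (hO : IsOpen O) (hqO : q ∈ O) :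
    ∀ᶠ p in 𝓝 (x, y), ‖p.1‖ = ‖p.2‖ → (circV p.1 p.2 ∩ O).Nonempty := by
  let w : E3 × E3 → ℍ[ℝ] := fun p => (‖p.1‖ ^ 2) • (q : ℍ[ℝ]) - imL p.1 * q * imL p.2
  have hwc : Continuous w := by have := imL.continuous; fun_prop
  have hw0 : w (x, y) = (2 * ‖x‖ ^ 2) • (q : ℍ[ℝ]) := by
    simp only [w]
    rw [mem_circV.1 hq, mul_assoc, imL_mul_self, Quaternion.mul_coe_eq_smul, ← hxy, neg_smul,
      sub_neg_eq_add, ← add_smul, two_mul]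
  have hq0 : (q : ℍ[ℝ]) ≠ 0 := by
    intro h; have := norm_S3 q; rw [h, norm_zero] at this; norm_num at this
  have hpos : 0 < 2 * ‖x‖ ^ 2 := by have := norm_pos_iff.2 hx; positivity
  have hw1 : w (x, y) ≠ 0 := by rw [hw0]; exact smul_ne_zero hpos.ne' hq0
  obtain ⟨O', hO', rfl⟩ := isOpen_induced_iff.1 hO
  have hr : ContinuousAt (fun p => radial (w p)) (x, y) :=
    ContinuousAt.comp (f := w) (contDiffAt_radial (n := 0) hw1).continuousAt hwc.continuousAt
  have hr0 : radial (w (x, y)) = q := by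
    rw [hw0, radial_smul hpos, radial_of_norm_one (norm_S3 q)]
  filter_upwards [hr.eventually (hO'.mem_nhds (by simp only [hr0]; exact hqO)),
    hwc.continuousAt.eventually_ne hw1] with p hp hp0 hpn
  refine ⟨_, radial_mem_circV hp0 ?_, hp⟩
  simp only [w]
  rw [mul_sub, sub_mul, mul_smul_comm, smul_mul_assoc, ← mul_assoc, ← mul_assoc, imL_mul_self,
    mul_assoc (imL p.1 * (q : ℍ[ℝ])), imL_mul_self, Quaternion.mul_coe_eq_smul,
    Quaternion.coe_mul_eq_smul, hpn, neg_smul, neg_smul, neg_mul, smul_mul_assoc]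
  abel

end Circles

/-! ### Isometries of the 3-sphere and their action on coordinates. -/

section Isometries

lemma S3_ne_zero (q : S3) : (q : ℍ[ℝ]) ≠ 0 := by
  intro h; have := norm_S3 q; rw [h, norm_zero] at this; norm_num at this

lemma span_eq_top_of_isOpen {O : Set S3} (hO : IsOpen O) (hne : O.Nonempty) :
    Submodule.span ℝ ((fun q : S3 => (q : ℍ[ℝ])) '' O) = ⊤ := by
  obtain ⟨q, hq⟩ := hne
  obtain ⟨O', hO', rfl⟩ := isOpen_induced_iff.1 hO
  apply Submodule.eq_top_of_nonempty_interior'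
  refine ⟨q, mem_interior_iff_mem_nhds.2 ?_⟩
  have hr := (contDiffAt_radial (n := 0) (S3_ne_zero q)).continuousAt
  filter_upwards [hr.eventually (hO'.mem_nhds (by rw [radial_of_norm_one (norm_S3 q)]; exact hq)),
    eventually_ne_nhds (S3_ne_zero q)] with w hw hw0
  rw [← norm_smul_radial hw0]
  exact Submodule.smul_mem _ _ (Submodule.subset_span
    ⟨⟨radial w, by simpa using norm_radial hw0⟩, hw, rfl⟩)

lemma inner_eq_of_dist_eq {p q p' q' : S3} (h : dist p q = dist p' q') :
    ⟪(p : ℍ[ℝ]), (q : ℍ[ℝ])⟫ = ⟪(p' : ℍ[ℝ]), (q' : ℍ[ℝ])⟫ := by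
  rw [Subtype.dist_eq, Subtype.dist_eq, dist_eq_norm, dist_eq_norm] at h
  have h2 := congrArg (· ^ 2) h
  simp only [norm_sub_sq_real, norm_S3] at h2
  linarith

/-- A distance preserving map on an open subset of the 3-sphere is linear. -/
lemma exists_linearIsometry_of_dist_eq {O : Set S3} (hO : IsOpen O) (hne : O.Nonempty)
    {g : S3 → S3} (hg : ∀ p ∈ O, ∀ q ∈ O, dist (g p) (g q) = dist p q) :
    ∃ A : ℍ[ℝ] ≃ₗᵢ[ℝ] ℍ[ℝ], ∀ p ∈ O, ((g p : S3) : ℍ[ℝ]) = A p := by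
  have hspan := span_eq_top_of_isOpen hO hne
  have hinner : ∀ p ∈ O, ∀ q ∈ O,
      ⟪((g p : S3) : ℍ[ℝ]), ((g q : S3) : ℍ[ℝ])⟫ = ⟪(p : ℍ[ℝ]), (q : ℍ[ℝ])⟫ :=
    fun p hp q hq => inner_eq_of_dist_eq (hg p hp q hq)
  let B := Module.Basis.ofSpan hspan.ge
  have hB : ∀ i, ∃ p ∈ O, (p : ℍ[ℝ]) = B i := fun i =>
    Module.Basis.ofSpan_subset hspan.ge ⟨i, rfl⟩
  choose p hpO hpB using hB
  let T : ℍ[ℝ] →ₗ[ℝ] ℍ[ℝ] := B.constr ℝ fun i => ((g (p i) : S3) : ℍ[ℝ])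
  have hT : ∀ i, T (B i) = ((g (p i) : S3) : ℍ[ℝ]) := fun i => B.constr_basis ℝ _ i
  have hTT : (innerₗ ℍ[ℝ]).compl₁₂ T T = innerₗ ℍ[ℝ] := by
    refine B.ext fun i => B.ext fun j => ?_
    simp only [LinearMap.compl₁₂_apply, innerₗ_apply_apply, hT]
    rw [hinner _ (hpO i) _ (hpO j), hpB, hpB]
  have hTi : ∀ x y, ⟪T x, T y⟫ = ⟪x, y⟫ := fun x y =>
    LinearMap.congr_fun (LinearMap.congr_fun hTT x) y
  let A := (T.isometryOfInner hTi).toLinearIsometryEquiv rfl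
  have hA : ∀ x, A x = T x := fun x => rfl
  refine ⟨A, fun q hq => ?_⟩
  refine ext_inner_right ℝ fun w => ?_
  obtain ⟨z, rfl⟩ := A.surjective w
  rw [A.inner_map_map]
  have : (innerₗ ℍ[ℝ] ((g q : S3) : ℍ[ℝ])).comp T = innerₗ ℍ[ℝ] (q : ℍ[ℝ]) := by
    refine B.ext fun i => ?_
    simp only [LinearMap.comp_apply, innerₗ_apply_apply, hT]
    rw [hinner _ hq _ (hpO i), hpB]
  exact LinearMap.congr_fun this z

lemma inner_one_left (q : ℍ[ℝ]) : ⟪(1 : ℍ[ℝ]), q⟫ = q.re := by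
  rw [Quaternion.inner_def, one_mul, Quaternion.re_star]

lemma finrank_E3 : Module.finrank ℝ E3 = 3 := by simp

/-- Every linear isometry of the quaternions fixing `1` is an automorphism or an
antiautomorphism. -/
lemma map_mul_or_map_mul_rev (φ : ℍ[ℝ] →ₗᵢ[ℝ] ℍ[ℝ]) (h1 : φ 1 = 1) :
    (∀ p q, φ (p * q) = φ p * φ q) ∨ (∀ p q, φ (p * q) = φ q * φ p) := by
  have him : ∀ x : E3, (φ (imL x)).re = 0 := by
    intro x
    rw [← inner_one_left, ← h1, φ.inner_map_map, inner_one_left, imL_re]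
  let ψ : E3 → E3 := fun x => imPart (φ (imL x))
  have hψ : ∀ x, imL (ψ x) = φ (imL x) := fun x => imL_imPart (him x)
  have hψi : ∀ x y, ⟪ψ x, ψ y⟫ = ⟪x, y⟫ := by
    intro x y
    rw [← imL.inner_map_map, hψ, hψ, φ.inner_map_map, imL.inner_map_map]
  have hψn : ∀ x, ‖ψ x‖ = ‖x‖ := by
    intro x
    rw [← imL.norm_map, hψ, φ.norm_map, imL.norm_map]
  let i : E3 := EuclideanSpace.single 0 1
  let j : E3 := EuclideanSpace.single 1 1
  let k : E3 := EuclideanSpace.single 2 1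
  have ni : ‖ψ i‖ = 1 := by rw [hψn]; simp [i]
  have nj : ‖ψ j‖ = 1 := by rw [hψn]; simp [j]
  have nk : ‖ψ k‖ = 1 := by rw [hψn]; simp [k]
  have nij : ⟪ψ i, ψ j⟫ = 0 := by rw [hψi, inner_E3]; simp [i, j]
  have nik : ⟪ψ i, ψ k⟫ = 0 := by rw [hψi, inner_E3]; simp [i, k]
  have njk : ⟪ψ j, ψ k⟫ = 0 := by rw [hψi, inner_E3]; simp [j, k]
  set I := imL (ψ i) with hI
  set J := imL (ψ j) with hJ
  set K := imL (ψ k) with hK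
  have sq : ∀ x : E3, ‖x‖ = 1 → imL x * imL x = -1 := by
    intro x hx; rw [imL_mul_self, hx]; simp
  have ac : ∀ x y : E3, ⟪x, y⟫ = 0 → imL y * imL x = -(imL x * imL y) := by
    intro x y hxy
    have := imL_mul_add x y
    rw [hxy, mul_zero, Quaternion.coe_zero] at this
    exact eq_neg_of_add_eq_zero_right this
  have II : I * I = -1 := sq _ ni
  have JJ : J * J = -1 := sq _ nj
  have JI : J * I = -(I * J) := ac _ _ nij
  have hre : (I * J).re = 0 := by
    have := Quaternion.inner_def I J
    rw [hJ, star_imL, mul_neg, Quaternion.re_neg, hI, imL.inner_map_map, nij] at this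
    linarith
  obtain ⟨w, hw⟩ : ∃ w : E3, imL w = I * J := ⟨_, imL_imPart hre⟩
  have hwn : ‖w‖ = 1 := by
    rw [← imL.norm_map, hw, norm_mul, hI, hJ, imL.norm_map, imL.norm_map, ni, nj, one_mul]
  have hwi : ⟪ψ i, w⟫ = 0 := by
    rw [← imL.inner_map_map, hw, Quaternion.inner_def, star_mul, ← hI, hJ, hI, star_imL, star_imL,
      neg_mul_neg, ← hI, ← hJ, JI, mul_neg, ← mul_assoc, II]
    simp [hJ]
  have hwj : ⟪ψ j, w⟫ = 0 := by
    rw [← imL.inner_map_map, hw, Quaternion.inner_def, star_mul, hJ, hI, star_imL, star_imL,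
      neg_mul_neg, ← hI, ← hJ, ← mul_assoc, JJ]
    simp [hI]
  have hwk := expand_of_orthonormal finrank_E3 ni nj nk nij nik njk w
  rw [hwi, hwj, zero_smul, zero_smul, zero_add, zero_add] at hwk
  set e := ⟪ψ k, w⟫ with he
  have he1 : |e| = 1 := by
    have := congrArg norm hwk
    rwa [norm_smul, nk, mul_one, hwn, Real.norm_eq_abs, eq_comm] at this
  have hIJ : I * J = e • K := by rw [← hw, hwk, map_smul]
  have hφ : ∀ q : ℍ[ℝ], φ q = q.re • (1 : ℍ[ℝ]) + q.imI • I + q.imJ • J + q.imK • K := by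
    intro q
    have hq : q = q.re • (1 : ℍ[ℝ]) + q.imI • imL i + q.imJ • imL j + q.imK • imL k := by
      ext <;> simp [i, j, k]
    conv_lhs => rw [hq]
    simp only [map_add, map_smul, h1, hI, hJ, hK, hψ]
  have KK : K * K = -1 := sq _ nk
  have cases : ∀ s : ℝ, s * s = 1 → I * J = s • K → J * I = -(s • K) ∧ J * K = s • I ∧
      K * J = -(s • I) ∧ K * I = s • J ∧ I * K = -(s • J) := by
    intro s hs h
    have hK' : K = s • (I * J) := by rw [h, smul_smul, hs, one_smul]
    refine ⟨by rw [JI, h], ?_, ?_, ?_, ?_⟩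
    · rw [hK', mul_smul_comm, ← mul_assoc, JI, neg_mul, mul_assoc, JJ]; simp
    · rw [hK', smul_mul_assoc, mul_assoc, JJ]; simp
    · rw [hK', smul_mul_assoc, mul_assoc, JI, mul_neg, ← mul_assoc, II]; simp
    · rw [hK', mul_smul_comm, ← mul_assoc, II]; simp
  -- The product `I J` is orthogonal to `1`, `I` and `J`, hence `±K`: the sign decides between
  -- automorphism and antiautomorphism.
  rcases (abs_eq zero_le_one).1 he1 with h | h
  · left
    rw [h] at hIJ
    obtain ⟨c1, c2, c3, c4, c5⟩ := cases 1 (by norm_num) hIJ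
    intro p q
    rw [hφ, hφ p, hφ q]
    simp only [mul_add, add_mul, smul_mul_smul_comm, one_mul, mul_one, II, JJ, KK, hIJ, c1, c2, c3,
      c4, c5, Quaternion.re_mul, Quaternion.imI_mul, Quaternion.imJ_mul, Quaternion.imK_mul]
    module
  · right
    rw [h] at hIJ
    obtain ⟨c1, c2, c3, c4, c5⟩ := cases (-1) (by norm_num) hIJ
    intro p q
    rw [hφ, hφ p, hφ q]
    simp only [mul_add, add_mul, smul_mul_smul_comm, one_mul, mul_one, II, JJ, KK, hIJ, c1, c2, c3,
      c4, c5, Quaternion.re_mul, Quaternion.imI_mul, Quaternion.imJ_mul, Quaternion.imK_mul]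
    module

lemma exists_isometry_E3 (ψ : ℍ[ℝ] →ₗ[ℝ] ℍ[ℝ]) (hn : ∀ q, ‖ψ q‖ = ‖q‖)
    (hre : ∀ x : E3, (ψ (imL x)).re = 0) :
    ∃ α : E3 ≃ₗᵢ[ℝ] E3, ∀ x, imL (α x) = ψ (imL x) := by
  let T : E3 →ₗᵢ[ℝ] E3 :=
    { toFun := fun x => imPart (ψ (imL x))
      map_add' := fun x y => by
        apply imL_injective
        rw [imL_imPart (hre (x + y)), map_add, map_add, map_add, imL_imPart (hre x),
          imL_imPart (hre y)]
      map_smul' := fun c x => by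
        apply imL_injective
        rw [RingHom.id_apply, imL_imPart (hre (c • x)), map_smul, map_smul, map_smul,
          imL_imPart (hre x)]
      norm_map' := fun x => by
        change ‖imPart (ψ (imL x))‖ = ‖x‖
        rw [← imL.norm_map, imL_imPart (hre _), hn, imL.norm_map] }
  exact ⟨T.toLinearIsometryEquiv rfl, fun x => imL_imPart (hre x)⟩

/-- Isometries of the 3-sphere act on the coordinates of great circles by isometries of the two
factors, possibly exchanging them. -/
lemma exists_action (A : ℍ[ℝ] ≃ₗᵢ[ℝ] ℍ[ℝ]) : ∃ α β : E3 ≃ₗᵢ[ℝ] E3,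
    (∀ (x y : E3) (q : ℍ[ℝ]), imL x * q = q * imL y → imL (α x) * A q = A q * imL (β y)) ∨
    (∀ (x y : E3) (q : ℍ[ℝ]), imL x * q = q * imL y → imL (β y) * A q = A q * imL (α x)) := by
  -- Splitting off left multiplication by `A 1` leaves an isometry `φ` fixing `1`.
  set a := A 1 with ha
  have han : ‖a‖ = 1 := by rw [ha, A.norm_map, norm_one]
  have hsa : ‖star a‖ = 1 := by rw [Quaternion.norm_star, han]
  let φ : ℍ[ℝ] →ₗᵢ[ℝ] ℍ[ℝ] :=
    { toLinearMap := (LinearMap.mulLeft ℝ (star a)).comp (A.toLinearEquiv : ℍ[ℝ] →ₗ[ℝ] ℍ[ℝ])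
      norm_map' := fun q => by
        change ‖star a * A q‖ = ‖q‖
        rw [norm_mul, hsa, one_mul, A.norm_map] }
  have hφ : ∀ q, φ q = star a * A q := fun q => rfl
  have hA : ∀ q, A q = a * φ q := by
    intro q; rw [hφ, ← mul_assoc, mul_star_of_norm_one han, one_mul]
  have h1 : φ 1 = 1 := by rw [hφ, ← ha, star_mul_of_norm_one han]
  have him : ∀ x : E3, (φ (imL x)).re = 0 := by
    intro x
    rw [← inner_one_left, ← h1, φ.inner_map_map, inner_one_left, imL_re]
  have hsaa : ∀ q, star a * (a * q) = q := by
    intro q; rw [← mul_assoc, star_mul_of_norm_one han, one_mul]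
  obtain ⟨β, hβ⟩ := exists_isometry_E3 φ.toLinearMap φ.norm_map him
  obtain ⟨α, hα⟩ := exists_isometry_E3
    ((LinearMap.mulLeft ℝ a).comp ((LinearMap.mulRight ℝ (star a)).comp φ.toLinearMap))
    (fun q => by
      change ‖a * (φ q * star a)‖ = ‖q‖
      rw [norm_mul, norm_mul, hsa, han, φ.norm_map, one_mul, mul_one])
    (fun x => by
      change (a * (φ (imL x) * star a)).re = 0
      obtain ⟨y, hy⟩ := exists_conj_imL (imPart (φ (imL x))) a
      rw [← mul_assoc, ← imL_imPart (him x), ← hy, imL_re])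
  have hα' : ∀ x, imL (α x) = a * (φ (imL x) * star a) := hα
  have hβ' : ∀ x, imL (β x) = φ (imL x) := hβ
  rcases map_mul_or_map_mul_rev φ h1 with h | h
  · refine ⟨α, β, Or.inl fun x y q hq => ?_⟩
    rw [hα', hβ', hA, mul_assoc, mul_assoc, hsaa, mul_assoc, ← h, ← h, hq]
  · refine ⟨β, α, Or.inr fun x y q hq => ?_⟩
    rw [hα', hβ', hA, mul_assoc, mul_assoc, hsaa, mul_assoc, ← h, ← h, hq]

end Isometries

/-! ### The fibration as a circle relation. -/

section CircleRel

/-- The coordinates of the members of `F`. -/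
def circleRel (F : Set (Set S3)) (x y : E3) : Prop := ‖x‖ = ‖y‖ ∧ x ≠ 0 ∧ circV x y ∈ F

variable {W : Set S3} {F : Set (Set S3)}

lemma circleRel.smul {x y : E3} {t : ℝ} (h : circleRel F x y) (ht : t ≠ 0) :
    circleRel F (t • x) (t • y) :=
  ⟨by rw [norm_smul, norm_smul, h.1], smul_ne_zero ht h.2.1, by rw [circV_smul ht]; exact h.2.2⟩

lemma S2_norm (u : S2) : ‖(u : E3)‖ = 1 := by simp

lemma S2_ne_zero (u : S2) : (u : E3) ≠ 0 := by
  intro h; have := S2_norm u; rw [h, norm_zero] at this; norm_num at this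

lemma HasC2GraphMap.exists_coord (hC2 : HasC2GraphMap F) {C : Set S3} (hC : C ∈ F) :
    ∃ x y : E3, x ≠ 0 ∧ circV x y = C := by
  obtain ⟨V, f, -, -, ⟨-, u, -, hu⟩ | ⟨-, u, -, hu⟩⟩ := hC2 C hC
  · exact ⟨_, _, S2_ne_zero u, hu⟩
  · exact ⟨_, _, S2_ne_zero (f u), hu⟩

/-- The map `g` is known to be linear only on `O`, which need not contain the circle. As the image
is a great circle, two non-antipodal points in `O` suffice to identify it. -/
lemma circV_eq_of_image {A : ℍ[ℝ] ≃ₗᵢ[ℝ] ℍ[ℝ]} {g : S3 → S3} {O : Set S3} (hO : IsOpen O)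
    (hg : ∀ p ∈ O, ((g p : S3) : ℍ[ℝ]) = A p) {x y x' y' x'' y'' : E3} (hx : x ≠ 0) (hx' : x' ≠ 0)
    (hx'' : x'' ≠ 0) (hne : (circV x y ∩ O).Nonempty)
    (hA : ∀ q : ℍ[ℝ], imL x * q = q * imL y → imL x' * A q = A q * imL y')
    (hi : g '' circV x y = circV x'' y'') : circV x'' y'' = circV x' y' := by
  obtain ⟨p, hp, hpO⟩ := hne
  obtain ⟨q, ⟨hq, hqO⟩, h1, h2⟩ := exists_second_point hx hp hO hpO
  have hmem : ∀ r ∈ circV x y, r ∈ O → g r ∈ circV x' y' := by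
    intro r hr hrO
    rw [mem_circV, hg r hrO]
    exact hA r hr
  obtain ⟨t, ht, rfl, rfl⟩ := eq_smul_of_two_points hx' hx'' (hmem p hp hpO) (hmem q hq hqO)
    (hi ▸ Set.mem_image_of_mem g hp) (hi ▸ Set.mem_image_of_mem g hq)
    (by rw [hg p hpO, hg q hqO]; exact fun h => h1 (A.injective h))
    (by rw [hg p hpO, hg q hqO, ← map_neg]; exact fun h => h2 (A.injective h))
  exact circV_smul ht

/-- The map `T` stands for either kind of action on coordinates, with or without exchange of the
factors. The target coordinates are reached only up to sign because circles are unoriented. -/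
lemma circleRel_hom_of_action (hC2 : HasC2GraphMap F) {A : ℍ[ℝ] ≃ₗᵢ[ℝ] ℍ[ℝ]} {g : S3 → S3}
    {U O : Set S3} (hU : IsOpen U) (hO : IsOpen O) (hg : ∀ p ∈ O, ((g p : S3) : ℍ[ℝ]) = A p)
    (hgF : ∀ D ∈ F, D ⊆ U → g '' D ∈ F) {x y x' y' : E3} (hR : circleRel F x y)
    (hR' : circleRel F x' y') (hn : ‖x‖ = ‖x'‖) (hxU : circV x y ⊆ U) {p₀ : S3}
    (hp₀ : p₀ ∈ circV x y) (hp₀O : p₀ ∈ O) (hgC : g '' circV x y = circV x' y')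
    (T : E3 × E3 → E3 × E3)
    (hT : ∀ (p : E3 × E3) (q : ℍ[ℝ]), imL p.1 * q = q * imL p.2 →
      imL (T p).1 * A q = A q * imL (T p).2)
    (hTn : ∀ p : E3 × E3, ‖p.1‖ = ‖p.2‖ → ‖(T p).1‖ = ‖p.1‖ ∧ ‖(T p).2‖ = ‖p.1‖) :
    (∀ᶠ p in 𝓝 (x, y), circleRel F p.1 p.2 → circleRel F (T p).1 (T p).2) ∧
    (((T (x, y)).1 = x' ∧ (T (x, y)).2 = y') ∨ ((T (x, y)).1 = -x' ∧ (T (x, y)).2 = -y')) := by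
  have hT0 : ∀ p : E3 × E3, ‖p.1‖ = ‖p.2‖ → p.1 ≠ 0 → (T p).1 ≠ 0 := by
    intro p hp hp0
    rw [← norm_ne_zero_iff, (hTn p hp).1]
    exact norm_ne_zero_iff.2 hp0
  constructor
  · filter_upwards [eventually_circV_subset hU hxU,
      eventually_circV_inter_nonempty hR.2.1 hR.1 hp₀ hO hp₀O] with p hp1 hp2 hp
    refine ⟨(hTn p hp.1).1.trans (hTn p hp.1).2.symm, hT0 p hp.1 hp.2.1, ?_⟩
    have hD := hgF _ hp.2.2 hp1
    obtain ⟨x'', y'', hx'', hi⟩ := hC2.exists_coord hD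
    rw [← circV_eq_of_image hO hg hp.2.1 (hT0 p hp.1 hp.2.1) hx'' (hp2 hp.1) (hT p) hi.symm, hi]
    exact hD
  · obtain ⟨q, ⟨hq, hqO⟩, h1, h2⟩ := exists_second_point hR.2.1 hp₀ hO hp₀O
    have hmem : ∀ r ∈ circV x y, r ∈ O → g r ∈ circV (T (x, y)).1 (T (x, y)).2 := by
      intro r hr hrO
      rw [mem_circV, hg r hrO]
      exact hT (x, y) r hr
    obtain ⟨t, ht, e1, e2⟩ := eq_smul_of_two_points hR'.2.1 (hT0 (x, y) hR.1 hR.2.1)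
      (hgC ▸ Set.mem_image_of_mem g hp₀) (hgC ▸ Set.mem_image_of_mem g hq)
      (hmem p₀ hp₀ hp₀O) (hmem q hq hqO)
      (by rw [hg p₀ hp₀O, hg q hqO]; exact fun h => h1 (A.injective h))
      (by rw [hg p₀ hp₀O, hg q hqO, ← map_neg]; exact fun h => h2 (A.injective h))
    have ht1 : |t| = 1 := by
      have h3 := (hTn (x, y) hR.1).1
      rw [e1, norm_smul, hn, Real.norm_eq_abs] at h3
      exact mul_right_cancel₀ (norm_ne_zero_iff.2 hR'.2.1) (h3.trans (one_mul _).symm)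
    rw [e1, e2]
    rcases (abs_eq zero_le_one).1 ht1 with h | h
    · left; rw [h, one_smul, one_smul]; exact ⟨rfl, rfl⟩
    · right; rw [h, neg_one_smul, neg_one_smul]; exact ⟨rfl, rfl⟩

lemma circleRel.neg {x y : E3} (h : circleRel F x y) : circleRel F (-x) (-y) := by
  simpa using h.smul (t := -1) (by norm_num)

lemma isCircleRelation (hF : IsGreatCircleFibration W F) (hC2 : HasC2GraphMap F)
    (hhom : LocallyFiberwiseHomogeneous F) : IsCircleRelation (circleRel F) where
  norm_eq h := h.1
  smul h ht := h.smul ht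
  sep {x y x' y'} h h' hi := by
    have heq : circV x y = circV x' y' := by
      by_contra hne
      obtain ⟨q, hq, hq'⟩ := circV_inter_nonempty h.2.1 h.1 h'.1 hi
      exact Set.disjoint_left.1 (hF.pairwiseDisjoint _ h.2.2 _ h'.2.2 hne) hq hq'
    obtain ⟨p, hp⟩ := circV_nonempty h.2.1 h.1
    obtain ⟨q, ⟨hq, -⟩, h1, h2⟩ := exists_second_point h.2.1 hp isOpen_univ trivial
    obtain ⟨t, -, ht⟩ := eq_smul_of_two_points h.2.1 h'.2.1 hp hq (heq ▸ hp) (heq ▸ hq) h1 h2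
    exact ⟨t, ht⟩
  hom {x y x' y'} h h' hn := by
    obtain ⟨U, U', g, hU, -, hCU, -, ⟨-, hiso⟩, hgF, hgC⟩ := hhom _ h.2.2 _ h'.2.2
    obtain ⟨p₀, hp₀⟩ := circV_nonempty h.2.1 h.1
    obtain ⟨N, hN, hdist⟩ := hiso p₀ (hCU hp₀)
    have hO : IsOpen (interior N ∩ U) := isOpen_interior.inter hU
    have hp₀O : p₀ ∈ interior N ∩ U := ⟨mem_interior_iff_mem_nhds.2 hN, hCU hp₀⟩
    obtain ⟨A, hA⟩ := exists_linearIsometry_of_dist_eq hO ⟨p₀, hp₀O⟩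
      (fun p hp q hq => hdist p ⟨interior_subset hp.1, hp.2⟩ q ⟨interior_subset hq.1, hq.2⟩)
    have main := circleRel_hom_of_action hC2 hU hO hA hgF h h' hn hCU hp₀ hp₀O hgC
    obtain ⟨α, β, hαβ | hαβ⟩ := exists_action A
    · obtain ⟨hev, ⟨e1, e2⟩ | ⟨e1, e2⟩⟩ := main (fun p => (α p.1, β p.2))
        (fun p q hq => hαβ p.1 p.2 q hq)
        (fun p hp => ⟨α.norm_map _, by rw [hp]; exact β.norm_map _⟩)
      · exact ⟨α, β, Or.inl ⟨e1, e2, hev⟩⟩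
      -- Composing both isometries with the antipodal map corrects the orientation.
      · refine ⟨α.trans (LinearIsometryEquiv.neg ℝ), β.trans (LinearIsometryEquiv.neg ℝ),
          Or.inl ⟨?_, ?_, hev.mono fun p hp hpR => (hp hpR).neg⟩⟩
        · simp only at e1; simp [e1]
        · simp only at e2; simp [e2]
    · obtain ⟨hev, ⟨e1, e2⟩ | ⟨e1, e2⟩⟩ := main (fun p => (β p.2, α p.1))
        (fun p q hq => hαβ p.1 p.2 q hq)
        (fun p hp => ⟨by rw [hp]; exact β.norm_map _, α.norm_map _⟩)
      · exact ⟨α, β, Or.inr ⟨e2, e1, hev⟩⟩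
      · refine ⟨α.trans (LinearIsometryEquiv.neg ℝ), β.trans (LinearIsometryEquiv.neg ℝ),
          Or.inr ⟨?_, ?_, hev.mono fun p hp hpR => (hp hpR).neg⟩⟩
        · simp only at e2; simp [e2]
        · simp only at e1; simp [e1]

end CircleRel

/-! ### From `C²` maps of 2-spheres to radial germs. -/

section Germs

/-- Central projection from Euclidean 3-space to the 2-sphere, with an arbitrary value at `0`. -/
def toS2 (x : E3) : S2 :=
  if h : x = 0 then ⟨EuclideanSpace.single 0 1, by simp⟩
  else ⟨radial x, by simpa using norm_radial h⟩

lemma coe_toS2 {x : E3} (hx : x ≠ 0) : (toS2 x : E3) = radial x := by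
  simp [toS2, hx]

lemma toS2_coe (u : S2) : toS2 u = u := by
  apply Subtype.ext
  rw [coe_toS2 (S2_ne_zero u), radial_of_norm_one (S2_norm u)]

lemma continuousAt_toS2 {x : E3} (hx : x ≠ 0) : ContinuousAt toS2 x := by
  rw [Topology.IsInducing.subtypeVal.continuousAt_iff]
  refine (contDiffAt_radial (n := 0) hx).continuousAt.congr ?_
  filter_upwards [eventually_ne_nhds hx] with y hy
  exact (coe_toS2 hy).symm

/-- The chart of the sphere at `v` is stereographic projection from `-v`, which is smooth near `v`.
-/
lemma contMDiffAt_toS2 {x : E3} (hx : x ≠ 0) :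
    ContMDiffAt (modelWithCornersSelf ℝ E3) (𝓡 2) 2 toS2 x := by
  have : Fact (Module.finrank ℝ E3 = 2 + 1) := ⟨finrank_E3⟩
  rw [contMDiffAt_iff_target]
  refine ⟨continuousAt_toS2 hx, ?_⟩
  set v := toS2 x with hv
  have hvx : (v : E3) = radial x := coe_toS2 hx
  let U := (OrthonormalBasis.fromOrthogonalSpanSingleton (𝕜 := ℝ) 2
    (ne_zero_of_mem_unit_sphere (-v))).repr
  have h1 : ContDiffAt ℝ 2 (stereoToFun ((-v : S2) : E3)) (radial x) := by
    refine contDiffOn_stereoToFun.contDiffAt ((isOpen_ne_fun (by fun_prop) (by fun_prop)).mem_nhds ?_)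
    simp only [Set.mem_ofPred_eq, innerSL_apply_apply, ← hvx]
    rw [show ((-v : S2) : E3) = -(v : E3) from rfl, inner_neg_left, real_inner_self_eq_norm_sq,
      S2_norm]
    norm_num
  have h2 : ContDiffAt ℝ 2 (fun y => U (stereoToFun ((-v : S2) : E3) (radial y))) x :=
    U.contDiff.contDiffAt.comp x (h1.comp x (contDiffAt_radial hx))
  refine ContMDiffAt.congr_of_eventuallyEq h2.contMDiffAt ?_
  filter_upwards [eventually_ne_nhds hx] with y hy
  have : radial y = (toS2 y : E3) := (coe_toS2 hy).symm
  rw [this]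
  rfl

/-- The radial extension of a `C²` map between 2-spheres. -/
lemma isRadialGerm_of_contMDiffOn {V : Set S2} {f : S2 → S2} (hV : IsOpen V)
    (hf : ContMDiffOn (𝓡 2) (𝓡 2) 2 f V) {u : S2} (hu : u ∈ V) :
    IsRadialGerm (fun x : E3 => ‖x‖ • (f (toS2 x) : E3)) u where
  contDiffAt := by
    have : Fact (Module.finrank ℝ E3 = 2 + 1) := ⟨finrank_E3⟩
    have hu0 := S2_ne_zero u
    have h1 : ContMDiffAt (𝓡 2) (𝓡 2) 2 f (toS2 u) := by
      rw [toS2_coe]; exact hf.contMDiffAt (hV.mem_nhds hu)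
    have h2 : ContMDiffAt (modelWithCornersSelf ℝ E3) (modelWithCornersSelf ℝ E3) 2
        (fun x : E3 => (f (toS2 x) : E3)) (u : E3) :=
      (contMDiff_coe_sphere (E := E3) (n := 2) (m := 2)).contMDiffAt.comp (u : E3)
        (h1.comp (u : E3) (contMDiffAt_toS2 hu0))
    exact (contDiffAt_norm ℝ hu0).smul h2.contDiffAt
  map_smul t ht x := by
    have : toS2 (t • x) = toS2 x := by
      by_cases hx : x = 0
      · simp [hx]
      · apply Subtype.ext
        rw [coe_toS2 hx, coe_toS2 (smul_ne_zero ht.ne' hx), radial_smul ht]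
    simp only [this, norm_smul, Real.norm_of_nonneg ht.le, smul_smul]
  norm_map := Eventually.of_forall fun x => by simp [norm_smul]

lemma circleRel_toS2 {F : Set (Set S3)} {x : E3} (hx : x ≠ 0) {v : S2}
    (h : circleOf (toS2 x) v ∈ F) : circleRel F x (‖x‖ • (v : E3)) := by
  refine ⟨by simp [norm_smul], hx, ?_⟩
  rw [circleOf_eq, coe_toS2 hx, ← circV_smul (norm_ne_zero_iff.2 hx), norm_smul_radial hx] at h
  exact h

lemma circleRel_toS2' {F : Set (Set S3)} {x : E3} (hx : x ≠ 0) {v : S2}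
    (h : circleOf v (toS2 x) ∈ F) : circleRel F (‖x‖ • (v : E3)) x := by
  refine ⟨by simp [norm_smul], smul_ne_zero (norm_ne_zero_iff.2 hx) (S2_ne_zero v), ?_⟩
  rw [circleOf_eq, coe_toS2 hx, ← circV_smul (norm_ne_zero_iff.2 hx), norm_smul_radial hx] at h
  exact h

/-- Near each of its members, a locally fiberwise homogeneous fibration has one constant
coordinate. -/
theorem exists_constant_coord {W : Set S3} {F : Set (Set S3)} (hF : IsGreatCircleFibration W F)
    (hC2 : HasC2GraphMap F) (hhom : LocallyFiberwiseHomogeneous F) {C : Set S3} (hC : C ∈ F) :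
    ∃ u v : S2, circleOf u v = C ∧
      ((∀ᶠ w in 𝓝 u, circleOf w v ∈ F) ∨ (∀ᶠ w in 𝓝 v, circleOf u w ∈ F)) := by
  have hR := isCircleRelation hF hC2 hhom
  have hcoe : ∀ w : S2, Tendsto (fun z : S2 => (z : E3)) (𝓝 w) (𝓝 (w : E3)) := fun w =>
    continuous_subtype_val.tendsto w
  obtain ⟨V, f, hV, hf, ⟨hfF, u, hu, huC⟩ | ⟨hfF, v, hv, hvC⟩⟩ := hC2 C hC
  · refine ⟨u, f u, huC, ?_⟩
    have hV' : ∀ᶠ x in 𝓝 (u : E3), toS2 x ∈ V :=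
      (continuousAt_toS2 (S2_ne_zero u)).eventually
        (by rw [toS2_coe]; exact hV.mem_nhds hu)
    have hrel : ∀ᶠ x in 𝓝 (u : E3), circleRel F x (‖x‖ • (f (toS2 x) : E3)) := by
      filter_upwards [hV', eventually_ne_nhds (S2_ne_zero u)] with x hx hx0
      exact circleRel_toS2 hx0 (hfF _ hx)
    have key := hR.eventually_rel finrank_E3 (S2_norm u) (isRadialGerm_of_contMDiffOn hV hf hu) hrel
    simp only [S2_norm, one_smul, toS2_coe] at key
    refine key.imp (fun h => ((hcoe u).eventually h).mono fun w hw => ?_)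
      (fun h => ((hcoe (f u)).eventually h).mono fun w hw => ?_)
    · rw [S2_norm, one_smul] at hw; exact hw.2.2
    · rw [S2_norm, one_smul] at hw; exact hw.2.2
  · refine ⟨f v, v, hvC, Or.symm ?_⟩
    have hV' : ∀ᶠ x in 𝓝 (v : E3), toS2 x ∈ V :=
      (continuousAt_toS2 (S2_ne_zero v)).eventually
        (by rw [toS2_coe]; exact hV.mem_nhds hv)
    have hrel : ∀ᶠ x in 𝓝 (v : E3), circleRel F (‖x‖ • (f (toS2 x) : E3)) x := by
      filter_upwards [hV', eventually_ne_nhds (S2_ne_zero v)] with x hx hx0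
      exact circleRel_toS2' hx0 (hfF _ hx)
    have key := hR.op.eventually_rel finrank_E3 (S2_norm v)
      (isRadialGerm_of_contMDiffOn hV hf hv) hrel
    simp only [S2_norm, one_smul, toS2_coe] at key
    refine key.imp (fun h => ((hcoe v).eventually h).mono fun w hw => ?_)
      (fun h => ((hcoe (f v)).eventually h).mono fun w hw => ?_)
    · rw [S2_norm, one_smul] at hw; exact hw.2.2
    · rw [S2_norm, one_smul] at hw; exact hw.2.2

end Germs

/-! ### Families of parallel circles and the connectedness argument. -/

section Parallel

/-- The great circle through a point with a prescribed right coordinate (`Sum.inl`) or left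
coordinate (`Sum.inr`). -/
def parallel : S2 ⊕ S2 → S3 → Set S3
  | .inl v, p => {y | imL v * (star (p : ℍ[ℝ]) * y) = star (p : ℍ[ℝ]) * y * imL v}
  | .inr u, p => {y | imL u * ((y : ℍ[ℝ]) * star (p : ℍ[ℝ])) = y * star (p : ℍ[ℝ]) * imL u}

lemma S3_star_mul (p : S3) : star (p : ℍ[ℝ]) * p = 1 := star_mul_of_norm_one (norm_S3 p)

lemma S3_mul_star (p : S3) : (p : ℍ[ℝ]) * star (p : ℍ[ℝ]) = 1 := mul_star_of_norm_one (norm_S3 p)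

lemma mem_parallel (τ : S2 ⊕ S2) (p : S3) : p ∈ parallel τ p := by
  cases τ with
  | inl v => simp [parallel, S3_star_mul]
  | inr u => simp [parallel, S3_mul_star]

lemma circleOf_eq_parallel_inl {u v : S2} {p : S3}
    (h : imL u = p * imL v * star (p : ℍ[ℝ])) : circleOf u v = parallel (.inl v) p := by
  ext y
  rw [circleOf_eq, mem_circV, h]
  change _ ↔ _ = _
  constructor
  · intro hy
    rw [mul_assoc, ← hy]
    simp only [← mul_assoc, S3_star_mul, one_mul]
  · intro hy
    rw [mul_assoc, mul_assoc, hy]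
    simp only [← mul_assoc, S3_mul_star, one_mul]

lemma circleOf_eq_parallel_inr {u v : S2} {p : S3}
    (h : imL v = star (p : ℍ[ℝ]) * imL u * p) : circleOf u v = parallel (.inr u) p := by
  ext y
  rw [circleOf_eq, mem_circV, h]
  change _ ↔ _ = _
  constructor
  · intro hy
    rw [← mul_assoc, hy]
    simp only [mul_assoc, S3_mul_star, mul_one]
  · intro hy
    rw [← mul_assoc, ← mul_assoc, ← hy]
    simp only [mul_assoc, S3_star_mul, mul_one]

/-- The image of a unit imaginary quaternion under conjugation by a unit quaternion. -/
def conjS2 (q : ℍ[ℝ]) (v : S2) : S2 := toS2 (imPart (q * imL v * star q))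

lemma norm_imPart_conj {q : ℍ[ℝ]} (hq : ‖q‖ = 1) (v : S2) :
    imL (imPart (q * imL v * star q)) = q * imL v * star q ∧
      ‖imPart (q * imL v * star q)‖ = 1 := by
  obtain ⟨y, hy⟩ := exists_conj_imL (v : E3) q
  have h : imL (imPart (q * imL v * star q)) = q * imL v * star q := by
    apply imL_imPart
    rw [← hy, imL_re]
  refine ⟨h, ?_⟩
  rw [← imL.norm_map, h, norm_mul, norm_mul, Quaternion.norm_star, hq, imL.norm_map, S2_norm]
  norm_num

lemma imL_conjS2 {q : ℍ[ℝ]} (hq : ‖q‖ = 1) (v : S2) :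
    imL (conjS2 q v) = q * imL v * star q := by
  obtain ⟨h1, h2⟩ := norm_imPart_conj hq v
  rw [conjS2, coe_toS2 (by rw [← norm_ne_zero_iff, h2]; exact one_ne_zero),
    radial_of_norm_one h2, h1]

lemma continuous_imPart : Continuous imPart := by
  have h : Continuous fun q : ℍ[ℝ] => ![q.imI, q.imJ, q.imK] := by
    refine continuous_pi fun i => ?_
    fin_cases i
    · exact Quaternion.continuous_imI
    · exact Quaternion.continuous_imJ
    · exact Quaternion.continuous_imK
  exact (PiLp.continuous_toLp 2 _).comp h

lemma continuousAt_conjS2 {q : ℍ[ℝ]} (hq : ‖q‖ = 1) (v : S2) :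
    ContinuousAt (fun p => conjS2 p v) q := by
  have h2 := (norm_imPart_conj hq v).2
  refine ContinuousAt.comp (f := fun p : ℍ[ℝ] => imPart (p * imL v * star p))
    (continuousAt_toS2 (by rw [← norm_ne_zero_iff, h2]; exact one_ne_zero)) ?_
  have := continuous_imPart
  fun_prop

variable {W : Set S3} {F : Set (Set S3)}

/-- Two families of the same kind are cosets of centralizers, so agreement at one point forces
agreement everywhere. Families of different kinds cannot agree on an open set, since `p v p⁻¹` is
not locally constant up to sign. -/
lemma parallel_inj_of_eventually_eq {τ τ' : S2 ⊕ S2} {q : S3}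
    (h : ∀ᶠ p in 𝓝 q, parallel τ p = parallel τ' p) : parallel τ = parallel τ' := by
  have mixed : ∀ {v u : S2} {q : S3},
      ¬ ∀ᶠ p in 𝓝 q, parallel (.inl v) p = parallel (.inr u) p := by
    intro v u q h
    have hc : ∀ p : S3, parallel (.inl v) p = parallel (.inr u) p →
        ∃ a : ℝ, (a = 1 ∨ a = -1) ∧ (p : ℍ[ℝ]) * imL v * star (p : ℍ[ℝ]) = a • imL u := by
      intro p hp
      obtain ⟨h1, h2⟩ := norm_imPart_conj (norm_S3 p) v
      have hmem : (⟨p * imL v, by simp⟩ : S3) ∈ parallel (.inl v) p := by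
        change _ = _
        simp only [← mul_assoc, S3_star_mul, one_mul]
      rw [hp] at hmem
      obtain ⟨a, ha⟩ := eq_smul_of_commute (S2_ne_zero u) hmem
      refine ⟨a, ?_, by rw [← h1, ha, map_smul]⟩
      rw [ha, norm_smul, S2_norm, mul_one, Real.norm_eq_abs] at h2
      exact (abs_eq zero_le_one).1 h2
    have hval : ∀ (p : S3) (a : ℝ), (p : ℍ[ℝ]) * imL v * star (p : ℍ[ℝ]) = a • imL u →
        ⟪(p : ℍ[ℝ]) * imL v * star (p : ℍ[ℝ]), imL u⟫ = a := by
      intro p a ha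
      rw [ha, inner_smul_left, real_inner_self_eq_norm_sq, imL.norm_map, S2_norm]
      simp
    obtain ⟨s, hs, hsq⟩ := hc q h.self_of_nhds
    have hcont : Continuous fun p : S3 =>
        ⟪(p : ℍ[ℝ]) * imL v * star (p : ℍ[ℝ]), imL u⟫ := by fun_prop
    -- The coefficient is `±1` and continuous, so it is constant near `q`. The resulting condition
    -- is linear in `p`; open subsets of the 3-sphere span, so it holds for all quaternions, and `v`
    -- would be central.
    have hev : ∀ᶠ p : S3 in 𝓝 q, (p : ℍ[ℝ]) * imL v = s • (imL u * p) := by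
      have hd := (hcont.continuousAt (x := q)).eventually (Metric.ball_mem_nhds _ (ε := 1) one_pos)
      filter_upwards [h, hd] with p hp hpd
      obtain ⟨a, ha, hap⟩ := hc p hp
      rw [hval q s hsq, hval p a hap, Real.dist_eq] at hpd
      have has : a = s := by
        rcases ha with rfl | rfl <;> rcases hs with rfl | rfl <;> first | rfl | norm_num at hpd
      rw [← has, ← smul_mul_assoc, ← hap, mul_assoc _ (star (p : ℍ[ℝ])), S3_star_mul, mul_one]
    obtain ⟨O, hO, hOo, hqO⟩ := eventually_nhds_iff.1 hev
    let K : Submodule ℝ ℍ[ℝ] :=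
      LinearMap.ker (LinearMap.mulRight ℝ (imL v) - s • LinearMap.mulLeft ℝ (imL u))
    have hK : K = ⊤ := by
      rw [eq_top_iff, ← span_eq_top_of_isOpen hOo ⟨q, hqO⟩, Submodule.span_le]
      rintro _ ⟨p, hp, rfl⟩
      simp only [K, SetLike.mem_coe, LinearMap.mem_ker, LinearMap.sub_apply, LinearMap.smul_apply,
        LinearMap.mulRight_apply, LinearMap.mulLeft_apply, sub_eq_zero]
      exact hO p hp
    have hall : ∀ p : ℍ[ℝ], p * imL v = s • (imL u * p) := by
      intro p
      have : p ∈ K := hK ▸ Submodule.mem_top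
      simpa only [K, LinearMap.mem_ker, LinearMap.sub_apply, LinearMap.smul_apply,
        LinearMap.mulRight_apply, LinearMap.mulLeft_apply, sub_eq_zero] using this
    have h1 := hall 1
    rw [one_mul, mul_one] at h1
    have hcomm : ∀ p : ℍ[ℝ], p * imL v = imL v * p := by
      intro p; rw [hall p, h1, smul_mul_assoc]
    have e1 := congrArg (fun q : ℍ[ℝ] => q.imJ) (hcomm (imL (EuclideanSpace.single 0 1)))
    have e2 := congrArg (fun q : ℍ[ℝ] => q.imK) (hcomm (imL (EuclideanSpace.single 0 1)))
    have e3 := congrArg (fun q : ℍ[ℝ] => q.imK) (hcomm (imL (EuclideanSpace.single 1 1)))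
    simp at e1 e2 e3
    apply S2_ne_zero v
    ext i
    fin_cases i <;> simp <;> linarith
  have left : ∀ v : S2, ∀ p z : S3, (⟨p * z, by simp⟩ : S3) ∈ parallel (.inl v) p ↔
      imL v * (z : ℍ[ℝ]) = z * imL v := by
    intro v p z
    simp only [parallel, Set.mem_ofPred_eq, ← mul_assoc, mul_assoc _ (star (p : ℍ[ℝ])) (p : ℍ[ℝ]),
      S3_star_mul, mul_one, one_mul]
  have right : ∀ u : S2, ∀ p z : S3, (⟨z * p, by simp⟩ : S3) ∈ parallel (.inr u) p ↔
      imL u * (z : ℍ[ℝ]) = z * imL u := by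
    intro u p z
    simp only [parallel, Set.mem_ofPred_eq, mul_assoc (z : ℍ[ℝ]) (p : ℍ[ℝ]), S3_mul_star, mul_one]
  cases τ with
  | inl v =>
    cases τ' with
    | inl v' =>
      have h0 := h.self_of_nhds
      funext p
      ext y
      have := left v q ⟨star (p : ℍ[ℝ]) * y, by simp⟩
      rw [h0, left v' q] at this
      exact this.symm
    | inr u => exact absurd h mixed
  | inr u =>
    cases τ' with
    | inl v => exact absurd (h.mono fun p hp => hp.symm) mixed
    | inr u' =>
      have h0 := h.self_of_nhds
      funext p
      ext y
      have := right u q ⟨y * star (p : ℍ[ℝ]), by simp⟩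
      rw [h0, right u' q] at this
      exact this.symm

/-- Each point of `W` has a neighborhood in which the fibers are parallel. -/
lemma exists_eventually_parallel_mem (hF : IsGreatCircleFibration W F) (hC2 : HasC2GraphMap F)
    (hhom : LocallyFiberwiseHomogeneous F) {q : S3} (hq : q ∈ W) :
    ∃ τ, ∀ᶠ p in 𝓝 q, parallel τ p ∈ F := by
  rw [← hF.sUnion_eq] at hq
  obtain ⟨C, hC, hqC⟩ := hq
  obtain ⟨u, v, rfl, h⟩ := exists_constant_coord hF hC2 hhom hC
  have hq' : imL u * (q : ℍ[ℝ]) = q * imL v := hqC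
  rcases h with h | h
  · refine ⟨.inl v, ?_⟩
    have hu : conjS2 q v = u := by
      apply Subtype.ext
      apply imL_injective
      rw [imL_conjS2 (norm_S3 q), ← hq', mul_assoc, S3_mul_star, mul_one]
    have hc : ContinuousAt (fun p : S3 => conjS2 p v) q :=
      ContinuousAt.comp (f := fun p : S3 => (p : ℍ[ℝ])) (continuousAt_conjS2 (norm_S3 q) v)
        continuous_subtype_val.continuousAt
    simp only [ContinuousAt, hu] at hc
    filter_upwards [hc.eventually h] with p hp
    rwa [← circleOf_eq_parallel_inl (imL_conjS2 (norm_S3 p) v)]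
  · refine ⟨.inr u, ?_⟩
    have hsn : ∀ p : S3, ‖star (p : ℍ[ℝ])‖ = 1 := fun p => by rw [Quaternion.norm_star, norm_S3]
    have hv : conjS2 (star (q : ℍ[ℝ])) u = v := by
      apply Subtype.ext
      apply imL_injective
      rw [imL_conjS2 (hsn q), star_star, mul_assoc, hq', ← mul_assoc, S3_star_mul, one_mul]
    have hc : ContinuousAt (fun p : S3 => conjS2 (star (p : ℍ[ℝ])) u) q :=
      ContinuousAt.comp (f := fun p : S3 => star (p : ℍ[ℝ])) (continuousAt_conjS2 (hsn q) u)
        (by fun_prop)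
    simp only [ContinuousAt, hv] at hc
    filter_upwards [hc.eventually h] with p hp
    rwa [← circleOf_eq_parallel_inr (u := u)
      (by rw [imL_conjS2 (hsn p), star_star])]

lemma IsGreatCircleFibration.eq_of_mem (hF : IsGreatCircleFibration W F) {C D : Set S3}
    (hC : C ∈ F) (hD : D ∈ F) {q : S3} (hqC : q ∈ C) (hqD : q ∈ D) : C = D := by
  by_contra hne
  exact Set.disjoint_left.1 (hF.pairwiseDisjoint _ hC _ hD hne) hqC hqD

/-- A locally fiberwise homogeneous fibration of a connected set consists of parallel circles. -/
theorem exists_forall_eq_parallel (hW : IsConnected W) (hF : IsGreatCircleFibration W F)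
    (hC2 : HasC2GraphMap F) (hhom : LocallyFiberwiseHomogeneous F) :
    ∃ τ, ∀ C ∈ F, ∃ q, C = parallel τ q := by
  have huniq : ∀ {τ τ' : S2 ⊕ S2} {q : S3}, (∀ᶠ p in 𝓝 q, parallel τ p ∈ F) →
      (∀ᶠ p in 𝓝 q, parallel τ' p ∈ F) → parallel τ = parallel τ' := by
    intro τ τ' q h h'
    refine parallel_inj_of_eventually_eq (q := q) ?_
    filter_upwards [h, h'] with p hp hp'
    exact hF.eq_of_mem hp hp' (mem_parallel τ p) (mem_parallel τ' p)
  obtain ⟨q₀, hq₀⟩ := hW.nonempty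
  obtain ⟨τ, hτ⟩ := exists_eventually_parallel_mem hF hC2 hhom hq₀
  refine ⟨τ, ?_⟩
  -- The points near which the fibers belong to the family of `τ` form an open set, disjoint from
  -- the analogous open sets of the other families; together these cover the connected set `W`.
  have hsub : W ⊆ {q | ∀ᶠ p in 𝓝 q, parallel τ p ∈ F} := by
    refine hW.isPreconnected.subset_left_of_subset_union
      (v := ⋃ σ ∈ {σ | parallel τ ≠ parallel σ}, {q | ∀ᶠ p in 𝓝 q, parallel σ p ∈ F})
      isOpen_setOfPred_eventually_nhds
      (isOpen_biUnion fun σ _ => isOpen_setOfPred_eventually_nhds) ?_ ?_ ⟨q₀, hq₀, hτ⟩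
    · rw [Set.disjoint_left]
      intro q hq hq'
      simp only [Set.mem_iUnion] at hq'
      obtain ⟨σ, hσ, hσq⟩ := hq'
      exact hσ (huniq hq hσq)
    · intro q hq
      obtain ⟨σ, hσ⟩ := exists_eventually_parallel_mem hF hC2 hhom hq
      by_cases h : parallel τ = parallel σ
      · left; rwa [Set.mem_ofPred_eq, h]
      · right; simp only [Set.mem_iUnion]; exact ⟨σ, h, hσ⟩
  intro C hC
  obtain ⟨x, y, hx, rfl⟩ := hC2.exists_coord hC
  obtain ⟨u, v, huv, -⟩ := exists_constant_coord hF hC2 hhom hC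
  obtain ⟨q, hq⟩ : (circV x y).Nonempty := by
    rw [← huv]
    exact circV_nonempty (S2_ne_zero u) ((S2_norm u).trans (S2_norm v).symm)
  have hqW : q ∈ W := hF.sUnion_eq ▸ ⟨_, hC, hq⟩
  exact ⟨q, hF.eq_of_mem hC (hsub hqW).self_of_nhds hq (mem_parallel τ q)⟩

end Parallel

/-! ### Parallel circles as Hopf fibers. -/

section Hopf

/-- The first standard basis vector. -/
def stdI : E3 := EuclideanSpace.single 0 1

lemma exists_coeComplex_of_commute {q : ℍ[ℝ]} (h : imL stdI * q = q * imL stdI) :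
    ∃ z : ℂ, q = (z : ℍ[ℝ]) := by
  have e1 := congrArg (fun q : ℍ[ℝ] => q.imJ) h
  have e2 := congrArg (fun q : ℍ[ℝ] => q.imK) h
  simp [stdI] at e1 e2
  refine ⟨⟨q.re, q.imI⟩, ?_⟩
  ext <;> simp <;> linarith

lemma coeComplex_commute (z : ℂ) : imL stdI * (z : ℍ[ℝ]) = z * imL stdI := by
  ext <;> simp [stdI]

lemma exists_intertwine_stdI (v : S2) : ∃ b : S3, imL v * (b : ℍ[ℝ]) = b * imL stdI :=
  circV_nonempty (S2_ne_zero v) (by rw [S2_norm]; simp [stdI])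

/-- Conjugation by `b` takes `i` to `v`, hence the centralizer `ℂ` of `i` to that of `v`. -/
lemma commute_conj_iff {v : S2} {b : S3} (hb : imL v * (b : ℍ[ℝ]) = b * imL stdI) (q : ℍ[ℝ]) :
    imL v * q = q * imL v ↔ ∃ z : ℂ, q = b * z * star (b : ℍ[ℝ]) := by
  have hb' : star (b : ℍ[ℝ]) * imL v = imL stdI * star (b : ℍ[ℝ]) := by
    have := congrArg star hb
    rw [star_mul, star_mul, star_imL, star_imL, mul_neg, neg_mul] at this
    exact neg_injective this
  constructor
  · intro h
    obtain ⟨z, hz⟩ := exists_coeComplex_of_commute (q := star (b : ℍ[ℝ]) * q * b) (by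
      rw [← mul_assoc, ← mul_assoc, ← hb', mul_assoc _ (imL (v : E3)) q, h, mul_assoc _ (b : ℍ[ℝ]),
        ← hb]
      simp only [mul_assoc])
    refine ⟨z, ?_⟩
    rw [← hz]
    simp only [mul_assoc, S3_mul_star, mul_one]
    rw [← mul_assoc, S3_mul_star, one_mul]
  · rintro ⟨z, rfl⟩
    rw [← mul_assoc, ← mul_assoc, hb, mul_assoc _ (star (b : ℍ[ℝ])), hb', mul_assoc _ (imL stdI),
      coeComplex_commute]
    simp only [mul_assoc]

/-- Parallel great circles are fibers of a Hopf fibration. -/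
theorem exists_isHopfFibration_parallel (τ : S2 ⊕ S2) :
    ∃ H, IsHopfFibration H ∧ ∀ q, parallel τ q ∈ H := by
  cases τ with
  | inl v =>
    obtain ⟨b, hb⟩ := exists_intertwine_stdI v
    -- The circle through `q` is cut out by `q b ℂ b⁻¹`, the image under right multiplication by
    -- `b⁻¹` of the complex line of `q b`.
    let T : ℍ[ℝ] →ₗᵢ[ℝ] ℍ[ℝ] :=
      { toLinearMap := LinearMap.mulRight ℝ (star (b : ℍ[ℝ]))
        norm_map' := fun q => by simp }
    refine ⟨_, ⟨T.toLinearIsometryEquiv rfl, rfl⟩, fun q => ?_⟩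
    have hT : ∀ x, T.toLinearIsometryEquiv rfl x = x * star (b : ℍ[ℝ]) := fun x => rfl
    refine ⟨_, ⟨⟨q * b, by simp⟩, rfl⟩, ?_⟩
    ext y
    simp only [parallel, Set.mem_ofPred_eq, commute_conj_iff hb, hT]
    constructor
    · rintro ⟨z, hz⟩
      have hy : (y : ℍ[ℝ]) = q * b * z * star (b : ℍ[ℝ]) := by
        rw [mul_assoc (q : ℍ[ℝ]), mul_assoc (q : ℍ[ℝ]), ← hz, ← mul_assoc, S3_mul_star, one_mul]
      have hyb : (y : ℍ[ℝ]) * b = q * b * z := by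
        rw [hy, mul_assoc _ (star (b : ℍ[ℝ])), S3_star_mul, mul_one]
      refine ⟨⟨y * b, by simp⟩, ⟨z, hyb⟩, ?_⟩
      exact hy.trans (congrArg (· * star (b : ℍ[ℝ])) hyb.symm)
    · rintro ⟨x, ⟨z, hx⟩, hy⟩
      refine ⟨z, ?_⟩
      rw [hy, hx]
      simp only [← mul_assoc, S3_star_mul, one_mul]
  | inr u =>
    obtain ⟨b, hb⟩ := exists_intertwine_stdI u
    -- Here the circle lies in `b ℂ b⁻¹ q`. Quaternionic conjugation exchanges left and right
    -- multiplication, so `x ↦ b * star x` carries the complex line of `star q * b` onto this plane.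
    let T : ℍ[ℝ] →ₗᵢ[ℝ] ℍ[ℝ] :=
      { toFun := fun q => b * star q
        map_add' := fun p q => by rw [star_add, mul_add]
        map_smul' := fun c q => by simp
        norm_map' := fun q => by
          change ‖(b : ℍ[ℝ]) * star q‖ = ‖q‖
          simp }
    refine ⟨_, ⟨T.toLinearIsometryEquiv rfl, rfl⟩, fun q => ?_⟩
    have hT : ∀ x, T.toLinearIsometryEquiv rfl x = b * star x := fun x => rfl
    refine ⟨_, ⟨⟨star (q : ℍ[ℝ]) * b, by simp⟩, rfl⟩, ?_⟩
    ext y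
    simp only [parallel, Set.mem_ofPred_eq, commute_conj_iff hb, hT]
    have hstar : ∀ z : ℂ, star (z : ℍ[ℝ]) = ((starRingEnd ℂ z : ℂ) : ℍ[ℝ]) := by
      intro z
      ext <;> simp
    constructor
    · rintro ⟨z, hz⟩
      have hy : (y : ℍ[ℝ]) = b * z * star (b : ℍ[ℝ]) * q := by
        rw [← hz, mul_assoc, S3_star_mul, mul_one]
      refine ⟨⟨star (y : ℍ[ℝ]) * b, by simp⟩, ⟨starRingEnd ℂ z, ?_⟩, ?_⟩
      · simp only [hy, star_mul, star_star, hstar, mul_assoc, S3_star_mul, mul_one]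
      · simp only [star_mul, star_star]
        rw [← mul_assoc, S3_mul_star, one_mul]
    · rintro ⟨x, ⟨z, hx⟩, hy⟩
      refine ⟨starRingEnd ℂ z, ?_⟩
      rw [hy, hx]
      simp only [star_mul, star_star, hstar, mul_assoc, S3_mul_star, mul_one]

end Hopf
end GreatCircle
end

theorem mainTheorem2 (W : Set GreatCircle.S3) (F : Set (Set GreatCircle.S3))
    (hWopen : IsOpen W) (hWconn : IsConnected W)
    (hF : GreatCircle.IsGreatCircleFibration W F)
    (hC2 : GreatCircle.HasC2GraphMap F)
    (hhom : GreatCircle.LocallyFiberwiseHomogeneous F) :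
    ∃ H : Set (Set GreatCircle.S3), GreatCircle.IsHopfFibration H ∧ F ⊆ H := by
  obtain ⟨τ, hτ⟩ := GreatCircle.exists_forall_eq_parallel hWconn hF hC2 hhom
  obtain ⟨H, hH, hp⟩ := GreatCircle.exists_isHopfFibration_parallel τ
  refine ⟨H, hH, fun C hC => ?_⟩
  obtain ⟨q, rfl⟩ := hτ C hC
  exact hp q
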